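/- Let $0<a<1$ and $0<\kappa\le 1$. For $q\in(-1,1)$ put $\underline a(q)=\min\{a,\ \kappa|q-1|,\ \kappa|q+1|\}$. Initial data: $f_I\in C^2([-1,1])$ has exactly one zero $p_I\in(-1,1)$, with $f_I>0$ on $[-1,p_I)$ and $f_I<0$ on $(p_I,1]$; $f_I'(\pm1)=0$; $\lambda_I:=-f_I'(p_I)>0$; and there is $0<a_0<a/4$ with $-f_I'(x)>\tfrac12\lambda_I$ for all $x\in[-1,1]$ with $|x-p_I|<a_0$. Consider the free boundary problem (P) $$f_t-f_{xx}=\lambda(t)\left[\delta_{p(t)-\underline a(p(t))}-\delta_{p(t)+\underline a(p(t))}\right],\qquad \lambda(t)=-f_x(p(t),t),$$ on $(-1,1)$ with homogeneous Neumann conditions at $x=\pm1$ and $f(\cdot,0)=f_I$, where $p(t)$ is the zero of $f(\cdot,t)$. Let $K(x,t)=(4\pi t)^{-1/2}e^{-x^2/(4t)}$ and let $\Gamma(x,x';t)=\sum_{k\in\mathbb Z}K\big(x-(2k+(-1)^{|k|}x'),t\big)$ be the Neumann heat kernel of $(-1,1)$. For $0<T<\infty$, a solution of (P) on $[0,T)$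 is a pair $(f,p)$ such that: 1. $f(\cdot,0)=f_I$ on $[-1,1]$, and $f(\cdot,t)\to f_I$ uniformly on $[-1,1]$ as $t\downarrow0$; 2. for every $t\in[0,T)$, $p(t)\in(-1,1)$ and $\{x\in[-1,1]: f(x,t)=0\}=\{p(t)\}$; 3. for every $t\in(0,T)$, $f$ is $C^\infty$ in $(x,t)$ at $(p(t),t)$ and $\lambda(t)>0$; moreover $\lambda$ is integrable on $[0,t]$ for every $t<T$; 4. (Duhamel's formula) for all $t\in(0,T)$ and $x\in[-1,1]$, $$f(x,t)=\int_{-1}^{1}\Gamma(x,x';t)f_I(x')\,dx'+\int_0^t\Big[\Gamma\big(x,p(s)-\underline a(p(s));t-s\big)-\Gamma\big(x,p(s)+\underline a(p(s));t-s\big)\Big]\lambda(s)\,ds .$$ **Statement.** Let $0<T<\infty$ and let $(f,p)$ be a solution of (P) on $[0,T)$. Then there is $\varepsilon>0$ such that $$p(t)\in[-1+\varepsilon,\,1-\varepsilon]\qquad\text{for all }0\le t<T,$$ and every limit point of $p(t)$ as $t\uparrow T$ also lies in $[-1+\varepsilon,1-\varepsilon]$ (so the bound includes $t=T$ whenever the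 solution, with continuous $p$, exists up to and including time $T$). Thus the free boundary stays away from the Neumann boundaries $x=\pm1$. -/

import Mathlib

open Set Filter Topology MeasureTheory
open scoped ContDiff

namespace PriceFormation

noncomputable section

/-- The heat kernel `K(x,t) = (4πt)^{-1/2} exp(-x²/(4t))` on the real line. -/
def heatKernel (x t : ℝ) : ℝ :=
  1 / Real.sqrt (4 * Real.pi * t) * Real.exp (-x ^ 2 / (4 * t))

/-- The Neumann heat kernel of `(-1,1)`, by the method of images:
`Γ(x,x';t) = ∑_{k ∈ ℤ} K(x - (2k + (-1)^{|k|} x'), t)`. -/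
def neumannKernel (x x' t : ℝ) : ℝ :=
  ∑' k : ℤ, heatKernel (x - (2 * (k : ℝ) + (-1) ^ k.natAbs * x')) t

/-- The jump length `min {a, κ |q - 1|, κ |q + 1|}` for a price `q`. -/
def jump (κ a q : ℝ) : ℝ :=
  min a (κ * min |q - 1| |q + 1|)

/-- The flux `λ(t) = -f_x(p(t), t)` across the free boundary. -/
def flux (f : ℝ → ℝ → ℝ) (p : ℝ → ℝ) (t : ℝ) : ℝ :=
  -deriv (fun x => f x t) (p t)

/-- Admissible initial data `fI ∈ C²([-1,1])` with zero `pI`. Derivatives are one-sided at `±1`. -/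
structure IsInitialDatum (a : ℝ) (fI : ℝ → ℝ) (pI : ℝ) : Prop where
  contDiffOn : ContDiffOn ℝ 2 fI (Icc (-1) 1)
  zero_mem : pI ∈ Ioo (-1 : ℝ) 1
  zero : fI pI = 0
  pos_left : ∀ x ∈ Icc (-1 : ℝ) 1, x < pI → 0 < fI x
  neg_right : ∀ x ∈ Icc (-1 : ℝ) 1, pI < x → fI x < 0
  neumann_left : derivWithin fI (Icc (-1) 1) (-1) = 0
  neumann_right : derivWithin fI (Icc (-1) 1) 1 = 0
  flux_pos : 0 < -derivWithin fI (Icc (-1) 1) pI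
  slope : ∃ a₀ : ℝ, 0 < a₀ ∧ a₀ < a / 4 ∧
    ∀ x ∈ Icc (-1 : ℝ) 1, x ∈ Ioo (pI - a₀) (pI + a₀) →
      1 / 2 * -derivWithin fI (Icc (-1) 1) pI < -derivWithin fI (Icc (-1) 1) x

/-- `(f, p)` is a classical solution, on the half-open time interval `[0,T)`, of
`f_t - f_xx = λ(t) (δ_{p(t) - jump} - δ_{p(t) + jump})` on `(-1,1)`, with Neumann boundary
conditions at `x = ±1` and initial datum `fI`, where `p(t)` is the only zero of `f(·,t)`.
The equation and the boundary conditions are expressed by Duhamel's formula.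
Only the values `f x t` with `x ∈ [-1,1]` and `t ∈ [0,T)` matter. -/
structure IsSolution (κ a : ℝ) (fI : ℝ → ℝ) (T : ℝ) (f : ℝ → ℝ → ℝ) (p : ℝ → ℝ) : Prop where
  /-- The initial condition. -/
  initial : ∀ x ∈ Icc (-1 : ℝ) 1, f x 0 = fI x
  /-- The initial datum is attained uniformly. -/
  tendsto_initial : TendstoUniformlyOn (fun t x => f x t) fI (𝓝[>] 0) (Icc (-1) 1)
  /-- The free boundary lies inside the domain. -/
  mem : ∀ t ∈ Ico 0 T, p t ∈ Ioo (-1 : ℝ) 1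
  /-- The zero set of `f(·,t)` is exactly `{p(t)}`. -/
  zero_iff : ∀ t ∈ Ico 0 T, ∀ x ∈ Icc (-1 : ℝ) 1, f x t = 0 ↔ x = p t
  /-- `f` is smooth in `(x,t)` at the free boundary. -/
  smooth : ∀ t ∈ Ioo 0 T, ContDiffAt ℝ ∞ (fun z : ℝ × ℝ => f z.1 z.2) (p t, t)
  /-- The free boundary is nondegenerate. -/
  flux_pos : ∀ t ∈ Ioo 0 T, 0 < flux f p t
  /-- The flux is integrable on every `[0,t]` with `t < T`. -/
  flux_integrable : ∀ t ∈ Ioo 0 T, IntervalIntegrable (flux f p) volume 0 t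
  /-- Duhamel's formula. -/
  duhamel : ∀ t ∈ Ioo 0 T, ∀ x ∈ Icc (-1 : ℝ) 1,
    f x t = (∫ x' in (-1 : ℝ)..1, neumannKernel x x' t * fI x') +
      ∫ s in (0 : ℝ)..t,
        (neumannKernel x (p s - jump κ a (p s)) (t - s) -
          neumannKernel x (p s + jump κ a (p s)) (t - s)) * flux f p s

end

end PriceFormation

namespace PriceFormation

/-! ### The heat kernel and the Neumann kernel -/

/-! The free boundary `p` separates a left phase of density `f` from a right phase of density `-f`.
Flux `λ` leaves both phases at `p` and is reinserted at distance `j = jump κ a p`, at `p - j` on the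
left and `p + j` on the right, so each phase conserves its mass, `M₁` and `M₂`. It is enough to keep
`p` from the wall `1` as `t ↑ T`: `IsFreeBoundary.reflect` exchanges the walls, and compactness
together with the initial data covers the other times.

Let `w = defect`, comparable to `(1-x)²`. The right phase lies in `w ≤ w(p)`, so `N = ∫ -f w/(r+w)`
over it is at most `w(p) M₂ / r`. A positive lower bound on `N` near time `T`, for one fixed `r`,
therefore bounds `w(p)` from below. Diffusion relaxes `N` upwards to the level `(1-r)M₂/6` on the
time scale `r`; only the jumps from `p` to `p + j` lower it.

These losses are paid for by the left phase, where the same flux moves mass from `p` to `p - j`,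
away from the wall. By `loss_le`, the loss is at most 48 times the drop of the potential `X = ∫ f
(log(R+w) - log(r+w))` plus `3/R` times the rise of `V = ∫ f w`, both over the left phase. Both
budgets are small near `T`. The function `V + kpi M₁ t` is monotone and bounded, so its late
increments vanish. The left phase cannot concentrate at the wall: `exists_lint_inv_le` bounds `∫
f/(r+w)` by `C r^(-3/4)`, and integrating in `r` gives `X ≤ 4 C R^(1/4)`. `lyapunov_le` combines the
three quantities, and `exists_le_defect` chooses `R` and then `r` so that on `[T-r, T)` relaxation
beats the losses.

The evolution laws of these integrals come from Duhamel's formula. Against functions even about both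
walls the Neumann kernel unfolds to a Gaussian average on the line, which yields a weak formulation
(`weak_eq`); smoothness of `f` near `p` then splits it into one formulation for each phase
(`hasDerivAt_left`, `hasDerivAt_right`). -/

lemma heatKernel_nonneg (x t : ℝ) : 0 ≤ heatKernel x t := by
  unfold heatKernel; positivity

lemma heatKernel_neg (x t : ℝ) : heatKernel (-x) t = heatKernel x t := by
  simp [heatKernel]

lemma measurable_heatKernel : Measurable fun z : ℝ × ℝ => heatKernel z.1 z.2 := by
  unfold heatKernel; fun_prop

lemma continuous_heatKernel (t : ℝ) : Continuous fun x => heatKernel x t := by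
  unfold heatKernel; fun_prop

/-- Default values: the square root of a nonpositive number is `0`, and so is `1 / 0`. Hence the
image series converges at every time, and measurability needs no restriction on `t`. -/
lemma heatKernel_of_nonpos (x : ℝ) {t : ℝ} (ht : t ≤ 0) : heatKernel x t = 0 := by
  have : Real.sqrt (4 * Real.pi * t) = 0 :=
    Real.sqrt_eq_zero_of_nonpos (by nlinarith [Real.pi_pos])
  simp [heatKernel, this]

lemma heatKernel_image_le {x x' r t T : ℝ} (ht : 0 < t) (htT : t ≤ T)
    (hr : |x| + |x'| ≤ r) (k : ℤ) :
    heatKernel (x - (2 * (k : ℝ) + (-1) ^ k.natAbs * x')) t ≤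
      1 / Real.sqrt (4 * Real.pi * t) * Real.exp ((r ^ 2 - (k : ℝ) ^ 2) / (4 * T)) := by
  unfold heatKernel
  refine mul_le_mul_of_nonneg_left (Real.exp_le_exp.2 ?_) (by positivity)
  have he : |(-1 : ℝ) ^ k.natAbs * x'| = |x'| := by simp [abs_mul]
  generalize (-1 : ℝ) ^ k.natAbs * x' = y at he
  have hu : (x - y) ^ 2 ≤ r ^ 2 := by
    apply sq_le_sq'
    · have := neg_abs_le x; have := le_abs_self y; linarith
    · have := le_abs_self x; have := neg_abs_le y; linarith
  -- With `u = x - y` this follows from `3k² - 4ku + 2u² ≥ 0`, by completing the square.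
  have hw : (k : ℝ) ^ 2 - r ^ 2 ≤ (x - (2 * (k : ℝ) + y)) ^ 2 := by
    nlinarith [sq_nonneg (3 * (k : ℝ) - 2 * (x - y)), sq_nonneg (x - y)]
  have hT : 0 < T := ht.trans_le htT
  calc -(x - (2 * (k : ℝ) + y)) ^ 2 / (4 * t)
      ≤ -(x - (2 * (k : ℝ) + y)) ^ 2 / (4 * T) := by
        rw [neg_div, neg_div, neg_le_neg_iff]
        gcongr
    _ ≤ (r ^ 2 - (k : ℝ) ^ 2) / (4 * T) := by
        gcongr
        linarith

lemma summable_exp_sub_sq (r : ℝ) {T : ℝ} (hT : 0 < T) :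
    Summable fun k : ℤ => Real.exp ((r ^ 2 - (k : ℝ) ^ 2) / (4 * T)) := by
  have key : Summable fun n : ℕ => Real.exp ((r ^ 2 - (n : ℝ) ^ 2) / (4 * T)) := by
    have h1 : Summable fun n : ℕ => Real.exp (n * (-(1 / (4 * T)))) :=
      Real.summable_exp_nat_mul_iff.2 (by simp; positivity)
    refine Summable.of_nonneg_of_le (fun n => (Real.exp_pos _).le) (fun n => ?_)
      (h1.mul_left (Real.exp (r ^ 2 / (4 * T))))
    rw [← Real.exp_add]
    gcongr
    rw [sub_div, sub_eq_add_neg]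
    gcongr
    have : (n : ℝ) ≤ (n : ℝ) ^ 2 := by exact_mod_cast Nat.le_self_pow two_ne_zero n
    rw [← neg_div, mul_neg, mul_one_div, ← neg_div]
    gcongr
  refine summable_int_iff_summable_nat_and_neg.2 ⟨?_, ?_⟩
  · simpa using key
  · simpa using key

lemma summable_heatKernel_image (x x' t : ℝ) :
    Summable fun k : ℤ => heatKernel (x - (2 * (k : ℝ) + (-1) ^ k.natAbs * x')) t := by
  rcases le_or_gt t 0 with ht | ht
  · simp [heatKernel_of_nonpos _ ht, summable_zero]
  · exact Summable.of_nonneg_of_le (fun k => heatKernel_nonneg _ _)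
      (fun k => heatKernel_image_le ht le_rfl le_rfl k)
      ((summable_exp_sub_sq _ ht).mul_left _)

lemma neumannKernel_nonneg (x x' t : ℝ) : 0 ≤ neumannKernel x x' t :=
  tsum_nonneg fun _ => heatKernel_nonneg _ _

lemma measurable_neumannKernel :
    Measurable fun z : ℝ × ℝ × ℝ => neumannKernel z.1 z.2.1 z.2.2 := by
  refine measurable_of_tendsto_metrizable' (u := (atTop : Filter (Finset ℤ)))
    (f := fun (s : Finset ℤ) z => ∑ k ∈ s, heatKernel (z.1 - (2 * (k : ℝ) + (-1) ^ k.natAbs * z.2.1)) z.2.2)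
    (fun s => Finset.measurable_sum s fun k _ => ?_) ?_
  · exact measurable_heatKernel.comp
      (f := fun z : ℝ × ℝ × ℝ => (z.1 - (2 * (k : ℝ) + (-1) ^ k.natAbs * z.2.1), z.2.2))
      (by fun_prop)
  · rw [tendsto_pi_nhds]
    exact fun z => (summable_heatKernel_image z.1 z.2.1 z.2.2).hasSum

/-- The singularity `t^(-1/2)` is integrable in time; the space-time Fubini arguments for Duhamel
terms rest on it. -/
lemma exists_neumannKernel_le {T : ℝ} (hT : 0 < T) :
    ∃ C : ℝ, 0 < C ∧ ∀ x ∈ Icc (-1 : ℝ) 1, ∀ x' ∈ Icc (-1 : ℝ) 1, ∀ t ∈ Ioc 0 T,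
      neumannKernel x x' t ≤ C / Real.sqrt t := by
  have hs := summable_exp_sub_sq 2 hT
  refine ⟨∑' k : ℤ, Real.exp ((2 ^ 2 - (k : ℝ) ^ 2) / (4 * T)),
    hs.tsum_pos (fun _ => (Real.exp_pos _).le) 0 (Real.exp_pos _), fun x hx x' hx' t ht => ?_⟩
  have hr : |x| + |x'| ≤ 2 := by
    have := abs_le.2 hx; have := abs_le.2 hx'; linarith
  have h1 : neumannKernel x x' t ≤
      ∑' k : ℤ, 1 / Real.sqrt t * Real.exp ((2 ^ 2 - (k : ℝ) ^ 2) / (4 * T)) := by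
    refine (summable_heatKernel_image x x' t).tsum_le_tsum (fun k => ?_) (hs.mul_left _)
    refine (heatKernel_image_le ht.1 ht.2 hr k).trans ?_
    have := Real.sqrt_pos.2 ht.1
    gcongr
    nlinarith [Real.pi_gt_three, ht.1]
  rw [tsum_mul_left] at h1
  calc _ ≤ _ := h1
    _ = _ := by ring

lemma continuousOn_neumannKernel (x' t : ℝ) :
    ContinuousOn (fun x => neumannKernel x x' t) (Icc (-1) 1) := by
  rcases le_or_gt t 0 with ht | ht
  · simp only [neumannKernel, heatKernel_of_nonpos _ ht, tsum_zero]
    exact continuousOn_const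
  · refine continuousOn_tsum (u := fun k : ℤ => 1 / Real.sqrt (4 * Real.pi * t) *
        Real.exp (((1 + |x'|) ^ 2 - (k : ℝ) ^ 2) / (4 * t))) (fun k => ?_)
        ((summable_exp_sub_sq _ ht).mul_left _) (fun k x hx => ?_)
    · exact ((continuous_heatKernel t).comp (by fun_prop)).continuousOn
    · rw [Real.norm_of_nonneg (heatKernel_nonneg _ _)]
      refine heatKernel_image_le ht le_rfl ?_ k
      have := abs_le.2 hx; linarith

/-! ### Test functions compatible with the Neumann conditions -/

/-- Smooth functions on the line that are even about both end points of `[-1,1]`. -/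
structure IsTest (ψ : ℝ → ℝ) : Prop where
  smooth : ContDiff ℝ ∞ ψ
  even_right : ∀ x, ψ (2 - x) = ψ x
  even_left : ∀ x, ψ (-2 - x) = ψ x

/-- The two reflections compose to a translation by 4, so bounds reduce to a compact interval. -/
lemma IsTest.periodic {ψ : ℝ → ℝ} (h : IsTest ψ) : Function.Periodic ψ 4 := fun x => by
  have := h.even_right (x + 4)
  rw [← this, ← h.even_left x]; ring_nf

lemma IsTest.continuous {ψ : ℝ → ℝ} (h : IsTest ψ) : Continuous ψ := h.smooth.continuous

lemma IsTest.exists_bound {ψ : ℝ → ℝ} (h : IsTest ψ) : ∃ C : ℝ, 0 ≤ C ∧ ∀ x, |ψ x| ≤ C := by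
  obtain ⟨C, hC⟩ := isCompact_Icc.exists_bound_of_continuousOn (s := Icc (0 : ℝ) 4)
    h.continuous.continuousOn
  refine ⟨C, (norm_nonneg _).trans (hC 0 (by norm_num)), fun x => ?_⟩
  obtain ⟨y, hy, hxy⟩ := h.periodic.exists_mem_Ico₀ (by norm_num) x
  rw [hxy]
  exact hC y ⟨hy.1, hy.2.le⟩

/-- A reflection changes the sign of `ψ'` and restores it in `ψ''`, so the class is stable under the
spatial operator. -/
lemma IsTest.deriv_deriv {ψ : ℝ → ℝ} (h : IsTest ψ) : IsTest (deriv (deriv ψ)) := by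
  have hs : ∀ c : ℝ, (∀ x, ψ (c - x) = ψ x) → ∀ x, deriv (deriv ψ) (c - x) = deriv (deriv ψ) x := by
    intro c hc x
    have h1 : (fun x => ψ (c - x)) = ψ := funext hc
    have h2 : deriv ψ = fun x => -deriv ψ (c - x) := by
      conv_lhs => rw [← h1]
      funext x; rw [deriv_comp_const_sub]
    conv_rhs => rw [h2]
    rw [deriv.fun_neg, deriv_comp_const_sub, neg_neg]
  have hd : ContDiff ℝ ∞ (deriv ψ) := by
    simpa using h.smooth.iterate_deriv 1
  exact ⟨by simpa using hd.iterate_deriv 1, hs _ h.even_right, hs _ h.even_left⟩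

/-! ### Unfolding the Neumann kernel to the whole line -/

lemma integrable_heatKernel {t : ℝ} (ht : 0 < t) : Integrable fun z => heatKernel z t := by
  have := (integrable_exp_neg_mul_sq (b := 1 / (4 * t)) (by positivity)).const_mul
    (1 / Real.sqrt (4 * Real.pi * t))
  refine this.congr (ae_of_all _ fun z => ?_)
  simp only [heatKernel]
  congr 2; field_simp

lemma integral_heatKernel {t : ℝ} (ht : 0 < t) : ∫ z, heatKernel z t = 1 := by
  have : ∀ z, heatKernel z t =
      1 / Real.sqrt (4 * Real.pi * t) * Real.exp (-(1 / (4 * t)) * z ^ 2) := fun z => by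
    simp only [heatKernel]; congr 2; field_simp
  simp_rw [this]
  rw [integral_const_mul, integral_gaussian]
  rw [show Real.pi / (1 / (4 * t)) = 4 * Real.pi * t by field_simp]
  have : 0 < Real.sqrt (4 * Real.pi * t) := Real.sqrt_pos.2 (by have := Real.pi_pos; positivity)
  field_simp

lemma IsTest.integrable_heatKernel_mul {ψ : ℝ → ℝ} (h : IsTest ψ) {t : ℝ} (ht : 0 < t) (y : ℝ) :
    Integrable fun z => heatKernel z t * ψ (y + z) := by
  obtain ⟨C, -, hC⟩ := h.exists_bound
  exact (integrable_heatKernel ht).mul_bdd (c := C)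
    (h.continuous.comp (by fun_prop)).aestronglyMeasurable (ae_of_all _ fun z => hC _)

lemma IsTest.comp_add_two_mul_of_even {ψ : ℝ → ℝ} (h : IsTest ψ) {k : ℤ} (hk : Even k) (x : ℝ) :
    ψ (x + 2 * k) = ψ x := by
  obtain ⟨m, rfl⟩ := hk
  have := h.periodic.int_mul m x
  rw [← this]; push_cast; ring_nf

/-- The index of the image cell that the `k`-th summand of the Neumann kernel covers. -/
def imageIndex (k : ℤ) : ℤ := if Even k then -k else k

lemma imageIndex_involutive : Function.Involutive imageIndex := fun k => by
  unfold imageIndex; split_ifs <;> simp_all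

/-- The substitution is a translation for even `k` and a reflection for odd `k`. The symmetries of
`ψ` absorb it, and the resulting cells of length 2 tile the line. -/
lemma IsTest.integral_image {ψ : ℝ → ℝ} (h : IsTest ψ) (t x' : ℝ) (k : ℤ) :
    ∫ x in (-1 : ℝ)..1, heatKernel (x - (2 * (k : ℝ) + (-1) ^ k.natAbs * x')) t * ψ x =
      ∫ z in (2 * (imageIndex k : ℝ) - 1 - x')..(2 * (imageIndex k : ℝ) + 1 - x'),
        heatKernel z t * ψ (x' + z) := by
  rcases Int.even_or_odd k with hk | hk
  · have h1 : (-1 : ℝ) ^ k.natAbs = 1 := (Int.natAbs_even.2 hk).neg_one_pow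
    have h2 : ∀ x, heatKernel (x - (2 * (k : ℝ) + (-1) ^ k.natAbs * x')) t * ψ x =
        (fun z => heatKernel z t * ψ (x' + z)) (x - (2 * k + x')) := fun x => by
      simp only [h1, one_mul]
      rw [← h.comp_add_two_mul_of_even hk (x' + _)]; ring_nf
    simp_rw [h2]
    rw [intervalIntegral.integral_comp_sub_right (fun z => heatKernel z t * ψ (x' + z))]
    simp only [imageIndex, hk, if_true]
    push_cast
    congr 1 <;> ring
  · have h1 : (-1 : ℝ) ^ k.natAbs = -1 := (Int.natAbs_odd.2 hk).neg_one_pow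
    have h2 : ∀ x, heatKernel (x - (2 * (k : ℝ) + (-1) ^ k.natAbs * x')) t * ψ x =
        (fun z => heatKernel z t * ψ (x' + z)) ((2 * k - x') - x) := fun x => by
      simp only [h1]
      rw [← heatKernel_neg, ← h.even_right x]
      have : Even (k - 1) := by simpa using hk.sub_odd odd_one
      rw [← h.comp_add_two_mul_of_even this]; push_cast; ring_nf
    simp_rw [h2]
    rw [intervalIntegral.integral_comp_sub_left (fun z => heatKernel z t * ψ (x' + z))]
    simp only [imageIndex, Int.not_even_iff_odd.2 hk, if_false]
    congr 1 <;> ring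

lemma Integrable.hasSum_cells {h : ℝ → ℝ} (hi : Integrable h) (y : ℝ) :
    HasSum (fun m : ℤ => ∫ z in (2 * (m : ℝ) - 1 - y)..(2 * (m : ℝ) + 1 - y), h z) (∫ z, h z) := by
  -- Scaling by 2 turns the cells into integer translates of one unit interval.
  have h1 : Integrable fun w => 2 * h (2 * w) := (hi.comp_mul_left' two_ne_zero).const_mul 2
  have h2 := h1.hasSum_intervalIntegral ((-1 - y) / 2)
  have h3 : ∫ w, 2 * h (2 * w) = ∫ z, h z := by
    rw [integral_const_mul, Measure.integral_comp_mul_left h 2]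
    simp
  rw [h3] at h2
  refine (congrArg (HasSum · _) (funext fun m => ?_)).mpr h2
  rw [intervalIntegral.integral_const_mul, intervalIntegral.integral_comp_mul_left h two_ne_zero]
  simp only [smul_eq_mul]
  rw [← mul_assoc, mul_inv_cancel₀ two_ne_zero, one_mul]
  congr 1 <;> ring

/-- Integrating the Neumann kernel against a test function is a Gaussian average. -/
lemma IsTest.integral_neumannKernel_mul {ψ : ℝ → ℝ} (h : IsTest ψ) {t x' : ℝ} (ht : 0 < t) :
    ∫ x in (-1 : ℝ)..1, neumannKernel x x' t * ψ x = ∫ z, heatKernel z t * ψ (x' + z) := by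
  obtain ⟨C, hC0, hC⟩ := h.exists_bound
  have hs := (summable_exp_sub_sq (1 + |x'|) ht).mul_left (1 / Real.sqrt (4 * Real.pi * t))
  have h1 : HasSum (fun k : ℤ => ∫ x in (-1 : ℝ)..1,
      heatKernel (x - (2 * (k : ℝ) + (-1) ^ k.natAbs * x')) t * ψ x)
      (∫ x in (-1 : ℝ)..1, neumannKernel x x' t * ψ x) := by
    refine intervalIntegral.hasSum_integral_of_dominated_convergence
      (bound := fun k _ => 1 / Real.sqrt (4 * Real.pi * t) *
        Real.exp (((1 + |x'|) ^ 2 - (k : ℝ) ^ 2) / (4 * t)) * C) (fun k => ?_) (fun k => ?_)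
      ?_ ?_ ?_
    · exact (((continuous_heatKernel t).comp (by fun_prop)).mul h.continuous).aestronglyMeasurable
    · refine ae_of_all _ fun x hx => ?_
      rw [uIoc_of_le (by norm_num)] at hx
      rw [norm_mul, Real.norm_of_nonneg (heatKernel_nonneg _ _)]
      refine mul_le_mul (heatKernel_image_le ht le_rfl ?_ k) (hC x) (abs_nonneg _) (by positivity)
      have := abs_le.2 ⟨hx.1.le, hx.2⟩; linarith
    · exact ae_of_all _ fun x _ => hs.mul_right C
    · simp
    · exact ae_of_all _ fun x _ => (summable_heatKernel_image x x' t).hasSum.mul_right _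
  have h2 := Integrable.hasSum_cells (h.integrable_heatKernel_mul ht x') x'
  have h3 := (imageIndex_involutive.toPerm.hasSum_iff).2 h2
  refine h1.unique ?_
  refine (congrArg (HasSum · _) (funext fun k => ?_)).mpr h3
  exact h.integral_image t x' k

/-! ### Gaussian averages of test functions -/

/-- The Gaussian average of `ψ` about `x` with variance `2t`. -/
noncomputable def heatAvg (ψ : ℝ → ℝ) (t x : ℝ) : ℝ :=
  ∫ z, heatKernel z 1 * ψ (x + Real.sqrt t * z)

lemma integral_heatKernel_mul_eq_heatAvg (ψ : ℝ → ℝ) {t : ℝ} (ht : 0 < t) (x : ℝ) :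
    ∫ z, heatKernel z t * ψ (x + z) = heatAvg ψ t x := by
  have hs : 0 < Real.sqrt t := Real.sqrt_pos.2 ht
  have h1 : ∀ z, heatKernel z 1 * ψ (x + Real.sqrt t * z) =
      Real.sqrt t * (fun w => heatKernel w t * ψ (x + w)) (Real.sqrt t * z) := fun z => by
    have : heatKernel z 1 = Real.sqrt t * heatKernel (Real.sqrt t * z) t := by
      simp only [heatKernel, mul_one]
      rw [Real.sqrt_mul (by positivity) t, mul_pow, Real.sq_sqrt ht.le,
        show -(t * z ^ 2) / (4 * t) = -z ^ 2 / 4 by field_simp]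
      have : 0 < Real.sqrt (4 * Real.pi) := Real.sqrt_pos.2 (by have := Real.pi_pos; positivity)
      field_simp
    simp only [this]; ring
  unfold heatAvg
  simp_rw [h1]
  rw [integral_const_mul, Measure.integral_comp_mul_left (fun w => heatKernel w t * ψ (x + w)),
    smul_eq_mul, abs_of_pos (inv_pos.2 hs), ← mul_assoc, mul_inv_cancel₀ hs.ne', one_mul]

lemma Function.Periodic.exists_abs_le {g : ℝ → ℝ} (hg : Continuous g) (hp : g.Periodic 4) :
    ∃ C : ℝ, 0 ≤ C ∧ ∀ x, |g x| ≤ C := by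
  obtain ⟨C, hC⟩ := isCompact_Icc.exists_bound_of_continuousOn (s := Icc (0 : ℝ) 4) hg.continuousOn
  refine ⟨C, (norm_nonneg _).trans (hC 0 (by norm_num)), fun x => ?_⟩
  obtain ⟨y, hy, hxy⟩ := hp.exists_mem_Ico₀ (by norm_num) x
  rw [hxy]
  exact hC y ⟨hy.1, hy.2.le⟩

lemma IsTest.contDiff_deriv {ψ : ℝ → ℝ} (h : IsTest ψ) : ContDiff ℝ ∞ (deriv ψ) := by
  simpa using h.smooth.iterate_deriv 1

lemma IsTest.hasDerivAt {ψ : ℝ → ℝ} (h : IsTest ψ) (x : ℝ) : HasDerivAt ψ (deriv ψ x) x :=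
  ((h.smooth.differentiable (by simp)) x).hasDerivAt

lemma IsTest.hasDerivAt_deriv {ψ : ℝ → ℝ} (h : IsTest ψ) (x : ℝ) :
    HasDerivAt (deriv ψ) (deriv (deriv ψ) x) x :=
  ((h.contDiff_deriv.differentiable (by simp)) x).hasDerivAt

lemma IsTest.exists_bound_deriv {ψ : ℝ → ℝ} (h : IsTest ψ) :
    ∃ C : ℝ, 0 ≤ C ∧ ∀ x, |deriv ψ x| ≤ C := by
  refine Function.Periodic.exists_abs_le h.contDiff_deriv.continuous fun x => ?_
  rw [← deriv_comp_add_const]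
  congr 1
  exact funext h.periodic

lemma IsTest.abs_heatAvg_le {ψ : ℝ → ℝ} {C : ℝ} (hC : ∀ x, |ψ x| ≤ C) (t x : ℝ) :
    |heatAvg ψ t x| ≤ C := by
  have h1 : ‖∫ z, heatKernel z 1 * ψ (x + Real.sqrt t * z)‖ ≤ ∫ z, heatKernel z 1 * C := by
    refine norm_integral_le_of_norm_le ((integrable_heatKernel one_pos).mul_const C)
      (ae_of_all _ fun z => ?_)
    rw [norm_mul, Real.norm_of_nonneg (heatKernel_nonneg _ _)]
    exact mul_le_mul_of_nonneg_left (hC _) (heatKernel_nonneg _ _)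
  rwa [integral_mul_const, integral_heatKernel one_pos, one_mul] at h1

/-- With `√t` inside `ψ` instead of the kernel there is no singularity at `t = 0`. For `t < 0`
`Real.sqrt` returns `0`, the average is `ψ` itself, and continuity holds on the whole plane. -/
lemma IsTest.continuous_heatAvg {ψ : ℝ → ℝ} (h : IsTest ψ) :
    Continuous fun q : ℝ × ℝ => heatAvg ψ q.1 q.2 := by
  obtain ⟨C, -, hC⟩ := h.exists_bound
  refine continuous_of_dominated (bound := fun z => heatKernel z 1 * C) (fun q => ?_)
    (fun q => ae_of_all _ fun z => ?_) ((integrable_heatKernel one_pos).mul_const C)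
    (ae_of_all _ fun z => ?_)
  · exact ((continuous_heatKernel 1).mul
      (h.continuous.comp (by fun_prop))).aestronglyMeasurable
  · rw [norm_mul, Real.norm_of_nonneg (heatKernel_nonneg _ _)]
    exact mul_le_mul_of_nonneg_left (hC _) (heatKernel_nonneg _ _)
  · exact continuous_const.mul (h.continuous.comp (by fun_prop))

lemma heatAvg_zero (ψ : ℝ → ℝ) (x : ℝ) : heatAvg ψ 0 x = ψ x := by
  simp [heatAvg, integral_mul_const, integral_heatKernel one_pos]

lemma integrable_heatKernel_mul_abs : Integrable fun z => heatKernel z 1 * |z| := by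
  have := ((integrable_mul_exp_neg_mul_sq (b := 1 / 4) (by norm_num)).abs).const_mul
    (1 / Real.sqrt (4 * Real.pi * 1))
  refine this.congr (ae_of_all _ fun z => ?_)
  simp only [heatKernel, abs_mul, Real.abs_exp]
  rw [show -z ^ 2 / (4 * 1) = -(1 / 4) * z ^ 2 by ring]
  ring

lemma hasDerivAt_heatKernel (z : ℝ) :
    HasDerivAt (fun z => heatKernel z 1) (-(z / 2) * heatKernel z 1) z := by
  unfold heatKernel
  have h1 : HasDerivAt (fun z : ℝ => -z ^ 2 / (4 * 1)) (-(z / 2)) z := by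
    have := ((hasDerivAt_pow 2 z).neg).div_const (4 * 1)
    convert! this using 1
    norm_num; ring
  convert! (h1.exp).const_mul (1 / Real.sqrt (4 * Real.pi * 1)) using 1
  ring

/-- Differentiating `ψ(x + √t z)` in `t` produces `ψ' z/(2√t)`. Since `z K = -2K'` for the kernel
`K` at time 1, integration by parts trades this for `ψ''`. -/
lemma IsTest.hasDerivAt_heatAvg {ψ : ℝ → ℝ} (h : IsTest ψ) {t : ℝ} (ht : 0 < t) (x : ℝ) :
    HasDerivAt (fun s => heatAvg ψ s x) (heatAvg (deriv (deriv ψ)) t x) t := by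
  obtain ⟨C, hC0, hC⟩ := h.exists_bound
  obtain ⟨C₁, hC₁0, hC₁⟩ := h.exists_bound_deriv
  obtain ⟨C₂, hC₂0, hC₂⟩ := h.deriv_deriv.exists_bound
  have hst : 0 < Real.sqrt t := Real.sqrt_pos.2 ht
  have hs2 : 0 < Real.sqrt (t / 2) := Real.sqrt_pos.2 (by linarith)
  have hc0 := h.continuous
  have hc1 := h.contDiff_deriv.continuous
  have hc2 := h.deriv_deriv.continuous
  have hK := continuous_heatKernel 1
  have hzK : Integrable fun z => heatKernel z 1 * z :=
    integrable_heatKernel_mul_abs.mono' (by fun_prop) (ae_of_all _ fun z => by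
      rw [norm_mul, Real.norm_of_nonneg (heatKernel_nonneg _ _), Real.norm_eq_abs])
  have key := hasDerivAt_integral_of_dominated_loc_of_deriv_le (μ := volume)
    (F := fun s z => heatKernel z 1 * ψ (x + Real.sqrt s * z))
    (F' := fun s z => heatKernel z 1 * (deriv ψ (x + Real.sqrt s * z) * (1 / (2 * Real.sqrt s) * z)))
    (x₀ := t) (s := Ioi (t / 2)) (bound := fun z => heatKernel z 1 * |z| * (C₁ * (1 / (2 * Real.sqrt (t / 2)))))
    (Ioi_mem_nhds (by linarith)) (Eventually.of_forall fun s => ?_) ?_ ?_ ?_ ?_ ?_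
  · have h2 := key.2
    have hibp := integral_mul_deriv_eq_deriv_mul_of_integrable
      (u := fun z => deriv ψ (x + Real.sqrt t * z)) (v := fun z => heatKernel z 1)
      (u' := fun z => deriv (deriv ψ) (x + Real.sqrt t * z) * Real.sqrt t)
      (v' := fun z => -(z / 2) * heatKernel z 1) (fun z _ => ?_) (fun z _ => hasDerivAt_heatKernel z)
      ?_ ?_ ?_
    · convert! h2 using 1
      have e1 : ∫ z, deriv ψ (x + Real.sqrt t * z) * (-(z / 2) * heatKernel z 1) =
          -Real.sqrt t * ∫ z, heatKernel z 1 *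
            (deriv ψ (x + Real.sqrt t * z) * (1 / (2 * Real.sqrt t) * z)) := by
        rw [← integral_const_mul]
        congr 1; funext z; field_simp
      have e2 : ∫ z, deriv (deriv ψ) (x + Real.sqrt t * z) * Real.sqrt t * heatKernel z 1 =
          Real.sqrt t * heatAvg (deriv (deriv ψ)) t x := by
        unfold heatAvg
        rw [← integral_const_mul]
        congr 1; funext z; ring
      rw [e1, e2] at hibp
      rw [neg_mul, neg_inj] at hibp
      exact (mul_left_cancel₀ hst.ne' hibp).symm
    · have := (h.hasDerivAt_deriv (x + Real.sqrt t * z)).comp z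
        (((hasDerivAt_id z).const_mul (Real.sqrt t)).const_add x)
      simpa [Function.comp_def] using this
    · have := (hzK.mul_const (-1 / 2)).bdd_mul (f := fun z => deriv ψ (x + Real.sqrt t * z)) (c := C₁)
        (hc1.comp (by fun_prop)).aestronglyMeasurable (ae_of_all _ fun z => hC₁ _)
      refine this.congr (ae_of_all _ fun z => ?_)
      simp only [Pi.mul_apply]; ring
    · have := (integrable_heatKernel one_pos).bdd_mul
        (f := fun z => deriv (deriv ψ) (x + Real.sqrt t * z) * Real.sqrt t) (c := C₂ * Real.sqrt t)
        ((hc2.comp (by fun_prop)).mul continuous_const).aestronglyMeasurable (ae_of_all _ fun z => by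
          rw [norm_mul, Real.norm_of_nonneg hst.le]
          exact mul_le_mul_of_nonneg_right (hC₂ _) hst.le)
      exact this
    · exact (integrable_heatKernel one_pos).bdd_mul
        (f := fun z => deriv ψ (x + Real.sqrt t * z)) (c := C₁)
        (hc1.comp (by fun_prop)).aestronglyMeasurable (ae_of_all _ fun z => hC₁ _)
  · exact (hK.mul (hc0.comp (by fun_prop))).aestronglyMeasurable
  · exact (integrable_heatKernel one_pos).mul_bdd (c := C)
      (hc0.comp (by fun_prop)).aestronglyMeasurable (ae_of_all _ fun z => hC _)
  · exact (hK.mul ((hc1.comp (by fun_prop)).mul (by fun_prop))).aestronglyMeasurable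
  · refine ae_of_all _ fun z s hs => ?_
    have hs' : t / 2 < s := hs
    rw [norm_mul, norm_mul, norm_mul, Real.norm_of_nonneg (heatKernel_nonneg _ _),
      Real.norm_of_nonneg (by positivity : 0 ≤ 1 / (2 * Real.sqrt s))]
    have h1 : 1 / (2 * Real.sqrt s) ≤ 1 / (2 * Real.sqrt (t / 2)) := by gcongr
    have h2 : ‖deriv ψ (x + Real.sqrt s * z)‖ ≤ C₁ := hC₁ _
    rw [mul_assoc, Real.norm_eq_abs z]
    refine mul_le_mul_of_nonneg_left ?_ (heatKernel_nonneg _ _)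
    calc _ ≤ C₁ * (1 / (2 * Real.sqrt (t / 2)) * |z|) := by gcongr
      _ = _ := by ring
  · exact integrable_heatKernel_mul_abs.mul_const _
  · refine ae_of_all _ fun z s hs => ?_
    have hs' : t / 2 < s := hs
    have hd : HasDerivAt (fun s => x + Real.sqrt s * z) (1 / (2 * Real.sqrt s) * z) s :=
      ((Real.hasDerivAt_sqrt (by linarith)).mul_const z).const_add x
    exact ((h.hasDerivAt _).comp s hd).const_mul _

lemma IsTest.heatAvg_sub {ψ : ℝ → ℝ} (h : IsTest ψ) {t : ℝ} (ht : 0 ≤ t) (x : ℝ) :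
    heatAvg ψ t x - ψ x = ∫ s in (0 : ℝ)..t, heatAvg (deriv (deriv ψ)) s x := by
  rw [intervalIntegral.integral_eq_sub_of_hasDerivAt_of_le ht (f := fun s => heatAvg ψ s x)
    (h.continuous_heatAvg.comp (by fun_prop : Continuous fun s : ℝ => (s, x))).continuousOn
    (fun s hs => h.hasDerivAt_heatAvg hs.1 x)
    ((h.deriv_deriv.continuous_heatAvg.comp
      (by fun_prop : Continuous fun s : ℝ => (s, x))).intervalIntegrable _ _), heatAvg_zero]

/-! ### Fubini for Duhamel terms -/

lemma aestronglyMeasurable_neumannKernel_source {q : ℝ → ℝ} {t : ℝ}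
    (hq : AEMeasurable q (volume.restrict (Ioc 0 t))) (μ : Measure ℝ) [SFinite μ] :
    AEStronglyMeasurable (fun z : ℝ × ℝ => neumannKernel z.1 (q z.2) (t - z.2))
      (μ.prod (volume.restrict (Ioc 0 t))) := by
  have h1 : AEMeasurable (fun z : ℝ × ℝ => (z.1, q z.2, t - z.2))
      (μ.prod (volume.restrict (Ioc 0 t))) :=
    measurable_fst.aemeasurable.prodMk
      ((hq.comp_snd).prodMk (measurable_snd.const_sub t).aemeasurable)
  exact (measurable_neumannKernel.comp_aemeasurable h1).aestronglyMeasurable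

lemma aestronglyMeasurable_neumannKernel_time {q : ℝ → ℝ} {t : ℝ}
    (hq : AEMeasurable q (volume.restrict (Ioc 0 t))) (x : ℝ) :
    AEStronglyMeasurable (fun s => neumannKernel x (q s) (t - s)) (volume.restrict (Ioc 0 t)) := by
  have h1 : AEMeasurable (fun s : ℝ => (x, q s, t - s)) (volume.restrict (Ioc 0 t)) :=
    aemeasurable_const.prodMk (hq.prodMk (measurable_id.const_sub t).aemeasurable)
  exact (measurable_neumannKernel.comp_aemeasurable h1).aestronglyMeasurable

/-- The space-time data of a point source of strength `lam` at `q`, with integrable heat emission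
at time `t`. -/
structure IsSource (q lam : ℝ → ℝ) (t : ℝ) : Prop where
  pos : 0 < t
  meas : AEMeasurable q (volume.restrict (Ioc 0 t))
  mem : ∀ s ∈ Ioo 0 t, q s ∈ Icc (-1 : ℝ) 1
  integrable : IntegrableOn lam (Ioc 0 t)
  integrable_div : IntegrableOn (fun s => lam s / Real.sqrt (t - s)) (Ioc 0 t)

lemma ae_restrict_Ioc_mem_Ioo {t : ℝ} : ∀ᵐ s ∂(volume.restrict (Ioc 0 t)), s ∈ Ioo 0 t := by
  rw [← restrict_Ioo_eq_restrict_Ioc]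
  exact ae_restrict_mem measurableSet_Ioo

lemma IsSource.exists_bound {q lam : ℝ → ℝ} {t : ℝ} (h : IsSource q lam t) :
    ∃ C : ℝ, 0 < C ∧ ∀ x ∈ Icc (-1 : ℝ) 1, ∀ᵐ s ∂(volume.restrict (Ioc 0 t)),
      ‖neumannKernel x (q s) (t - s) * lam s‖ ≤ C * ‖lam s / Real.sqrt (t - s)‖ := by
  obtain ⟨C, hC, hb⟩ := exists_neumannKernel_le h.pos
  refine ⟨C, hC, fun x hx => ?_⟩
  filter_upwards [ae_restrict_Ioc_mem_Ioo] with s hs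
  rw [norm_mul, norm_div, Real.norm_of_nonneg (neumannKernel_nonneg _ _ _),
    Real.norm_of_nonneg (Real.sqrt_nonneg _)]
  have := hb x hx (q s) (h.mem s hs) (t - s) ⟨by linarith [hs.2], by linarith [hs.1]⟩
  calc _ ≤ C / Real.sqrt (t - s) * ‖lam s‖ := by gcongr
    _ = _ := by ring

lemma IsSource.integrableOn {q lam : ℝ → ℝ} {t : ℝ} (h : IsSource q lam t) {x : ℝ}
    (hx : x ∈ Icc (-1 : ℝ) 1) :
    IntegrableOn (fun s => neumannKernel x (q s) (t - s) * lam s) (Ioc 0 t) := by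
  obtain ⟨C, hC, hb⟩ := h.exists_bound
  exact (h.integrable_div.norm.const_mul C).mono'
    ((aestronglyMeasurable_neumannKernel_time h.meas x).mul h.integrable.aestronglyMeasurable)
    (hb x hx)

lemma IsSource.continuousOn {q lam : ℝ → ℝ} {t : ℝ} (h : IsSource q lam t) :
    ContinuousOn (fun x => ∫ s in (0 : ℝ)..t, neumannKernel x (q s) (t - s) * lam s)
      (Icc (-1) 1) := by
  obtain ⟨C, hC, hb⟩ := h.exists_bound
  simp_rw [intervalIntegral.integral_of_le h.pos.le]
  intro x hx
  refine continuousWithinAt_of_dominated (bound := fun s => C * ‖lam s / Real.sqrt (t - s)‖)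
    ?_ ?_ (h.integrable_div.norm.const_mul C) (ae_of_all _ fun s => ?_)
  · exact Eventually.of_forall fun x => (aestronglyMeasurable_neumannKernel_time h.meas x).mul
      h.integrable.aestronglyMeasurable
  · filter_upwards [self_mem_nhdsWithin] with y hy using hb y hy
  · exact ((continuousOn_neumannKernel (q s) (t - s)) x hx).mul continuousWithinAt_const

lemma ae_restrict_Ioc_mem_Icc : ∀ᵐ x ∂(volume.restrict (Ioc (-1 : ℝ) 1)), x ∈ Icc (-1 : ℝ) 1 := by
  filter_upwards [ae_restrict_mem measurableSet_Ioc] with x hx using ⟨hx.1.le, hx.2⟩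

lemma IsSource.integrable_prod {q lam : ℝ → ℝ} {t : ℝ} (h : IsSource q lam t) {ψ : ℝ → ℝ}
    (hψ : IsTest ψ) :
    Integrable (fun z : ℝ × ℝ => neumannKernel z.1 (q z.2) (t - z.2) * lam z.2 * ψ z.1)
      ((volume.restrict (Ioc (-1) 1)).prod (volume.restrict (Ioc 0 t))) := by
  obtain ⟨C, hC, hb⟩ := exists_neumannKernel_le h.pos
  obtain ⟨D, hD0, hD⟩ := hψ.exists_bound
  refine (((h.integrable_div.norm.const_mul (C * D)).comp_snd
    (volume.restrict (Ioc (-1 : ℝ) 1)))).mono' ?_ ?_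
  · exact ((aestronglyMeasurable_neumannKernel_source h.meas _).mul
      (h.integrable.aestronglyMeasurable.comp_snd)).mul
      (hψ.continuous.comp continuous_fst).aestronglyMeasurable
  · have h1 : ∀ᵐ z ∂((volume.restrict (Ioc (-1 : ℝ) 1)).prod (volume.restrict (Ioc 0 t))),
        z.1 ∈ Icc (-1 : ℝ) 1 :=
      Measure.quasiMeasurePreserving_fst.ae ae_restrict_Ioc_mem_Icc
    have h2 : ∀ᵐ z ∂((volume.restrict (Ioc (-1 : ℝ) 1)).prod (volume.restrict (Ioc 0 t))),
        z.2 ∈ Ioo 0 t :=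
      Measure.quasiMeasurePreserving_snd.ae ae_restrict_Ioc_mem_Ioo
    filter_upwards [h1, h2] with z hz1 hz2
    rw [norm_mul, norm_mul, norm_div, Real.norm_of_nonneg (neumannKernel_nonneg _ _ _),
      Real.norm_of_nonneg (Real.sqrt_nonneg _)]
    have := hb z.1 hz1 (q z.2) (h.mem _ hz2) (t - z.2) ⟨by linarith [hz2.2], by linarith [hz2.1]⟩
    calc _ ≤ C / Real.sqrt (t - z.2) * ‖lam z.2‖ * D := by gcongr; exact hD _
      _ = _ := by ring

/-- Pairing the heat emitted by a source with a test function. -/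
lemma IsSource.integral_mul {q lam : ℝ → ℝ} {t : ℝ} (h : IsSource q lam t) {ψ : ℝ → ℝ}
    (hψ : IsTest ψ) :
    ∫ x in (-1 : ℝ)..1, (∫ s in (0 : ℝ)..t, neumannKernel x (q s) (t - s) * lam s) * ψ x =
      ∫ s in (0 : ℝ)..t, lam s * heatAvg ψ (t - s) (q s) := by
  have hi := h.integrable_prod hψ
  rw [intervalIntegral.integral_of_le (by norm_num), intervalIntegral.integral_of_le h.pos.le]
  simp_rw [intervalIntegral.integral_of_le h.pos.le, ← integral_mul_const]
  rw [integral_integral_swap hi]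
  refine integral_congr_ae ?_
  filter_upwards [ae_restrict_Ioc_mem_Ioo] with s hs
  have h1 := hψ.integral_neumannKernel_mul (t := t - s) (x' := q s) (by linarith [hs.2])
  rw [integral_heatKernel_mul_eq_heatAvg ψ (by linarith [hs.2]),
    intervalIntegral.integral_of_le (by norm_num)] at h1
  rw [← h1, ← integral_const_mul]
  congr 1; funext x; ring

/-- Pairing the free evolution of the initial datum with a test function. -/
lemma integral_integral_neumannKernel_mul {g : ℝ → ℝ} (hg : ContinuousOn g (Icc (-1) 1)) {t : ℝ}
    (ht : 0 < t) {ψ : ℝ → ℝ} (hψ : IsTest ψ) :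
    ∫ x in (-1 : ℝ)..1, (∫ x' in (-1 : ℝ)..1, neumannKernel x x' t * g x') * ψ x =
      ∫ x in (-1 : ℝ)..1, g x * heatAvg ψ t x := by
  obtain ⟨C, hC, hb⟩ := exists_neumannKernel_le ht
  obtain ⟨D, hD0, hD⟩ := hψ.exists_bound
  have hgi : IntegrableOn g (Ioc (-1) 1) := (hg.integrableOn_Icc).mono_set Ioc_subset_Icc_self
  have hi : Integrable (fun z : ℝ × ℝ => neumannKernel z.1 z.2 t * g z.2 * ψ z.1)
      ((volume.restrict (Ioc (-1 : ℝ) 1)).prod (volume.restrict (Ioc (-1 : ℝ) 1))) := by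
    refine (((hgi.norm.const_mul (C / Real.sqrt t * D)).comp_snd
      (volume.restrict (Ioc (-1 : ℝ) 1)))).mono' ?_ ?_
    · refine (AEStronglyMeasurable.mul ?_ hgi.aestronglyMeasurable.comp_snd).mul
        (hψ.continuous.comp continuous_fst).aestronglyMeasurable
      exact (measurable_neumannKernel.comp (f := fun z : ℝ × ℝ => (z.1, z.2, t))
        (by fun_prop)).aestronglyMeasurable
    · have h1 : ∀ᵐ z ∂((volume.restrict (Ioc (-1 : ℝ) 1)).prod (volume.restrict (Ioc (-1 : ℝ) 1))),
          z.1 ∈ Icc (-1 : ℝ) 1 :=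
        Measure.quasiMeasurePreserving_fst.ae ae_restrict_Ioc_mem_Icc
      have h2 : ∀ᵐ z ∂((volume.restrict (Ioc (-1 : ℝ) 1)).prod (volume.restrict (Ioc (-1 : ℝ) 1))),
          z.2 ∈ Icc (-1 : ℝ) 1 :=
        Measure.quasiMeasurePreserving_snd.ae ae_restrict_Ioc_mem_Icc
      filter_upwards [h1, h2] with z hz1 hz2
      rw [norm_mul, norm_mul, Real.norm_of_nonneg (neumannKernel_nonneg _ _ _)]
      have := hb z.1 hz1 z.2 hz2 t ⟨ht, le_rfl⟩
      calc _ ≤ C / Real.sqrt t * ‖g z.2‖ * D := by gcongr; exact hD _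
        _ = _ := by ring
  simp_rw [intervalIntegral.integral_of_le (show (-1 : ℝ) ≤ 1 by norm_num), ← integral_mul_const]
  rw [integral_integral_swap hi]
  refine integral_congr_ae (ae_of_all _ fun x => ?_)
  have h1 := hψ.integral_neumannKernel_mul (t := t) (x' := x) ht
  rw [integral_heatKernel_mul_eq_heatAvg ψ ht,
    intervalIntegral.integral_of_le (by norm_num)] at h1
  simp only
  rw [← h1, ← integral_const_mul]
  congr 1; funext y; ring

lemma continuousOn_integral_neumannKernel {g : ℝ → ℝ} (hg : ContinuousOn g (Icc (-1) 1)) {t : ℝ}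
    (ht : 0 < t) :
    ContinuousOn (fun x => ∫ x' in (-1 : ℝ)..1, neumannKernel x x' t * g x') (Icc (-1) 1) := by
  obtain ⟨C, hC, hb⟩ := exists_neumannKernel_le ht
  have hgi : IntegrableOn g (Ioc (-1) 1) := (hg.integrableOn_Icc).mono_set Ioc_subset_Icc_self
  simp_rw [intervalIntegral.integral_of_le (show (-1 : ℝ) ≤ 1 by norm_num)]
  intro x hx
  refine continuousWithinAt_of_dominated (bound := fun s => C / Real.sqrt t * ‖g s‖)
    ?_ ?_ (hgi.norm.const_mul _) (ae_of_all _ fun s => ?_)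
  · refine Eventually.of_forall fun x => AEStronglyMeasurable.mul ?_ hgi.aestronglyMeasurable
    exact (measurable_neumannKernel.comp (f := fun y : ℝ => (x, y, t))
        (by fun_prop)).aestronglyMeasurable
  · filter_upwards [self_mem_nhdsWithin] with y hy
    filter_upwards [ae_restrict_Ioc_mem_Icc] with z hz
    rw [norm_mul, Real.norm_of_nonneg (neumannKernel_nonneg _ _ _)]
    have := hb y hy z hz t ⟨ht, le_rfl⟩
    gcongr
  · exact ((continuousOn_neumannKernel s t) x hx).mul continuousWithinAt_const

/-- Fubini on the triangle `0 < u < s < t`. -/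
lemma integral_triangle {lam q : ℝ → ℝ} {H : ℝ → ℝ → ℝ} {t C : ℝ} (ht : 0 ≤ t)
    (hlam : IntegrableOn lam (Ioc 0 t)) (hq : AEMeasurable q (volume.restrict (Ioc 0 t)))
    (hH : Continuous fun z : ℝ × ℝ => H z.1 z.2) (hC : ∀ s y, |H s y| ≤ C) :
    IntervalIntegrable (fun s => ∫ u in (0 : ℝ)..s, lam u * H (s - u) (q u)) volume 0 t ∧
    ∫ s in (0 : ℝ)..t, ∫ u in (0 : ℝ)..s, lam u * H (s - u) (q u) =
      ∫ u in (0 : ℝ)..t, lam u * ∫ s in (0 : ℝ)..(t - u), H s (q u) := by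
  have hi : Integrable (fun z : ℝ × ℝ =>
      (Ioi z.2).indicator (fun s => lam z.2 * H (s - z.2) (q z.2)) z.1)
      ((volume.restrict (Ioc 0 t)).prod (volume.restrict (Ioc 0 t))) := by
    refine ((hlam.norm.mul_const C).comp_snd (volume.restrict (Ioc 0 t))).mono' ?_ ?_
    · have h1 : (fun z : ℝ × ℝ =>
          (Ioi z.2).indicator (fun s => lam z.2 * H (s - z.2) (q z.2)) z.1) =
          {z : ℝ × ℝ | z.2 < z.1}.indicator (fun z => lam z.2 * H (z.1 - z.2) (q z.2)) := by
        funext z; simp [indicator]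
      rw [h1]
      refine AEStronglyMeasurable.indicator ?_ (measurableSet_lt measurable_snd measurable_fst)
      refine hlam.aestronglyMeasurable.comp_snd.mul ?_
      have h2 : AEMeasurable (fun z : ℝ × ℝ => (z.1 - z.2, q z.2))
          ((volume.restrict (Ioc 0 t)).prod (volume.restrict (Ioc 0 t))) :=
        (measurable_fst.sub measurable_snd).aemeasurable.prodMk hq.comp_snd
      exact (hH.measurable.comp_aemeasurable h2).aestronglyMeasurable
    · refine ae_of_all _ fun z => ?_
      refine (norm_indicator_le_norm_self _ _).trans ?_
      rw [norm_mul]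
      exact mul_le_mul_of_nonneg_left (hC _ _) (norm_nonneg _)
  -- The triangle is encoded by an indicator on the square; `u < s` and `u ≤ s` differ by a null
  -- set.
  have e1 : ∀ s ∈ Ioc 0 t, ∫ u in Ioc 0 t, (Ioi u).indicator (fun s => lam u * H (s - u) (q u)) s =
      ∫ u in (0 : ℝ)..s, lam u * H (s - u) (q u) := by
    intro s hs
    have h1 : ∀ u, (Ioi u).indicator (fun s => lam u * H (s - u) (q u)) s =
        (Iio s).indicator (fun u => lam u * H (s - u) (q u)) u := fun u => by simp [indicator]
    simp_rw [h1]
    rw [setIntegral_indicator measurableSet_Iio, intervalIntegral.integral_of_le hs.1.le,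
      ← restrict_Ioo_eq_restrict_Ioc (a := 0) (b := s)]
    congr 2
    ext u; constructor
    · rintro ⟨h1, h2⟩; exact ⟨h1.1, h2⟩
    · rintro ⟨h1, h2⟩; exact ⟨⟨h1, (h2.le.trans hs.2)⟩, h2⟩
  constructor
  · rw [intervalIntegrable_iff_integrableOn_Ioc_of_le ht]
    refine (hi.integral_prod_left).congr ?_
    filter_upwards [ae_restrict_mem measurableSet_Ioc] with s hs using e1 s hs
  · rw [intervalIntegral.integral_of_le ht, intervalIntegral.integral_of_le ht]
    rw [← setIntegral_congr_fun measurableSet_Ioc e1, integral_integral_swap hi]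
    refine setIntegral_congr_fun measurableSet_Ioc fun u hu => ?_
    rw [setIntegral_indicator measurableSet_Ioi]
    have : Ioc 0 t ∩ Ioi u = Ioc u t := by
      ext s; constructor
      · rintro ⟨h1, h2⟩; exact ⟨h2, h1.2⟩
      · rintro ⟨h1, h2⟩; exact ⟨⟨hu.1.trans h1, h2⟩, h1⟩
    rw [this, integral_const_mul, ← intervalIntegral.integral_of_le hu.2]
    congr 1
    rw [intervalIntegral.integral_comp_sub_right (fun s => H s (q u)), sub_self]

/-! ### The jump length -/

lemma continuous_jump (κ a : ℝ) : Continuous (jump κ a) := by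
  unfold jump; fun_prop

lemma jump_pos {κ a q : ℝ} (hκ : 0 < κ) (ha : 0 < a) (hq : q ∈ Ioo (-1 : ℝ) 1) :
    0 < jump κ a q := by
  refine lt_min ha (mul_pos hκ (lt_min ?_ ?_)) <;> rw [abs_pos]
  · linarith [hq.2]
  · linarith [hq.1]

/-- Because `κ ≤ 1`, a jump is no longer than the distance to either wall, so both sources stay in
`[-1,1]`. -/
lemma jump_le {κ a q : ℝ} (hκ₁ : κ ≤ 1) (hq : q ∈ Ioo (-1 : ℝ) 1) :
    jump κ a q ≤ 1 - q ∧ jump κ a q ≤ 1 + q := by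
  have h1 : |q - 1| = 1 - q := by rw [abs_of_neg (by linarith [hq.2])]; ring
  have h2 : |q + 1| = 1 + q := by rw [abs_of_pos (by linarith [hq.1])]; ring
  have h3 : jump κ a q ≤ min (1 - q) (1 + q) := by
    unfold jump
    rw [h1, h2]
    refine (min_le_right _ _).trans ?_
    have : 0 ≤ min (1 - q) (1 + q) := le_min (by linarith [hq.2]) (by linarith [hq.1])
    nlinarith
  exact ⟨h3.trans (min_le_left _ _), h3.trans (min_le_right _ _)⟩

/-! ### Regularity of solutions -/

namespace IsSolution

variable {κ a : ℝ} {fI : ℝ → ℝ} {T : ℝ} {f : ℝ → ℝ → ℝ} {p : ℝ → ℝ}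

lemma flux_eq_of_differentiableAt {t : ℝ}
    (hd : DifferentiableAt ℝ (fun z : ℝ × ℝ => f z.1 z.2) (p t, t)) :
    flux f p t = -fderiv ℝ (fun z : ℝ × ℝ => f z.1 z.2) (p t, t) (1, 0) := by
  have h1 : HasDerivAt (fun x : ℝ => (x, t)) ((1 : ℝ), (0 : ℝ)) (p t) :=
    (hasDerivAt_id (p t)).prodMk (hasDerivAt_const _ _)
  have h2 := hd.hasFDerivAt.comp_hasDerivAt_of_eq (p t) h1 rfl
  unfold flux
  rw [← h2.deriv]
  rfl

lemma continuousAt_fderiv {F : ℝ × ℝ → ℝ} {z : ℝ × ℝ} {n : ℕ} (h : ContDiffAt ℝ (n + 1) F z)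
    (v : ℝ × ℝ) : ContDiffAt ℝ n (fun w => fderiv ℝ F w v) z :=
  (h.fderiv_right le_rfl).clm_apply contDiffAt_const

/-- Near a point of the free boundary the solution is smooth and strictly decreasing. -/
lemma exists_box (h : IsSolution κ a fI T f p) {t₀ : ℝ} (ht₀ : t₀ ∈ Ioo 0 T) :
    ∃ δ > 0, ∀ x ∈ Icc (p t₀ - δ) (p t₀ + δ), ∀ t ∈ Icc (t₀ - δ) (t₀ + δ),
      x ∈ Ioo (-1 : ℝ) 1 ∧ t ∈ Ioo 0 T ∧ ContDiffAt ℝ 3 (fun z : ℝ × ℝ => f z.1 z.2) (x, t) ∧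
      fderiv ℝ (fun z : ℝ × ℝ => f z.1 z.2) (x, t) (1, 0) < 0 := by
  set F : ℝ × ℝ → ℝ := fun z => f z.1 z.2
  have h3 : ContDiffAt ℝ 3 F (p t₀, t₀) := contDiffAt_infty.1 (h.smooth t₀ ht₀) 3
  have e1 : ∀ᶠ z in 𝓝 (p t₀, t₀), ContDiffAt ℝ 3 F z := h3.eventually (by simp)
  have e2 : ∀ᶠ z in 𝓝 (p t₀, t₀), fderiv ℝ F z (1, 0) < 0 := by
    have hc : ContinuousAt (fun w => fderiv ℝ F w (1, 0)) (p t₀, t₀) :=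
      (continuousAt_fderiv (n := 2) (by exact_mod_cast h3) (1, 0)).continuousAt
    refine hc.eventually_lt continuousAt_const ?_
    have := h.flux_pos t₀ ht₀
    rw [flux_eq_of_differentiableAt (h3.differentiableAt (by simp))] at this
    linarith
  have e3 : ∀ᶠ z : ℝ × ℝ in 𝓝 (p t₀, t₀), z.1 ∈ Ioo (-1 : ℝ) 1 ∧ z.2 ∈ Ioo 0 T :=
    (continuousAt_fst.eventually (isOpen_Ioo.mem_nhds (h.mem t₀ ⟨ht₀.1.le, ht₀.2⟩))).and
      (continuousAt_snd.eventually (isOpen_Ioo.mem_nhds ht₀))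
  obtain ⟨δ, hδ, hb⟩ := Metric.nhds_basis_closedBall.eventually_iff.1 (e1.and (e2.and e3))
  refine ⟨δ, hδ, fun x hx t ht => ?_⟩
  have hm : (x, t) ∈ Metric.closedBall (p t₀, t₀) δ := by
    rw [Metric.mem_closedBall, Prod.dist_eq, Real.dist_eq, Real.dist_eq]
    exact max_le (abs_le.2 ⟨by simp; linarith [hx.1], by simp; linarith [hx.2]⟩)
      (abs_le.2 ⟨by simp; linarith [ht.1], by simp; linarith [ht.2]⟩)
  obtain ⟨g1, g2, g3, g4⟩ := hb hm
  exact ⟨g3, g4, g1, g2⟩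

lemma hasDerivAt_fst {x t : ℝ} {F : ℝ × ℝ → ℝ} (hd : DifferentiableAt ℝ F (x, t)) :
    HasDerivAt (fun y => F (y, t)) (fderiv ℝ F (x, t) (1, 0)) x :=
  hd.hasFDerivAt.comp_hasDerivAt_of_eq x ((hasDerivAt_id x).prodMk (hasDerivAt_const x t)) rfl

lemma hasDerivAt_snd {x t : ℝ} {F : ℝ × ℝ → ℝ} (hd : DifferentiableAt ℝ F (x, t)) :
    HasDerivAt (fun s => F (x, s)) (fderiv ℝ F (x, t) (0, 1)) t :=
  hd.hasFDerivAt.comp_hasDerivAt_of_eq t ((hasDerivAt_const t x).prodMk (hasDerivAt_id t)) rfl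

lemma strictAntiOn_box {δ x₀ t : ℝ}
    (hb : ∀ x ∈ Icc (x₀ - δ) (x₀ + δ), ContDiffAt ℝ 3 (fun z : ℝ × ℝ => f z.1 z.2) (x, t) ∧
      fderiv ℝ (fun z : ℝ × ℝ => f z.1 z.2) (x, t) (1, 0) < 0) :
    StrictAntiOn (fun x => f x t) (Icc (x₀ - δ) (x₀ + δ)) := by
  have hd : ∀ x ∈ Icc (x₀ - δ) (x₀ + δ), HasDerivAt (fun y => f y t)
      (fderiv ℝ (fun z : ℝ × ℝ => f z.1 z.2) (x, t) (1, 0)) x := fun x hx =>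
    hasDerivAt_fst ((hb x hx).1.differentiableAt (by simp))
  refine strictAntiOn_of_deriv_neg (convex_Icc _ _)
    (fun x hx => (hd x hx).continuousAt.continuousWithinAt) fun x hx => ?_
  have hx' := interior_subset hx
  rw [(hd x hx').deriv]
  exact (hb x hx').2

lemma apply_free_boundary (h : IsSolution κ a fI T f p) {t : ℝ} (ht : t ∈ Ico 0 T) :
    f (p t) t = 0 :=
  (h.zero_iff t ht (p t) ⟨(h.mem t ht).1.le, (h.mem t ht).2.le⟩).2 rfl

/-- The strict signs of `f` at `p t₀ - r` and `p t₀ + r` persist for nearby times. A zero then lies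
between the two points, and uniqueness of the zero identifies it with `p t`. -/
lemma continuousAt_free_boundary (h : IsSolution κ a fI T f p) {t₀ : ℝ} (ht₀ : t₀ ∈ Ioo 0 T) :
    ContinuousAt p t₀ := by
  obtain ⟨δ, hδ, hb⟩ := h.exists_box ht₀
  have ht : t₀ ∈ Icc (t₀ - δ) (t₀ + δ) := ⟨by linarith, by linarith⟩
  rw [Metric.continuousAt_iff']
  intro ε hε
  set r := min δ (ε / 2) with hr
  have hr0 : 0 < r := lt_min hδ (by linarith)
  have hrδ : r ≤ δ := min_le_left _ _
  have hrε : r < ε := (min_le_right _ _).trans_lt (by linarith)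
  have hanti := strictAntiOn_box (f := f) (x₀ := p t₀) (δ := δ) (t := t₀)
    fun x hx => ⟨(hb x hx t₀ ht).2.2.1, (hb x hx t₀ ht).2.2.2⟩
  have hz := h.apply_free_boundary ⟨ht₀.1.le, ht₀.2⟩
  have hm0 : p t₀ ∈ Icc (p t₀ - δ) (p t₀ + δ) := ⟨by linarith, by linarith⟩
  have hml : p t₀ - r ∈ Icc (p t₀ - δ) (p t₀ + δ) := ⟨by linarith, by linarith⟩
  have hmr : p t₀ + r ∈ Icc (p t₀ - δ) (p t₀ + δ) := ⟨by linarith, by linarith⟩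
  have hl : 0 < f (p t₀ - r) t₀ := hz ▸ hanti hml hm0 (by linarith)
  have hr : f (p t₀ + r) t₀ < 0 := hz ▸ hanti hm0 hmr (by linarith)
  have cl : ContinuousAt (fun t => f (p t₀ - r) t) t₀ :=
    (hasDerivAt_snd ((hb _ hml t₀ ht).2.2.1.differentiableAt (by simp))).continuousAt
  have cr : ContinuousAt (fun t => f (p t₀ + r) t) t₀ :=
    (hasDerivAt_snd ((hb _ hmr t₀ ht).2.2.1.differentiableAt (by simp))).continuousAt
  filter_upwards [cl.eventually_const_lt hl, cr.eventually_lt_const hr,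
    Icc_mem_nhds (by linarith : t₀ - δ < t₀) (by linarith : t₀ < t₀ + δ)] with t h1 h2 h3
  have hc : ContinuousOn (fun x => f x t) (Icc (p t₀ - r) (p t₀ + r)) := fun x hx =>
    (hasDerivAt_fst ((hb x ⟨by linarith [hx.1], by linarith [hx.2]⟩ t h3).2.2.1.differentiableAt
      (by simp))).continuousAt.continuousWithinAt
  obtain ⟨x, hx, hx0⟩ := intermediate_value_Icc' (by linarith) hc ⟨h2.le, h1.le⟩
  have hbx := hb x ⟨by linarith [hx.1], by linarith [hx.2]⟩ t h3
  have := (h.zero_iff t ⟨hbx.2.1.1.le, hbx.2.1.2⟩ x ⟨hbx.1.1.le, hbx.1.2.le⟩).1 hx0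
  rw [← this, Real.dist_eq]
  exact (abs_le.2 ⟨by linarith [hx.1], by linarith [hx.2]⟩).trans_lt hrε

lemma continuousAt_flux (h : IsSolution κ a fI T f p) {t₀ : ℝ} (ht₀ : t₀ ∈ Ioo 0 T) :
    ContinuousAt (flux f p) t₀ := by
  obtain ⟨δ, hδ, hb⟩ := h.exists_box ht₀
  have hm0 : p t₀ ∈ Icc (p t₀ - δ) (p t₀ + δ) := ⟨by linarith, by linarith⟩
  have ht : t₀ ∈ Icc (t₀ - δ) (t₀ + δ) := ⟨by linarith, by linarith⟩
  have hpc := h.continuousAt_free_boundary ht₀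
  have hc : ContinuousAt (fun w => fderiv ℝ (fun z : ℝ × ℝ => f z.1 z.2) w (1, 0)) (p t₀, t₀) :=
    (continuousAt_fderiv (n := 2) (by exact_mod_cast (hb _ hm0 t₀ ht).2.2.1) (1, 0)).continuousAt
  have hc2 : ContinuousAt (fun t => -fderiv ℝ (fun z : ℝ × ℝ => f z.1 z.2) (p t, t) (1, 0)) t₀ :=
    (ContinuousAt.comp (f := fun t => (p t, t)) hc (hpc.prodMk continuousAt_id)).neg
  refine hc2.congr ?_
  filter_upwards [isOpen_Ioo.mem_nhds ht₀] with t ht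
  exact (flux_eq_of_differentiableAt ((h.smooth t ht).differentiableAt (by simp))).symm

lemma integrableOn_flux (h : IsSolution κ a fI T f p) {t : ℝ} (ht : t ∈ Ioo 0 T) :
    IntegrableOn (flux f p) (Ioc 0 t) :=
  (intervalIntegrable_iff_integrableOn_Ioc_of_le ht.1.le).1 (h.flux_integrable t ht)

lemma aemeasurable_free_boundary (h : IsSolution κ a fI T f p) {t : ℝ} (ht : t ∈ Ioo 0 T) :
    AEMeasurable p (volume.restrict (Ioc 0 t)) :=
  ContinuousOn.aemeasurable (fun _ hs => (h.continuousAt_free_boundary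
    ⟨hs.1, hs.2.trans_lt ht.2⟩).continuousWithinAt) measurableSet_Ioc

/-- On the first half of the interval the flux is integrable and `1/√(t-s)` bounded; on the second
half the flux is continuous, hence bounded, and `1/√(t-s)` integrable. -/
lemma integrableOn_flux_div (h : IsSolution κ a fI T f p) {t : ℝ} (ht : t ∈ Ioo 0 T) :
    IntegrableOn (fun s => flux f p s / Real.sqrt (t - s)) (Ioc 0 t) := by
  have ht0 := ht.1
  rw [← Ioc_union_Ioc_eq_Ioc (by linarith : 0 ≤ t / 2) (by linarith : t / 2 ≤ t)]
  refine IntegrableOn.union ?_ ?_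
  · have h1 : IntegrableOn (flux f p) (Ioc 0 (t / 2)) :=
      (h.integrableOn_flux ht).mono_set (Ioc_subset_Ioc_right (by linarith))
    have h2 := h1.mul_bdd (g := fun s => (Real.sqrt (t - s))⁻¹) (c := (Real.sqrt (t / 2))⁻¹)
      (by fun_prop) ?_
    · simp only [div_eq_mul_inv (flux f p _)]
      exact h2
    · filter_upwards [ae_restrict_mem measurableSet_Ioc] with s hs
      have : 0 < Real.sqrt (t / 2) := Real.sqrt_pos.2 (by linarith)
      rw [norm_inv, Real.norm_of_nonneg (Real.sqrt_nonneg _)]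
      gcongr
      linarith [hs.2]
  · have hc : ContinuousOn (flux f p) (Icc (t / 2) t) := fun s hs =>
      (h.continuousAt_flux ⟨by linarith [hs.1], hs.2.trans_lt ht.2⟩).continuousWithinAt
    obtain ⟨C, hC⟩ := isCompact_Icc.exists_bound_of_continuousOn hc
    have h1 : IntervalIntegrable (fun s : ℝ => (t - s) ^ (-(1 / 2) : ℝ)) volume (t / 2) t := by
      have := (intervalIntegral.intervalIntegrable_rpow' (a := t / 2) (b := 0)
        (r := -(1 / 2)) (by norm_num)).comp_sub_left t
      convert! this using 1 <;> ring
    rw [intervalIntegrable_iff_integrableOn_Ioc_of_le (by linarith)] at h1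
    have h2 := h1.bdd_mul (f := flux f p) (c := C)
      ((hc.mono Ioc_subset_Icc_self).aestronglyMeasurable measurableSet_Ioc) ?_
    · refine IntegrableOn.congr_fun h2 (fun s hs => ?_) measurableSet_Ioc
      rw [Real.rpow_neg (by linarith [hs.2]), ← Real.sqrt_eq_rpow, div_eq_mul_inv]
    · filter_upwards [ae_restrict_mem measurableSet_Ioc] with s hs using hC s ⟨hs.1.le, hs.2⟩


lemma isSource_left (h : IsSolution κ a fI T f p) (hκ₀ : 0 < κ) (hκ₁ : κ ≤ 1) (ha₀ : 0 < a)
    {t : ℝ} (ht : t ∈ Ioo 0 T) : IsSource (fun s => p s - jump κ a (p s)) (flux f p) t where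
  pos := ht.1
  meas := (h.aemeasurable_free_boundary ht).sub
    ((continuous_jump κ a).measurable.comp_aemeasurable (h.aemeasurable_free_boundary ht))
  mem s hs := by
    have hm := h.mem s ⟨hs.1.le, hs.2.trans ht.2⟩
    have := jump_le (a := a) hκ₁ hm
    have := jump_pos hκ₀ ha₀ hm
    constructor <;> linarith [hm.1, hm.2]
  integrable := h.integrableOn_flux ht
  integrable_div := h.integrableOn_flux_div ht

lemma isSource_right (h : IsSolution κ a fI T f p) (hκ₀ : 0 < κ) (hκ₁ : κ ≤ 1) (ha₀ : 0 < a)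
    {t : ℝ} (ht : t ∈ Ioo 0 T) : IsSource (fun s => p s + jump κ a (p s)) (flux f p) t where
  pos := ht.1
  meas := (h.aemeasurable_free_boundary ht).add
    ((continuous_jump κ a).measurable.comp_aemeasurable (h.aemeasurable_free_boundary ht))
  mem s hs := by
    have hm := h.mem s ⟨hs.1.le, hs.2.trans ht.2⟩
    have := jump_le (a := a) hκ₁ hm
    have := jump_pos hκ₀ ha₀ hm
    constructor <;> linarith [hm.1, hm.2]
  integrable := h.integrableOn_flux ht
  integrable_div := h.integrableOn_flux_div ht

lemma eq_sources (h : IsSolution κ a fI T f p) (hκ₀ : 0 < κ) (hκ₁ : κ ≤ 1) (ha₀ : 0 < a)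
    {t x : ℝ} (ht : t ∈ Ioo 0 T) (hx : x ∈ Icc (-1 : ℝ) 1) :
    f x t = (∫ x' in (-1 : ℝ)..1, neumannKernel x x' t * fI x') +
      ((∫ s in (0 : ℝ)..t, neumannKernel x (p s - jump κ a (p s)) (t - s) * flux f p s) -
        ∫ s in (0 : ℝ)..t, neumannKernel x (p s + jump κ a (p s)) (t - s) * flux f p s) := by
  rw [h.duhamel t ht x hx, ← intervalIntegral.integral_sub]
  · simp_rw [sub_mul]
  · exact (intervalIntegrable_iff_integrableOn_Ioc_of_le ht.1.le).2
      ((h.isSource_left hκ₀ hκ₁ ha₀ ht).integrableOn hx)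
  · exact (intervalIntegrable_iff_integrableOn_Ioc_of_le ht.1.le).2
      ((h.isSource_right hκ₀ hκ₁ ha₀ ht).integrableOn hx)

lemma continuousOn_space (h : IsSolution κ a fI T f p) (hκ₀ : 0 < κ) (hκ₁ : κ ≤ 1) (ha₀ : 0 < a)
    (hI : ContinuousOn fI (Icc (-1) 1)) {t : ℝ} (ht : t ∈ Ioo 0 T) :
    ContinuousOn (fun x => f x t) (Icc (-1) 1) := by
  refine ContinuousOn.congr ?_ fun x hx => h.eq_sources hκ₀ hκ₁ ha₀ ht hx
  exact (continuousOn_integral_neumannKernel hI ht.1).add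
    ((h.isSource_left hκ₀ hκ₁ ha₀ ht).continuousOn.sub
      (h.isSource_right hκ₀ hκ₁ ha₀ ht).continuousOn)

/-- Strict decrease near `p t` makes `f` positive just to the left of it; a nonpositive value
farther left would create a second zero. -/
lemma pos_left (h : IsSolution κ a fI T f p) {t : ℝ} (ht : t ∈ Ioo 0 T)
    (hc : ContinuousOn (fun x => f x t) (Icc (-1) 1)) {x : ℝ} (hx : -1 ≤ x) (hxp : x < p t) :
    0 < f x t := by
  have ht' : t ∈ Ico 0 T := ⟨ht.1.le, ht.2⟩
  obtain ⟨δ, hδ, hb⟩ := h.exists_box ht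
  have htm : t ∈ Icc (t - δ) (t + δ) := ⟨by linarith, by linarith⟩
  have hanti := strictAntiOn_box (f := f) (x₀ := p t) (δ := δ) (t := t)
    fun x hx => ⟨(hb x hx t htm).2.2.1, (hb x hx t htm).2.2.2⟩
  by_contra hneg
  push Not at hneg
  have hm := h.mem t ht'
  obtain ⟨y, hy1, hy2⟩ := exists_between (max_lt hxp (by linarith : p t - δ < p t))
  have hxy := (le_max_left _ _).trans_lt hy1
  have hpos : 0 < f y t := h.apply_free_boundary ht' ▸ hanti
    ⟨((le_max_right _ _).trans_lt hy1).le, by linarith⟩ ⟨by linarith, by linarith⟩ hy2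
  obtain ⟨z, hz, hz0⟩ := intermediate_value_Icc hxy.le
    (hc.mono (Icc_subset_Icc hx (by linarith [hm.2]))) ⟨hneg, hpos.le⟩
  have := (h.zero_iff t ht' z ⟨by linarith [hz.1], by linarith [hz.2, hm.2]⟩).1 hz0
  linarith [hz.2]

lemma neg_right (h : IsSolution κ a fI T f p) {t : ℝ} (ht : t ∈ Ioo 0 T)
    (hc : ContinuousOn (fun x => f x t) (Icc (-1) 1)) {x : ℝ} (hx : x ≤ 1) (hxp : p t < x) :
    f x t < 0 := by
  have ht' : t ∈ Ico 0 T := ⟨ht.1.le, ht.2⟩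
  obtain ⟨δ, hδ, hb⟩ := h.exists_box ht
  have htm : t ∈ Icc (t - δ) (t + δ) := ⟨by linarith, by linarith⟩
  have hanti := strictAntiOn_box (f := f) (x₀ := p t) (δ := δ) (t := t)
    fun x hx => ⟨(hb x hx t htm).2.2.1, (hb x hx t htm).2.2.2⟩
  by_contra hneg
  push Not at hneg
  have hm := h.mem t ht'
  obtain ⟨y, hy1, hy2⟩ := exists_between (lt_min hxp (by linarith : p t < p t + δ))
  have hxy := hy2.trans_le (min_le_left _ _)
  have hpos : f y t < 0 := h.apply_free_boundary ht' ▸ hanti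
    ⟨by linarith, by linarith⟩ ⟨by linarith, (hy2.trans_le (min_le_right _ _)).le⟩ hy1
  obtain ⟨z, hz, hz0⟩ := intermediate_value_Icc hxy.le
    (hc.mono (Icc_subset_Icc (by linarith [hm.1]) hx)) ⟨hpos.le, hneg⟩
  have := (h.zero_iff t ht' z ⟨by linarith [hz.1, hm.1], by linarith [hz.2]⟩).1 hz0
  linarith [hz.1]

end IsSolution

end PriceFormation

namespace PriceFormation
namespace IsSolution

variable {κ a : ℝ} {fI : ℝ → ℝ} {T : ℝ} {f : ℝ → ℝ → ℝ} {p : ℝ → ℝ}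

/-! ### The weak formulation -/

lemma pairing_eq (h : IsSolution κ a fI T f p) (hκ₀ : 0 < κ) (hκ₁ : κ ≤ 1) (ha₀ : 0 < a)
    (hI : ContinuousOn fI (Icc (-1) 1)) {ψ : ℝ → ℝ} (hψ : IsTest ψ) {t : ℝ} (ht : t ∈ Ioo 0 T) :
    ∫ x in (-1 : ℝ)..1, f x t * ψ x = (∫ x in (-1 : ℝ)..1, fI x * heatAvg ψ t x) +
      ((∫ s in (0 : ℝ)..t, flux f p s * heatAvg ψ (t - s) (p s - jump κ a (p s))) -
        ∫ s in (0 : ℝ)..t, flux f p s * heatAvg ψ (t - s) (p s + jump κ a (p s))) := by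
  have hl := h.isSource_left hκ₀ hκ₁ ha₀ ht
  have hr := h.isSource_right hκ₀ hκ₁ ha₀ ht
  have hii : ∀ g : ℝ → ℝ, ContinuousOn g (Icc (-1) 1) →
      IntervalIntegrable (fun x => g x * ψ x) volume (-1) 1 := fun g hg =>
    (hg.mul hψ.continuous.continuousOn).intervalIntegrable_of_Icc (by norm_num)
  rw [← hl.integral_mul hψ, ← hr.integral_mul hψ, ← integral_integral_neumannKernel_mul hI ht.1 hψ,
    ← intervalIntegral.integral_sub (hii _ hl.continuousOn) (hii _ hr.continuousOn),
    ← intervalIntegral.integral_add (hii _ (continuousOn_integral_neumannKernel hI ht.1))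
      ((hii _ hl.continuousOn).sub (hii _ hr.continuousOn))]
  refine intervalIntegral.integral_congr fun x hx => ?_
  rw [uIcc_of_le (by norm_num)] at hx
  simp only [h.eq_sources hκ₀ hκ₁ ha₀ ht hx]
  ring

/-- The rate of change of the pairing of the solution with a test function. -/
noncomputable def weakRate (κ a : ℝ) (f : ℝ → ℝ → ℝ) (p ψ : ℝ → ℝ) (t : ℝ) : ℝ :=
  (∫ x in (-1 : ℝ)..1, f x t * deriv (deriv ψ) x) +
    flux f p t * (ψ (p t - jump κ a (p t)) - ψ (p t + jump κ a (p t)))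

lemma integral_initial (hI : ContinuousOn fI (Icc (-1) 1)) {ψ : ℝ → ℝ} (hψ : IsTest ψ) {t : ℝ}
    (ht : 0 < t) :
    IntervalIntegrable (fun s => ∫ x in (-1 : ℝ)..1, fI x * heatAvg (deriv (deriv ψ)) s x)
      volume 0 t ∧
    ∫ s in (0 : ℝ)..t, ∫ x in (-1 : ℝ)..1, fI x * heatAvg (deriv (deriv ψ)) s x =
      (∫ x in (-1 : ℝ)..1, fI x * heatAvg ψ t x) - ∫ x in (-1 : ℝ)..1, fI x * ψ x := by
  have hcont := hψ.deriv_deriv.continuous_heatAvg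
  have hi : IntegrableOn (Function.uncurry fun s x => fI x * heatAvg (deriv (deriv ψ)) s x)
      (Ioc 0 t ×ˢ Ioc (-1 : ℝ) 1) := by
    have hc : ContinuousOn (Function.uncurry fun s x => fI x * heatAvg (deriv (deriv ψ)) s x)
        (Icc 0 t ×ˢ Icc (-1 : ℝ) 1) :=
      (hI.comp continuousOn_snd fun z hz => hz.2).mul hcont.continuousOn
    exact (hc.integrableOn_compact (isCompact_Icc.prod isCompact_Icc)).mono_set
      (prod_mono Ioc_subset_Icc_self Ioc_subset_Icc_self)
  have hsw := intervalIntegral_intervalIntegral_swap (a := 0) (b := t) (c := -1) (d := 1)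
    (F := fun s x => fI x * heatAvg (deriv (deriv ψ)) s x)
    (by rwa [uIoc_of_le ht.le, uIoc_of_le (by norm_num)])
  constructor
  · rw [intervalIntegrable_iff_integrableOn_Ioc_of_le ht.le]
    simp_rw [intervalIntegral.integral_of_le (show (-1 : ℝ) ≤ 1 by norm_num)]
    rw [Measure.volume_eq_prod, IntegrableOn, ← Measure.prod_restrict] at hi
    exact hi.integral_prod_left
  · rw [hsw, ← intervalIntegral.integral_sub]
    · refine intervalIntegral.integral_congr fun x _ => ?_
      rw [intervalIntegral.integral_const_mul, ← hψ.heatAvg_sub ht.le, mul_sub]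
    · exact (hI.mul (hψ.continuous_heatAvg.comp
        (by fun_prop : Continuous fun x : ℝ => (t, x))).continuousOn).intervalIntegrable_of_Icc
        (by norm_num)
    · exact (hI.mul hψ.continuous.continuousOn).intervalIntegrable_of_Icc (by norm_num)

/-- Fubini on the triangle followed by `IsTest.heatAvg_sub`. The time-integrated form avoids
differentiating the Duhamel term. -/
lemma _root_.PriceFormation.IsSource.integral_heatAvg {q lam : ℝ → ℝ} {t : ℝ} (h : IsSource q lam t)
    {ψ : ℝ → ℝ} (hψ : IsTest ψ) :
    IntervalIntegrable (fun s => ∫ u in (0 : ℝ)..s, lam u * heatAvg (deriv (deriv ψ)) (s - u) (q u))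
      volume 0 t ∧
    IntervalIntegrable (fun s => lam s * ψ (q s)) volume 0 t ∧
    (∫ s in (0 : ℝ)..t, ∫ u in (0 : ℝ)..s, lam u * heatAvg (deriv (deriv ψ)) (s - u) (q u)) +
      ∫ s in (0 : ℝ)..t, lam s * ψ (q s) =
      ∫ s in (0 : ℝ)..t, lam s * heatAvg ψ (t - s) (q s) := by
  obtain ⟨C, hC0, hC⟩ := hψ.deriv_deriv.exists_bound
  obtain ⟨D, hD0, hD⟩ := hψ.exists_bound
  obtain ⟨h1, h2⟩ := integral_triangle (H := heatAvg (deriv (deriv ψ))) h.pos.le h.integrable h.meas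
    hψ.deriv_deriv.continuous_heatAvg (IsTest.abs_heatAvg_le hC)
  have i1 : IntervalIntegrable (fun s => lam s * ψ (q s)) volume 0 t := by
    rw [intervalIntegrable_iff_integrableOn_Ioc_of_le h.pos.le]
    exact h.integrable.mul_bdd (c := D)
      (hψ.continuous.measurable.comp_aemeasurable h.meas).aestronglyMeasurable
      (ae_of_all _ fun s => hD _)
  have i2 : IntervalIntegrable (fun s => lam s * heatAvg ψ (t - s) (q s)) volume 0 t := by
    rw [intervalIntegrable_iff_integrableOn_Ioc_of_le h.pos.le]
    have hm : AEMeasurable (fun s => (t - s, q s)) (volume.restrict (Ioc 0 t)) :=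
      (measurable_id.const_sub t).aemeasurable.prodMk h.meas
    exact h.integrable.mul_bdd (c := D)
      (hψ.continuous_heatAvg.measurable.comp_aemeasurable hm).aestronglyMeasurable
      (ae_of_all _ fun s => IsTest.abs_heatAvg_le hD _ _)
  refine ⟨h1, i1, ?_⟩
  rw [h2, ← eq_sub_iff_add_eq, ← intervalIntegral.integral_sub i2 i1]
  refine intervalIntegral.integral_congr fun u hu => ?_
  rw [uIcc_of_le h.pos.le] at hu
  rw [← hψ.heatAvg_sub (by linarith [hu.2]), mul_sub]

/-- The integrated form needs only integrability of the flux near time 0. Its integrand is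
continuous at positive times, which gives `hasDerivAt_pairing`. -/
lemma weak_eq (h : IsSolution κ a fI T f p) (hκ₀ : 0 < κ) (hκ₁ : κ ≤ 1) (ha₀ : 0 < a)
    (hI : ContinuousOn fI (Icc (-1) 1)) {ψ : ℝ → ℝ} (hψ : IsTest ψ) {t : ℝ} (ht : t ∈ Ioo 0 T) :
    IntervalIntegrable (weakRate κ a f p ψ) volume 0 t ∧
    ∫ x in (-1 : ℝ)..1, f x t * ψ x =
      (∫ x in (-1 : ℝ)..1, fI x * ψ x) + ∫ s in (0 : ℝ)..t, weakRate κ a f p ψ s := by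
  obtain ⟨i0, e0⟩ := integral_initial hI hψ ht.1
  obtain ⟨i1, i2, e1⟩ := (h.isSource_left hκ₀ hκ₁ ha₀ ht).integral_heatAvg hψ
  obtain ⟨j1, j2, e2⟩ := (h.isSource_right hκ₀ hκ₁ ha₀ ht).integral_heatAvg hψ
  have hi := (i0.add (i1.sub j1)).add (i2.sub j2)
  have hcongr : ∀ s ∈ Ioc 0 t, weakRate κ a f p ψ s = _ := fun s hs =>
    congrArg₂ (· + ·) (h.pairing_eq hκ₀ hκ₁ ha₀ hI hψ.deriv_deriv ⟨hs.1, hs.2.trans_lt ht.2⟩)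
      (mul_sub _ _ _)
  constructor
  · refine hi.congr ?_
    rw [uIoc_of_le ht.1.le]
    exact fun s hs => (hcongr s hs).symm
  · have e3 := setIntegral_congr_fun (μ := volume) measurableSet_Ioc hcongr
    rw [← intervalIntegral.integral_of_le ht.1.le, ← intervalIntegral.integral_of_le ht.1.le,
      intervalIntegral.integral_add (i0.add (i1.sub j1)) (i2.sub j2),
      intervalIntegral.integral_add i0 (i1.sub j1), intervalIntegral.integral_sub i1 j1,
      intervalIntegral.integral_sub i2 j2] at e3
    rw [e3, e0, h.pairing_eq hκ₀ hκ₁ ha₀ hI hψ ht, ← e1, ← e2]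
    ring

lemma continuousAt_pairing (h : IsSolution κ a fI T f p) (hκ₀ : 0 < κ) (hκ₁ : κ ≤ 1) (ha₀ : 0 < a)
    (hI : ContinuousOn fI (Icc (-1) 1)) {ψ : ℝ → ℝ} (hψ : IsTest ψ) {t₀ : ℝ} (ht₀ : t₀ ∈ Ioo 0 T) :
    ContinuousAt (fun t => ∫ x in (-1 : ℝ)..1, f x t * ψ x) t₀ := by
  obtain ⟨t₁, h1, h2⟩ := exists_between ht₀.2
  have hi := (h.weak_eq hκ₀ hκ₁ ha₀ hI hψ ⟨ht₀.1.trans h1, h2⟩).1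
  have hc := intervalIntegral.continuousOn_primitive_interval' hi (left_mem_uIcc)
  rw [uIcc_of_le (ht₀.1.trans h1).le] at hc
  have hc2 := (hc.continuousAt (Icc_mem_nhds ht₀.1 h1)).const_add (∫ x in (-1 : ℝ)..1, fI x * ψ x)
  refine hc2.congr ?_
  filter_upwards [isOpen_Ioo.mem_nhds ht₀] with t ht
  exact ((h.weak_eq hκ₀ hκ₁ ha₀ hI hψ ht).2).symm

lemma continuousAt_weakRate (h : IsSolution κ a fI T f p) (hκ₀ : 0 < κ) (hκ₁ : κ ≤ 1) (ha₀ : 0 < a)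
    (hI : ContinuousOn fI (Icc (-1) 1)) {ψ : ℝ → ℝ} (hψ : IsTest ψ) {t₀ : ℝ} (ht₀ : t₀ ∈ Ioo 0 T) :
    ContinuousAt (weakRate κ a f p ψ) t₀ := by
  have hp := h.continuousAt_free_boundary ht₀
  have hj : ContinuousAt (fun t => jump κ a (p t)) t₀ :=
    (continuous_jump κ a).continuousAt.comp hp
  exact (h.continuousAt_pairing hκ₀ hκ₁ ha₀ hI hψ.deriv_deriv ht₀).add
    ((h.continuousAt_flux ht₀).mul ((hψ.continuous.continuousAt.comp (hp.sub hj)).sub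
      (hψ.continuous.continuousAt.comp (hp.add hj))))

lemma hasDerivAt_pairing (h : IsSolution κ a fI T f p) (hκ₀ : 0 < κ) (hκ₁ : κ ≤ 1) (ha₀ : 0 < a)
    (hI : ContinuousOn fI (Icc (-1) 1)) {ψ : ℝ → ℝ} (hψ : IsTest ψ) {t₀ : ℝ} (ht₀ : t₀ ∈ Ioo 0 T) :
    HasDerivAt (fun t => ∫ x in (-1 : ℝ)..1, f x t * ψ x) (weakRate κ a f p ψ t₀) t₀ := by
  have hc : ContinuousOn (weakRate κ a f p ψ) (Ioo 0 T) := fun t ht =>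
    (h.continuousAt_weakRate hκ₀ hκ₁ ha₀ hI hψ ht).continuousWithinAt
  have hd := (intervalIntegral.integral_hasDerivAt_right (h.weak_eq hκ₀ hκ₁ ha₀ hI hψ ht₀).1
    (hc.stronglyMeasurableAtFilter isOpen_Ioo t₀ ht₀)
    (h.continuousAt_weakRate hκ₀ hκ₁ ha₀ hI hψ ht₀)).const_add (∫ x in (-1 : ℝ)..1, fI x * ψ x)
  refine hd.congr_of_eventuallyEq ?_
  filter_upwards [isOpen_Ioo.mem_nhds ht₀] with t ht
  exact (h.weak_eq hκ₀ hκ₁ ha₀ hI hψ ht).2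

end IsSolution
/-! ### Constructing test functions -/

lemma isTest_comp_sin {F : ℝ → ℝ} (h : ContDiff ℝ ∞ fun x => F (Real.sin (Real.pi / 2 * x))) :
    IsTest fun x => F (Real.sin (Real.pi / 2 * x)) where
  smooth := h
  even_right x := by
    rw [show Real.pi / 2 * (2 - x) = Real.pi - Real.pi / 2 * x by ring, Real.sin_pi_sub]
  even_left x := by
    rw [show Real.pi / 2 * (-2 - x) = -(Real.pi / 2 * x + Real.pi) by ring, Real.sin_neg,
      Real.sin_add_pi, neg_neg]

lemma isTest_const (c : ℝ) : IsTest fun _ => c := ⟨contDiff_const, fun _ => rfl, fun _ => rfl⟩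

lemma IsTest.mul {φ ψ : ℝ → ℝ} (hφ : IsTest φ) (hψ : IsTest ψ) : IsTest fun x => φ x * ψ x :=
  ⟨hφ.smooth.mul hψ.smooth, fun x => by rw [hφ.even_right, hψ.even_right],
    fun x => by rw [hφ.even_left, hψ.even_left]⟩

lemma IsTest.sub {φ ψ : ℝ → ℝ} (hφ : IsTest φ) (hψ : IsTest ψ) : IsTest fun x => φ x - ψ x :=
  ⟨hφ.smooth.sub hψ.smooth, fun x => by rw [hφ.even_right, hψ.even_right],
    fun x => by rw [hφ.even_left, hψ.even_left]⟩

lemma strictMonoOn_sin_half_pi :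
    StrictMonoOn (fun x => Real.sin (Real.pi / 2 * x)) (Icc (-1) 1) := by
  intro x hx y hy hxy
  have := Real.pi_pos
  exact Real.strictMonoOn_sin ⟨by nlinarith [hx.1], by nlinarith [hx.2]⟩
    ⟨by nlinarith [hy.1], by nlinarith [hy.2]⟩ (by nlinarith)

/-- Smooth cutoffs among the test functions. -/
lemma exists_cutoff {b c : ℝ} (hb : -1 ≤ b) (hbc : b < c) (hc : c ≤ 1) :
    ∃ ζ : ℝ → ℝ, IsTest ζ ∧ (∀ x, 0 ≤ ζ x ∧ ζ x ≤ 1) ∧ (∀ x ∈ Icc (-1) b, ζ x = 1) ∧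
      ∀ x ∈ Icc c 1, ζ x = 0 := by
  set S : ℝ → ℝ := fun x => Real.sin (Real.pi / 2 * x)
  have hS := strictMonoOn_sin_half_pi
  have hbc' : 0 < S c - S b := sub_pos.2 (hS ⟨hb, by linarith⟩ ⟨by linarith, hc⟩ hbc)
  refine ⟨fun x => 1 - Real.smoothTransition ((S x - S b) / (S c - S b)), ?_, fun x => ?_,
    fun x hx => ?_, fun x hx => ?_⟩
  · refine isTest_comp_sin (F := fun w => 1 - Real.smoothTransition ((w - S b) / (S c - S b))) ?_
    refine contDiff_const.sub (Real.smoothTransition.contDiff.comp ?_)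
    exact ((Real.contDiff_sin.comp (contDiff_const.mul contDiff_id)).sub contDiff_const).div_const _
  · constructor
    · linarith [Real.smoothTransition.le_one ((S x - S b) / (S c - S b))]
    · linarith [Real.smoothTransition.nonneg ((S x - S b) / (S c - S b))]
  · have : S x ≤ S b := hS.monotoneOn ⟨hx.1, by linarith [hx.2]⟩ ⟨hb, by linarith⟩ hx.2
    beta_reduce
    rw [Real.smoothTransition.zero_of_nonpos, sub_zero]
    exact div_nonpos_of_nonpos_of_nonneg (by linarith) hbc'.le
  · have : S c ≤ S x := hS.monotoneOn ⟨by linarith, hc⟩ ⟨by linarith [hx.1], hx.2⟩ hx.1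
    beta_reduce
    rw [Real.smoothTransition.one_of_one_le, sub_self]
    rw [one_le_div hbc']; linarith

lemma deriv_eq_zero_on_Icc {g : ℝ → ℝ} {u v : ℝ} (huv : u < v) (hd : Continuous (deriv g))
    (hg : ∀ x ∈ Icc u v, g x = 0) : ∀ x ∈ Icc u v, deriv g x = 0 := by
  have h1 : EqOn (deriv g) (fun _ => 0) (Ioo u v) := fun x hx => by
    have : g =ᶠ[𝓝 x] fun _ => 0 := by
      filter_upwards [Icc_mem_nhds hx.1 hx.2] with y hy using hg y hy
    rw [this.deriv_eq, deriv_const]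
  have h2 := h1.closure hd continuous_const
  rw [closure_Ioo huv.ne] at h2
  exact h2

lemma IsTest.deriv_eq_zero {ψ : ℝ → ℝ} (h : IsTest ψ) {u v : ℝ} (huv : u < v)
    (hg : ∀ x ∈ Icc u v, ψ x = 0) : ∀ x ∈ Icc u v, deriv ψ x = 0 ∧ deriv (deriv ψ) x = 0 :=
  fun x hx => ⟨deriv_eq_zero_on_Icc huv h.contDiff_deriv.continuous hg x hx,
    deriv_eq_zero_on_Icc huv h.deriv_deriv.continuous
      (deriv_eq_zero_on_Icc huv h.contDiff_deriv.continuous hg) x hx⟩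

/-- If `D y > 0`, the bump `ζ₁(1 - ζ₂)`, equal to 1 at `y` and supported where `D > 0`, has a
positive integral against `D`. -/
lemma nonpos_of_integral_test {D : ℝ → ℝ} {b c : ℝ} (hb : -1 ≤ b) (hc : c ≤ 1)
    (hD : ContinuousOn D (Icc b c))
    (h : ∀ φ, IsTest φ → (∀ x ∈ Icc (-1) b, φ x = 0) → (∀ x ∈ Icc c 1, φ x = 0) →
      ∫ x in b..c, D x * φ x = 0) {y : ℝ} (hy : y ∈ Ioo b c) : D y ≤ 0 := by
  by_contra hpos
  push Not at hpos
  have hbc : b < c := hy.1.trans hy.2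
  have hev : ∀ᶠ x in 𝓝 y, 0 < D x ∧ x ∈ Ioo b c :=
    ((hD.continuousAt (Icc_mem_nhds hy.1 hy.2)).eventually_const_lt hpos).and
      (isOpen_Ioo.mem_nhds hy)
  obtain ⟨η, hη, hball⟩ := Metric.nhds_basis_closedBall.eventually_iff.1 hev
  have hin : ∀ x, y - η ≤ x → x ≤ y + η → 0 < D x ∧ x ∈ Ioo b c := fun x h1 h2 =>
    hball (by rw [Metric.mem_closedBall, Real.dist_eq]; exact abs_le.2 ⟨by linarith, by linarith⟩)
  have hl := (hin (y - η) le_rfl (by linarith)).2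
  have hr := (hin (y + η) (by linarith) le_rfl).2
  obtain ⟨ζ₁, t1, b1, one1, zero1⟩ := exists_cutoff (b := y) (c := y + η) (by linarith [hl.1])
    (by linarith) (by linarith [hr.2])
  obtain ⟨ζ₂, t2, b2, one2, zero2⟩ := exists_cutoff (b := y - η) (c := y) (by linarith [hl.1])
    (by linarith) (by linarith [hr.2])
  have ht : IsTest fun x => ζ₁ x * (1 - ζ₂ x) := t1.mul ((isTest_const 1).sub t2)
  have hz := h _ ht (fun x hx => by rw [one2 x ⟨hx.1, hx.2.trans hl.1.le⟩]; ring)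
    (fun x hx => by rw [zero1 x ⟨hr.2.le.trans hx.1, hx.2⟩]; ring)
  refine absurd hz (ne_of_gt (intervalIntegral.integral_pos hbc
    (hD.mul ht.continuous.continuousOn) (fun x hx => ?_) ⟨y, ⟨hy.1.le, hy.2.le⟩, ?_⟩))
  · have hφ : 0 ≤ ζ₁ x * (1 - ζ₂ x) := mul_nonneg (b1 x).1 (by linarith [(b2 x).2])
    rcases lt_or_ge x (y - η) with h1 | h1
    · rw [one2 x ⟨by linarith [hx.1], h1.le⟩]; simp
    rcases lt_or_ge (y + η) x with h2 | h2
    · rw [zero1 x ⟨h2.le, by linarith [hx.2]⟩]; simp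
    · exact mul_nonneg (hin x h1 h2).1.le hφ
  · rw [one1 y ⟨by linarith [hy.1], le_rfl⟩, zero2 y ⟨le_rfl, by linarith [hy.2]⟩]
    simpa using hpos

lemma eq_zero_of_integral_test {D : ℝ → ℝ} {b c : ℝ} (hb : -1 ≤ b) (hc : c ≤ 1)
    (hD : ContinuousOn D (Icc b c))
    (h : ∀ φ, IsTest φ → (∀ x ∈ Icc (-1) b, φ x = 0) → (∀ x ∈ Icc c 1, φ x = 0) →
      ∫ x in b..c, D x * φ x = 0) {y : ℝ} (hy : y ∈ Ioo b c) : D y = 0 := by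
  refine le_antisymm (nonpos_of_integral_test hb hc hD h hy) ?_
  have := nonpos_of_integral_test (D := fun x => -D x) hb hc hD.neg (fun φ h1 h2 h3 => ?_) hy
  · linarith
  · simp only [neg_mul, intervalIntegral.integral_neg, h φ h1 h2 h3, neg_zero]

/-! ### Calculus where the solution is smooth -/

section Smooth

variable {f : ℝ → ℝ → ℝ} {b c t₀ δ : ℝ}

/-- The space derivative. -/
noncomputable def dx (f : ℝ → ℝ → ℝ) (z : ℝ × ℝ) : ℝ :=
  fderiv ℝ (fun z : ℝ × ℝ => f z.1 z.2) z (1, 0)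

/-- The second space derivative. -/
noncomputable def dxx (f : ℝ → ℝ → ℝ) (z : ℝ × ℝ) : ℝ := fderiv ℝ (dx f) z (1, 0)

/-- The time derivative. -/
noncomputable def dt (f : ℝ → ℝ → ℝ) (z : ℝ × ℝ) : ℝ :=
  fderiv ℝ (fun z : ℝ × ℝ => f z.1 z.2) z (0, 1)

lemma contDiffAt_dx {z : ℝ × ℝ} (h : ContDiffAt ℝ 3 (fun z : ℝ × ℝ => f z.1 z.2) z) :
    ContDiffAt ℝ 2 (dx f) z :=
  IsSolution.continuousAt_fderiv (n := 2) (by exact_mod_cast h) (1, 0)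

lemma continuousAt_dxx {z : ℝ × ℝ} (h : ContDiffAt ℝ 3 (fun z : ℝ × ℝ => f z.1 z.2) z) :
    ContinuousAt (dxx f) z :=
  (IsSolution.continuousAt_fderiv (n := 1) (F := dx f) (by exact_mod_cast contDiffAt_dx h)
    (1, 0)).continuousAt

lemma continuousAt_dt {z : ℝ × ℝ} (h : ContDiffAt ℝ 3 (fun z : ℝ × ℝ => f z.1 z.2) z) :
    ContinuousAt (dt f) z :=
  (IsSolution.continuousAt_fderiv (n := 2) (by exact_mod_cast h) (0, 1)).continuousAt

lemma continuousOn_slice {g : ℝ × ℝ → ℝ} {s : Set ℝ} {t : ℝ}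
    (h : ∀ x ∈ s, ContinuousAt g (x, t)) : ContinuousOn (fun x => g (x, t)) s := fun x hx =>
  (ContinuousAt.comp (f := fun x => (x, t)) (h x hx) (by fun_prop)).continuousWithinAt

lemma hasDerivAt_integral_mul (hbc : b ≤ c) (hδ : 0 < δ)
    (hb : ∀ x ∈ Icc b c, ∀ t ∈ Icc (t₀ - δ) (t₀ + δ),
      ContDiffAt ℝ 3 (fun z : ℝ × ℝ => f z.1 z.2) (x, t))
    {φ : ℝ → ℝ} (hφ : Continuous φ) :
    HasDerivAt (fun t => ∫ x in b..c, f x t * φ x) (∫ x in b..c, dt f (x, t₀) * φ x) t₀ := by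
  have hc : ContinuousOn (fun z : ℝ × ℝ => dt f z * φ z.1)
      (Icc b c ×ˢ Icc (t₀ - δ) (t₀ + δ)) := fun z hz =>
    ((continuousAt_dt (hb z.1 hz.1 z.2 hz.2)).mul
      (hφ.continuousAt.comp continuousAt_fst)).continuousWithinAt
  obtain ⟨C, hC⟩ := (isCompact_Icc.prod isCompact_Icc).exists_bound_of_continuousOn hc
  have ht₀ : t₀ ∈ Icc (t₀ - δ) (t₀ + δ) := ⟨by linarith, by linarith⟩
  have hcf : ∀ t ∈ Icc (t₀ - δ) (t₀ + δ), ContinuousOn (fun x => f x t * φ x) (Icc b c) :=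
    fun t ht => (continuousOn_slice (g := fun z : ℝ × ℝ => f z.1 z.2)
      fun x hx => (hb x hx t ht).continuousAt).mul hφ.continuousOn
  have hmem : Icc (t₀ - δ) (t₀ + δ) ∈ 𝓝 t₀ := Icc_mem_nhds (by linarith) (by linarith)
  refine (intervalIntegral.hasDerivAt_integral_of_dominated_loc_of_deriv_le
    (F := fun t x => f x t * φ x) (F' := fun t x => dt f (x, t) * φ x) (bound := fun _ => C)
    hmem ?_ ?_ ?_ ?_ (by simp) ?_).2
  · filter_upwards [hmem] with t ht
    rw [uIoc_of_le hbc]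
    exact ((hcf t ht).mono Ioc_subset_Icc_self).aestronglyMeasurable measurableSet_Ioc
  · exact (hcf t₀ ht₀).intervalIntegrable_of_Icc hbc
  · rw [uIoc_of_le hbc]
    exact (((continuousOn_slice fun x hx => continuousAt_dt (hb x hx t₀ ht₀)).mul
      hφ.continuousOn).mono Ioc_subset_Icc_self).aestronglyMeasurable measurableSet_Ioc
  · refine ae_of_all _ fun x hx t ht => ?_
    rw [uIoc_of_le hbc] at hx
    exact hC (x, t) ⟨⟨hx.1.le, hx.2⟩, ht⟩
  · refine ae_of_all _ fun x hx t ht => ?_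
    rw [uIoc_of_le hbc] at hx
    exact (IsSolution.hasDerivAt_snd (F := fun z : ℝ × ℝ => f z.1 z.2)
      ((hb x ⟨hx.1.le, hx.2⟩ t ht).differentiableAt (by simp))).mul_const _

lemma integral_mul_deriv_deriv (hbc : b ≤ c)
    (hb : ∀ x ∈ Icc b c, ContDiffAt ℝ 3 (fun z : ℝ × ℝ => f z.1 z.2) (x, t₀))
    {φ : ℝ → ℝ} (hφ : IsTest φ) :
    ∫ x in b..c, f x t₀ * deriv (deriv φ) x = (∫ x in b..c, dxx f (x, t₀) * φ x) +
      ((f c t₀ * deriv φ c - dx f (c, t₀) * φ c) - (f b t₀ * deriv φ b - dx f (b, t₀) * φ b)) := by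
  have i1 : IntervalIntegrable (fun x => f x t₀ * deriv (deriv φ) x) volume b c :=
    ((continuousOn_slice (g := fun z : ℝ × ℝ => f z.1 z.2) fun x hx => (hb x hx).continuousAt).mul
      hφ.deriv_deriv.continuous.continuousOn).intervalIntegrable_of_Icc hbc
  have i2 : IntervalIntegrable (fun x => dxx f (x, t₀) * φ x) volume b c :=
    ((continuousOn_slice fun x hx => continuousAt_dxx (hb x hx)).mul
      hφ.continuous.continuousOn).intervalIntegrable_of_Icc hbc
  have key := intervalIntegral.integral_eq_sub_of_hasDerivAt
    (f := fun x => f x t₀ * deriv φ x - dx f (x, t₀) * φ x)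
    (f' := fun x => f x t₀ * deriv (deriv φ) x - dxx f (x, t₀) * φ x)
    (a := b) (b := c) (fun x hx => ?_) (i1.sub i2)
  · rw [intervalIntegral.integral_sub i1 i2] at key
    linarith
  · rw [uIcc_of_le hbc] at hx
    have h1 := IsSolution.hasDerivAt_fst (F := fun z : ℝ × ℝ => f z.1 z.2)
      ((hb x hx).differentiableAt (by simp))
    have h2 := IsSolution.hasDerivAt_fst (F := dx f)
      ((contDiffAt_dx (hb x hx)).differentiableAt (by simp))
    convert! (h1.mul (hφ.hasDerivAt_deriv x)).sub (h2.mul (hφ.hasDerivAt x)) using 1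
    simp only [dx, dxx]
    ring

end Smooth

/-! ### One-sided weak formulations -/

namespace IsSolution

variable {κ a : ℝ} {fI : ℝ → ℝ} {T : ℝ} {f : ℝ → ℝ → ℝ} {p : ℝ → ℝ}

lemma intervalIntegrable_mul {g ψ : ℝ → ℝ} (hg : ContinuousOn g (Icc (-1) 1)) (hψ : Continuous ψ)
    {b c : ℝ} (hb : b ∈ Icc (-1 : ℝ) 1) (hc : c ∈ Icc (-1 : ℝ) 1) :
    IntervalIntegrable (fun x => g x * ψ x) volume b c :=
  ((hg.mul hψ.continuousOn).mono (uIcc_subset_Icc hb hc)).intervalIntegrable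

/-- The heat equation holds near the free boundary. -/
lemma dt_eq_dxx (h : IsSolution κ a fI T f p) (hκ₀ : 0 < κ) (hκ₁ : κ ≤ 1) (ha₀ : 0 < a)
    (hI : ContinuousOn fI (Icc (-1) 1)) {t₀ b c δ : ℝ} (ht₀ : t₀ ∈ Ioo 0 T) (hδ : 0 < δ)
    (hb : -1 < b) (hbc : b < c) (hc : c < 1)
    (hbox : ∀ x ∈ Icc b c, ∀ t ∈ Icc (t₀ - δ) (t₀ + δ),
      ContDiffAt ℝ 3 (fun z : ℝ × ℝ => f z.1 z.2) (x, t))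
    (hl : p t₀ - jump κ a (p t₀) ∈ Icc (-1) b) (hr : p t₀ + jump κ a (p t₀) ∈ Icc c 1)
    {x : ℝ} (hx : x ∈ Ioo b c) : dt f (x, t₀) = dxx f (x, t₀) := by
  have htm : t₀ ∈ Icc (t₀ - δ) (t₀ + δ) := ⟨by linarith, by linarith⟩
  have hcont : ∀ t ∈ Ioo 0 T, ContinuousOn (fun x => f x t) (Icc (-1) 1) := fun t ht =>
    h.continuousOn_space hκ₀ hκ₁ ha₀ hI ht
  have hbm : b ∈ Icc (-1 : ℝ) 1 := ⟨by linarith, by linarith⟩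
  have hcm : c ∈ Icc (-1 : ℝ) 1 := ⟨by linarith, by linarith⟩
  have hlm : (-1 : ℝ) ∈ Icc (-1 : ℝ) 1 := by norm_num
  have hrm : (1 : ℝ) ∈ Icc (-1 : ℝ) 1 := by norm_num
  have hct := continuousOn_slice (s := Icc b c) fun x hx => continuousAt_dt (hbox x hx t₀ htm)
  have hcx := continuousOn_slice (s := Icc b c) fun x hx => continuousAt_dxx (hbox x hx t₀ htm)
  refine sub_eq_zero.1 (eq_zero_of_integral_test (D := fun x => dt f (x, t₀) - dxx f (x, t₀))
    hb.le hc.le (hct.sub hcx) (fun φ hφ h1 h2 => ?_) hx)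
  have restrict : ∀ t ∈ Ioo 0 T, ∀ g : ℝ → ℝ, Continuous g → (∀ x ∈ Icc (-1) b, g x = 0) →
      (∀ x ∈ Icc c 1, g x = 0) → ∫ x in (-1 : ℝ)..1, f x t * g x = ∫ x in b..c, f x t * g x := by
    intro t ht g hg g1 g2
    rw [← intervalIntegral.integral_add_adjacent_intervals
      (intervalIntegrable_mul (hcont t ht) hg hlm hbm)
      (intervalIntegrable_mul (hcont t ht) hg hbm hrm),
      ← intervalIntegral.integral_add_adjacent_intervals
      (intervalIntegrable_mul (hcont t ht) hg hbm hcm)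
      (intervalIntegrable_mul (hcont t ht) hg hcm hrm)]
    have e1 : ∫ x in (-1 : ℝ)..b, f x t * g x = 0 := by
      rw [intervalIntegral.integral_congr (g := fun _ => 0), intervalIntegral.integral_zero]
      intro x hx
      rw [uIcc_of_le hb.le] at hx
      simp [g1 x hx]
    have e2 : ∫ x in c..(1 : ℝ), f x t * g x = 0 := by
      rw [intervalIntegral.integral_congr (g := fun _ => 0), intervalIntegral.integral_zero]
      intro x hx
      rw [uIcc_of_le hc.le] at hx
      simp [g2 x hx]
    rw [e1, e2]; ring
  have d1 := hφ.deriv_eq_zero hb h1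
  have d2 := hφ.deriv_eq_zero hc h2
  have hw := h.hasDerivAt_pairing hκ₀ hκ₁ ha₀ hI hφ ht₀
  have hL := (hasDerivAt_integral_mul hbc.le hδ hbox hφ.continuous).congr_of_eventuallyEq
    (f₁ := fun t => ∫ x in (-1 : ℝ)..1, f x t * φ x) (by
      filter_upwards [isOpen_Ioo.mem_nhds ht₀] with t ht using restrict t ht φ hφ.continuous h1 h2)
  have heq := hw.unique hL
  have hibp := integral_mul_deriv_deriv hbc.le (fun x hx => hbox x hx t₀ htm) hφ
  rw [weakRate, h1 _ hl, h2 _ hr, restrict t₀ ht₀ _ hφ.deriv_deriv.continuous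
    (fun x hx => (d1 x hx).2) (fun x hx => (d2 x hx).2), hibp,
    (d1 b ⟨hb.le, le_rfl⟩).1, (d2 c ⟨le_rfl, hc.le⟩).1, h1 b ⟨hb.le, le_rfl⟩,
    h2 c ⟨le_rfl, hc.le⟩] at heq
  have i1 : IntervalIntegrable (fun x => dt f (x, t₀) * φ x) volume b c :=
    (hct.mul hφ.continuous.continuousOn).intervalIntegrable_of_Icc hbc.le
  have i2 : IntervalIntegrable (fun x => dxx f (x, t₀) * φ x) volume b c :=
    (hcx.mul hφ.continuous.continuousOn).intervalIntegrable_of_Icc hbc.le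
  simp only [sub_mul]
  rw [intervalIntegral.integral_sub i1 i2, ← heq]
  ring

/-- The contribution of the moving end point to the derivative vanishes. -/
lemma hasDerivAt_moving_end (h : IsSolution κ a fI T f p) {t₀ : ℝ} (ht₀ : t₀ ∈ Ioo 0 T)
    {φ : ℝ → ℝ} (hφ : IsTest φ) :
    HasDerivAt (fun t => ∫ x in (p t₀)..(p t), f x t * φ x) 0 t₀ := by
  obtain ⟨δ, hδ, hb⟩ := h.exists_box ht₀
  obtain ⟨C, hC0, hC⟩ := hφ.exists_bound
  have hm0 : p t₀ ∈ Icc (p t₀ - δ) (p t₀ + δ) := ⟨by linarith, by linarith⟩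
  have htm : t₀ ∈ Icc (t₀ - δ) (t₀ + δ) := ⟨by linarith, by linarith⟩
  have hp := h.continuousAt_free_boundary ht₀
  have hd := hasDerivAt_snd ((hb _ hm0 t₀ htm).2.2.1.differentiableAt (by simp))
  -- Between `p t₀` and `p t` the function `f(·,t)` is monotone and vanishes at `p t`, so there it
  -- is at most `|f (p t₀) t| = O(t - t₀)`. The interval has length `o(1)`, so continuity of `p`
  -- suffices and no derivative of `p` is needed.
  have hO : (fun t => f (p t₀) t - f (p t₀) t₀) =O[𝓝 t₀] fun t => t - t₀ := hd.isBigO_sub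
  have ho : (fun t => C * (p t - p t₀)) =o[𝓝 t₀] fun _ => (1 : ℝ) := by
    rw [Asymptotics.isLittleO_one_iff]
    have := (hp.sub_const (p t₀)).const_mul C
    simpa [ContinuousAt] using this
  have hprod := ho.mul_isBigO hO
  rw [hasDerivAt_iff_isLittleO]
  simp only [intervalIntegral.integral_same, sub_zero, smul_zero]
  refine Asymptotics.IsBigO.trans_isLittleO ?_ (by simpa using hprod)
  refine Asymptotics.IsBigO.of_bound 1 ?_
  filter_upwards [isOpen_Ioo.mem_nhds ht₀,
    Icc_mem_nhds (by linarith : t₀ - δ < t₀) (by linarith : t₀ < t₀ + δ),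
    hp.eventually (Icc_mem_nhds (by linarith : p t₀ - δ < p t₀) (by linarith : p t₀ < p t₀ + δ))]
    with t ht ht2 hpt
  have hanti := (strictAntiOn_box (f := f) (x₀ := p t₀) (δ := δ) (t := t)
    fun x hx => ⟨(hb x hx t ht2).2.2.1, (hb x hx t ht2).2.2.2⟩).antitoneOn
  have hz := h.apply_free_boundary ⟨ht.1.le, ht.2⟩
  have hz₀ := h.apply_free_boundary ⟨ht₀.1.le, ht₀.2⟩
  have hle := intervalIntegral.norm_integral_le_of_norm_le_const
    (a := p t₀) (b := p t) (f := fun x => f x t * φ x) (C := |f (p t₀) t| * C) fun x hx => ?_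
  · rw [one_mul]
    refine hle.trans (le_of_eq ?_)
    rw [hz₀, sub_zero, norm_mul, norm_mul, Real.norm_of_nonneg hC0, Real.norm_eq_abs,
      Real.norm_eq_abs]
    ring
  · rw [norm_mul]
    refine mul_le_mul ?_ (hC x) (norm_nonneg _) (abs_nonneg _)
    have hx' := uIoc_subset_uIcc hx
    have hxm : x ∈ Icc (p t₀ - δ) (p t₀ + δ) := uIcc_subset_Icc hm0 hpt hx'
    rw [Real.norm_eq_abs]
    rcases le_total (p t₀) (p t) with hle | hle
    · rw [uIcc_of_le hle] at hx'
      have h1 : f (p t) t ≤ f x t := hanti hxm hpt hx'.2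
      have h2 : f x t ≤ f (p t₀) t := hanti hm0 hxm hx'.1
      rw [abs_of_nonneg (by linarith), abs_of_nonneg (by linarith)]
      exact h2
    · rw [uIcc_of_ge hle] at hx'
      have h1 : f x t ≤ f (p t) t := hanti hpt hxm hx'.1
      have h2 : f (p t₀) t ≤ f x t := hanti hxm hm0 hx'.2
      rw [abs_of_nonpos (by linarith), abs_of_nonpos (by linarith)]
      linarith

/-- A cutoff splits `ψ` into `ψ₁`, which vanishes near and to the right of `p`, and `ψ₂`, which on
the left phase lives only where `f` is smooth. The global weak formulation handles `ψ₁`;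
differentiation under the integral, the heat equation and integration by parts handle `ψ₂`. -/
lemma hasDerivAt_left (h : IsSolution κ a fI T f p) (hκ₀ : 0 < κ) (hκ₁ : κ ≤ 1) (ha₀ : 0 < a)
    (hI : ContinuousOn fI (Icc (-1) 1)) {ψ : ℝ → ℝ} (hψ : IsTest ψ) {t₀ : ℝ} (ht₀ : t₀ ∈ Ioo 0 T) :
    HasDerivAt (fun t => ∫ x in (-1 : ℝ)..(p t), f x t * ψ x)
      ((∫ x in (-1 : ℝ)..(p t₀), f x t₀ * deriv (deriv ψ) x) +
        flux f p t₀ * (ψ (p t₀ - jump κ a (p t₀)) - ψ (p t₀))) t₀ := by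
  obtain ⟨δ₀, hδ₀, hb₀⟩ := h.exists_box ht₀
  have hm := h.mem t₀ ⟨ht₀.1.le, ht₀.2⟩
  set j := jump κ a (p t₀) with hj
  have hj0 : 0 < j := jump_pos hκ₀ ha₀ hm
  have hjle := jump_le (a := a) hκ₁ hm
  rw [← hj] at hjle
  -- Keeping `δ` below `j` puts both sources outside the box, so the heat equation has no source
  -- there.
  obtain ⟨δ, hδ, hδδ⟩ : ∃ δ, 0 < δ ∧ δ ≤ min δ₀ j / 2 :=
    ⟨min δ₀ j / 2, by have := lt_min hδ₀ hj0; linarith, le_rfl⟩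
  have hd1 : δ < δ₀ := by have := min_le_left δ₀ j; linarith
  have hd2 : δ < j := by have := min_le_right δ₀ j; linarith
  have hb : ∀ x ∈ Icc (p t₀ - δ) (p t₀ + δ), ∀ t ∈ Icc (t₀ - δ) (t₀ + δ),
      x ∈ Ioo (-1 : ℝ) 1 ∧ t ∈ Ioo 0 T ∧ ContDiffAt ℝ 3 (fun z : ℝ × ℝ => f z.1 z.2) (x, t) ∧
      fderiv ℝ (fun z : ℝ × ℝ => f z.1 z.2) (x, t) (1, 0) < 0 := fun x hx t ht =>
    hb₀ x ⟨by linarith [hx.1], by linarith [hx.2]⟩ t ⟨by linarith [ht.1], by linarith [ht.2]⟩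
  have htm : t₀ ∈ Icc (t₀ - δ) (t₀ + δ) := ⟨by linarith, by linarith⟩
  have hcl := (hb (p t₀ - δ) ⟨le_rfl, by linarith⟩ t₀ htm).1
  have hcr := (hb (p t₀ + δ) ⟨by linarith, le_rfl⟩ t₀ htm).1
  set c := p t₀ - δ with hc
  set m := p t₀ - δ / 2 with hmm
  have hcont : ∀ t ∈ Ioo 0 T, ContinuousOn (fun x => f x t) (Icc (-1) 1) := fun t ht =>
    h.continuousOn_space hκ₀ hκ₁ ha₀ hI ht
  have hlm : (-1 : ℝ) ∈ Icc (-1 : ℝ) 1 := by norm_num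
  have hrm : (1 : ℝ) ∈ Icc (-1 : ℝ) 1 := by norm_num
  have hcm : c ∈ Icc (-1 : ℝ) 1 := ⟨hcl.1.le, hcl.2.le⟩
  have hpm : p t₀ ∈ Icc (-1 : ℝ) 1 := ⟨hm.1.le, hm.2.le⟩
  obtain ⟨ζ, tζ, -, one, zero⟩ := exists_cutoff (b := c) (c := m) hcl.1.le (by linarith)
    (by linarith [hcr.2])
  have t1 : IsTest fun x => ψ x * ζ x := hψ.mul tζ
  have t2 : IsTest fun x => ψ x - ψ x * ζ x := hψ.sub t1
  have z1 : ∀ x ∈ Icc m 1, ψ x * ζ x = 0 := fun x hx => by rw [zero x hx, mul_zero]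
  have z2 : ∀ x ∈ Icc (-1) c, ψ x - ψ x * ζ x = 0 := fun x hx => by
    rw [one x hx, mul_one, sub_self]
  have dz1 := t1.deriv_eq_zero (by linarith [hcr.2]) z1
  have dz2 := t2.deriv_eq_zero hcl.1 z2
  set ψ₁ : ℝ → ℝ := fun x => ψ x * ζ x with hψ₁
  set ψ₂ : ℝ → ℝ := fun x => ψ x - ψ x * ζ x with hψ₂
  have split : ∀ t ∈ Ioo 0 T, p t ∈ Icc m 1 → ∀ g₁ g₂ : ℝ → ℝ, Continuous g₁ → Continuous g₂ →
      (∀ x ∈ Icc m 1, g₁ x = 0) → (∀ x ∈ Icc (-1) c, g₂ x = 0) →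
      ∫ x in (-1 : ℝ)..(p t), f x t * (g₁ x + g₂ x) =
        (∫ x in (-1 : ℝ)..1, f x t * g₁ x) + ∫ x in c..(p t), f x t * g₂ x := by
    intro t ht hpt g₁ g₂ hg₁ hg₂ e1 e2
    have hptm : p t ∈ Icc (-1 : ℝ) 1 := ⟨by linarith [hpt.1, hcl.1], hpt.2⟩
    simp only [mul_add]
    rw [intervalIntegral.integral_add (intervalIntegrable_mul (hcont t ht) hg₁ hlm hptm)
      (intervalIntegrable_mul (hcont t ht) hg₂ hlm hptm),
      ← intervalIntegral.integral_add_adjacent_intervals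
        (intervalIntegrable_mul (hcont t ht) hg₁ hlm hptm)
        (intervalIntegrable_mul (hcont t ht) hg₁ hptm hrm),
      ← intervalIntegral.integral_add_adjacent_intervals
        (intervalIntegrable_mul (hcont t ht) hg₂ hlm hcm)
        (intervalIntegrable_mul (hcont t ht) hg₂ hcm hptm)]
    have v1 : ∫ x in (p t)..(1 : ℝ), f x t * g₁ x = 0 := by
      rw [intervalIntegral.integral_congr (g := fun _ => 0), intervalIntegral.integral_zero]
      intro x hx
      rw [uIcc_of_le hpt.2] at hx
      simp [e1 x ⟨hpt.1.trans hx.1, hx.2⟩]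
    have v2 : ∫ x in (-1 : ℝ)..c, f x t * g₂ x = 0 := by
      rw [intervalIntegral.integral_congr (g := fun _ => 0), intervalIntegral.integral_zero]
      intro x hx
      rw [uIcc_of_le hcl.1.le] at hx
      simp [e2 x hx]
    rw [v1, v2]; ring
  have hpm₀ : p t₀ ∈ Icc m 1 := ⟨by linarith, hm.2.le⟩
  have hD1 := h.hasDerivAt_pairing hκ₀ hκ₁ ha₀ hI t1 ht₀
  have hbox : ∀ x ∈ Icc c (p t₀), ∀ t ∈ Icc (t₀ - δ) (t₀ + δ),
      ContDiffAt ℝ 3 (fun z : ℝ × ℝ => f z.1 z.2) (x, t) := fun x hx t ht =>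
    (hb x ⟨hx.1, by linarith [hx.2]⟩ t ht).2.2.1
  have hD2 := hasDerivAt_integral_mul (by linarith : c ≤ p t₀) hδ hbox t2.continuous
  have hD3 := h.hasDerivAt_moving_end ht₀ t2
  have hsum := hD1.add (hD2.add hD3)
  have hp := h.continuousAt_free_boundary ht₀
  have hev : (fun t => ∫ x in (-1 : ℝ)..(p t), f x t * ψ x) =ᶠ[𝓝 t₀]
      fun t => (∫ x in (-1 : ℝ)..1, f x t * ψ₁ x) +
        ((∫ x in c..(p t₀), f x t * ψ₂ x) + ∫ x in (p t₀)..(p t), f x t * ψ₂ x) := by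
    filter_upwards [isOpen_Ioo.mem_nhds ht₀,
      hp.eventually (Icc_mem_nhds (by linarith : m < p t₀) hm.2)] with t ht hpt
    have hptm : p t ∈ Icc (-1 : ℝ) 1 := ⟨by linarith [hpt.1, hcl.1], hpt.2⟩
    rw [intervalIntegral.integral_add_adjacent_intervals
      (intervalIntegrable_mul (hcont t ht) t2.continuous hcm hpm)
      (intervalIntegrable_mul (hcont t ht) t2.continuous hpm hptm),
      ← split t ht hpt ψ₁ ψ₂ t1.continuous t2.continuous z1 z2]
    refine intervalIntegral.integral_congr fun x _ => ?_
    simp only [hψ₁, hψ₂]; ring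
  refine (hsum.congr_of_eventuallyEq hev).congr_deriv ?_
  have hheat : ∫ x in c..(p t₀), dt f (x, t₀) * ψ₂ x =
      ∫ x in c..(p t₀), dxx f (x, t₀) * ψ₂ x := by
    refine intervalIntegral.integral_congr_ae ?_
    filter_upwards with x hx
    rw [uIoc_of_le (by linarith)] at hx
    rw [h.dt_eq_dxx hκ₀ hκ₁ ha₀ hI ht₀ hδ hcl.1 (by linarith) hcr.2
      (fun x hx t ht => (hb x hx t ht).2.2.1) ⟨by linarith, by linarith⟩
      ⟨by linarith, by linarith⟩ ⟨hx.1, by linarith [hx.2]⟩]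
  have hibp := integral_mul_deriv_deriv (by linarith : c ≤ p t₀)
    (fun x hx => hbox x hx t₀ htm) t2
  have hψ'' : ∀ x, deriv (deriv ψ) x = deriv (deriv ψ₁) x + deriv (deriv ψ₂) x := by
    have e1 : deriv ψ₂ = fun x => deriv ψ x - deriv ψ₁ x :=
      funext fun x => ((hψ.hasDerivAt x).sub (t1.hasDerivAt x)).deriv
    intro x
    have e2 : deriv (fun x => deriv ψ x - deriv ψ₁ x) x = _ :=
      ((hψ.hasDerivAt_deriv x).sub (t1.hasDerivAt_deriv x)).deriv
    rw [e1, e2]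
    ring
  have hsp := split t₀ ht₀ hpm₀ _ _ t1.deriv_deriv.continuous t2.deriv_deriv.continuous
    (fun x hx => (dz1 x hx).2) (fun x hx => (dz2 x hx).2)
  simp only [← hψ''] at hsp
  have hz₀ := h.apply_free_boundary ⟨ht₀.1.le, ht₀.2⟩
  have hψ₂p : ψ₂ (p t₀) = ψ (p t₀) := by
    have := z1 _ hpm₀
    simp only [hψ₂, this, sub_zero]
  have hψ₂c : ψ₂ c = 0 := z2 c ⟨hcl.1.le, le_rfl⟩
  have hψ₁l : ψ₁ (p t₀ - j) = ψ (p t₀ - j) := by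
    simp only [hψ₁]
    rw [one _ ⟨by linarith, by linarith⟩, mul_one]
  have hψ₁r : ψ₁ (p t₀ + j) = 0 := z1 _ ⟨by linarith, by linarith⟩
  have hflux : flux f p t₀ = -dx f (p t₀, t₀) :=
    flux_eq_of_differentiableAt ((h.smooth t₀ ht₀).differentiableAt (by simp))
  -- The source at `p - j` is seen by `ψ₁` alone. The outflow at `p` is the boundary term `f_x ψ =
  -- -λ ψ` left by the integration by parts.
  rw [hsp, weakRate, ← hj, hψ₁l, hψ₁r, hheat, hibp, hz₀, hψ₂p, (dz2 c ⟨hcl.1.le, le_rfl⟩).1,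
    hψ₂c, hflux]
  ring

/-- This is the left formulation minus the one on all of `[-1,1]`: the sources at `p - j` cancel. -/
lemma hasDerivAt_right (h : IsSolution κ a fI T f p) (hκ₀ : 0 < κ) (hκ₁ : κ ≤ 1) (ha₀ : 0 < a)
    (hI : ContinuousOn fI (Icc (-1) 1)) {ψ : ℝ → ℝ} (hψ : IsTest ψ) {t₀ : ℝ} (ht₀ : t₀ ∈ Ioo 0 T) :
    HasDerivAt (fun t => ∫ x in (p t)..1, -f x t * ψ x)
      ((∫ x in (p t₀)..1, -f x t₀ * deriv (deriv ψ) x) +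
        flux f p t₀ * (ψ (p t₀ + jump κ a (p t₀)) - ψ (p t₀))) t₀ := by
  have split : ∀ t ∈ Ioo 0 T, ∀ g : ℝ → ℝ, Continuous g → ∫ x in (p t)..1, -f x t * g x =
      (∫ x in (-1 : ℝ)..(p t), f x t * g x) - ∫ x in (-1 : ℝ)..1, f x t * g x := by
    intro t ht g hg
    have hcont := h.continuousOn_space hκ₀ hκ₁ ha₀ hI ht
    have hm := h.mem t ⟨ht.1.le, ht.2⟩
    rw [← intervalIntegral.integral_add_adjacent_intervals
      (intervalIntegrable_mul hcont hg (b := -1) (c := p t) (by norm_num) ⟨hm.1.le, hm.2.le⟩)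
      (intervalIntegrable_mul hcont hg (c := 1) ⟨hm.1.le, hm.2.le⟩ (by norm_num))]
    simp only [neg_mul, intervalIntegral.integral_neg]
    ring
  have hd := (h.hasDerivAt_left hκ₀ hκ₁ ha₀ hI hψ ht₀).sub
    (h.hasDerivAt_pairing hκ₀ hκ₁ ha₀ hI hψ ht₀)
  refine (hd.congr_of_eventuallyEq ?_).congr_deriv ?_
  · filter_upwards [isOpen_Ioo.mem_nhds ht₀] with t ht using split t ht ψ hψ.continuous
  · rw [split t₀ ht₀ _ hψ.deriv_deriv.continuous, weakRate]
    ring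

end IsSolution

/-! ### Test functions of the squared distance to the right end point -/

/-- `1 - sin (πx/2)`, comparable to `(1-x)²`. -/
noncomputable def defect (x : ℝ) : ℝ := 1 - Real.sin (Real.pi / 2 * x)

/-- The constant `π²/4`. -/
noncomputable def kpi : ℝ := (Real.pi / 2) ^ 2

lemma kpi_pos : 0 < kpi := by unfold kpi; have := Real.pi_pos; positivity

lemma defect_mem (x : ℝ) : defect x ∈ Icc (0 : ℝ) 2 := by
  have h1 := Real.sin_le_one (Real.pi / 2 * x)
  have h2 := Real.neg_one_le_sin (Real.pi / 2 * x)
  constructor <;> unfold defect <;> linarith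

lemma contDiff_defect : ContDiff ℝ ∞ defect :=
  contDiff_const.sub (Real.contDiff_sin.comp (contDiff_const.mul contDiff_id))

lemma continuous_defect : Continuous defect := contDiff_defect.continuous

lemma isTest_comp_defect {F : ℝ → ℝ} (h : ContDiff ℝ ∞ fun x => F (defect x)) :
    IsTest fun x => F (defect x) :=
  isTest_comp_sin (F := fun w => F (1 - w)) h

lemma isTest_defect : IsTest defect := isTest_comp_defect (F := fun w => w) contDiff_defect

lemma hasDerivAt_defect (x : ℝ) :
    HasDerivAt defect (-(Real.pi / 2 * Real.cos (Real.pi / 2 * x))) x := by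
  have h1 : HasDerivAt (fun x : ℝ => Real.pi / 2 * x) (Real.pi / 2) x := by
    simpa using (hasDerivAt_id x).const_mul (Real.pi / 2)
  refine (h1.sin.const_sub 1).congr_deriv ?_
  ring

/-- `w = defect` satisfies `w'² = kpi w(2-w)` and `w'' = kpi(1-w)`, so diffusion acts on functions
of `w` as an ordinary differential operator in `w`. -/
lemma deriv_deriv_comp_defect {F F' F'' : ℝ → ℝ}
    (h1 : ∀ w ∈ Icc (0 : ℝ) 2, HasDerivAt F (F' w) w)
    (h2 : ∀ w ∈ Icc (0 : ℝ) 2, HasDerivAt F' (F'' w) w) (x : ℝ) :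
    deriv (deriv fun x => F (defect x)) x =
      kpi * (defect x * (2 - defect x) * F'' (defect x) + (1 - defect x) * F' (defect x)) := by
  have e1 : (deriv fun x => F (defect x)) =
      fun x => F' (defect x) * -(Real.pi / 2 * Real.cos (Real.pi / 2 * x)) :=
    funext fun x => ((h1 _ (defect_mem x)).comp x (hasDerivAt_defect x)).deriv
  have h3 : HasDerivAt (fun x : ℝ => Real.pi / 2 * x) (Real.pi / 2) x := by
    simpa using (hasDerivAt_id x).const_mul (Real.pi / 2)
  have h4 := ((h2 _ (defect_mem x)).comp x (hasDerivAt_defect x)).mul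
    ((h3.cos.const_mul (Real.pi / 2)).neg)
  rw [e1]
  refine h4.deriv.trans ?_
  have hs := Real.sin_sq_add_cos_sq (Real.pi / 2 * x)
  have hd : Real.sin (Real.pi / 2 * x) = 1 - defect x := by simp [defect]
  rw [hd] at hs ⊢
  have hc : Real.cos (Real.pi / 2 * x) ^ 2 = defect x * (2 - defect x) := by linarith
  simp only [Function.comp, kpi, Pi.neg_apply]
  rw [← hc]
  ring

lemma defect_strictAntiOn : StrictAntiOn defect (Icc (-1) 1) := fun x hx y hy hxy => by
  have := strictMonoOn_sin_half_pi hx hy hxy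
  simp only [defect] at *
  linarith

lemma defect_one : defect 1 = 0 := by simp [defect]

lemma defect_pos {x : ℝ} (hx : x ∈ Ico (-1 : ℝ) 1) : 0 < defect x := by
  rw [← defect_one]
  exact defect_strictAntiOn ⟨hx.1, hx.2.le⟩ (by norm_num) hx.2

lemma defect_sub_defect (x y : ℝ) : defect (x - y) - defect x =
    2 * (Real.sin (Real.pi / 4 * y) * Real.cos (Real.pi / 2 * (x - y / 2))) := by
  simp only [defect]
  have h1 : Real.pi / 2 * x = Real.pi / 2 * (x - y / 2) + Real.pi / 4 * y := by ring
  have h2 : Real.pi / 2 * (x - y) = Real.pi / 2 * (x - y / 2) - Real.pi / 4 * y := by ring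
  rw [h1, h2, Real.sin_add, Real.sin_sub]
  ring

/-- The dipole is at least a third as strong on the far side as on the near side. -/
lemma defect_dipole {p j : ℝ} (hj : 0 < j) (h1 : j ≤ 1 - p) (h2 : j ≤ 1 + p) :
    (defect p - defect (p + j)) / 3 ≤ defect (p - j) - defect p := by
  have e1 := defect_sub_defect p j
  have e2 := defect_sub_defect (p + j) j
  rw [add_sub_cancel_right, show p + j - j / 2 = p + j / 2 by ring] at e2
  rw [e1, e2]
  have hpi := Real.pi_pos
  have hs : 0 ≤ Real.sin (Real.pi / 4 * j) :=
    Real.sin_nonneg_of_nonneg_of_le_pi (by positivity) (by nlinarith)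
  have hcm : -(Real.pi / 2) ∈ Icc (-(Real.pi / 2)) (Real.pi / 2) := ⟨le_rfl, by linarith⟩
  have hm : Real.pi / 2 * (p + j / 2) ∈ Icc (-(Real.pi / 2)) (Real.pi / 2) :=
    ⟨by nlinarith, by nlinarith⟩
  -- The midpoints `p - j/2` and `p + j/2` of the two jumps have distances from `-1` in the ratio
  -- `th`, which is at least `1/3` because `j ≤ 1 + p`. The cosine is concave and vanishes at the
  -- argument of `-1`, so its values there have ratio at least `th`.
  set th := (1 + p - j / 2) / (1 + p + j / 2) with hth
  have hden : 0 < 1 + p + j / 2 := by linarith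
  have hth1 : 1 / 3 ≤ th := by rw [hth, div_le_div_iff₀ (by norm_num) hden]; linarith
  have hth2 : th ≤ 1 := by rw [hth, div_le_one hden]; linarith
  have hconc := strictConcaveOn_cos_Icc.concaveOn.2 hm hcm
    (by linarith : 0 ≤ th) (by linarith : 0 ≤ 1 - th) (by ring)
  simp only [smul_eq_mul, Real.cos_neg, Real.cos_pi_div_two, mul_zero, add_zero] at hconc
  have hpt : th * (Real.pi / 2 * (p + j / 2)) + (1 - th) * -(Real.pi / 2) =
      Real.pi / 2 * (p - j / 2) := by
    have : th * (1 + p + j / 2) = 1 + p - j / 2 := by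
      rw [hth]; exact div_mul_cancel₀ _ hden.ne'
    linear_combination (Real.pi / 2) * this
  rw [hpt] at hconc
  have hc0 : 0 ≤ Real.cos (Real.pi / 2 * (p + j / 2)) := Real.cos_nonneg_of_mem_Icc hm
  have : Real.cos (Real.pi / 2 * (p + j / 2)) / 3 ≤ Real.cos (Real.pi / 2 * (p - j / 2)) :=
    le_trans (by nlinarith) hconc
  nlinarith

/-- Here `w = 2 sin²(π(1-x)/4)`. The jump at most doubles `1 - x`, concavity then at most doubles
the sine, and squaring gives 4. -/
lemma defect_sub_le {p j : ℝ} (hj : 0 < j) (h1 : j ≤ 1 - p) (h2 : j ≤ 1 + p) :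
    defect (p - j) ≤ 4 * defect p := by
  have key : ∀ x, defect x = 2 * Real.sin (Real.pi / 4 * (1 - x)) ^ 2 := fun x => by
    rw [Real.sin_sq_eq_half_sub, defect,
      show 2 * (Real.pi / 4 * (1 - x)) = Real.pi / 2 - Real.pi / 2 * x by ring,
      Real.cos_pi_div_two_sub]
    ring
  have hpi := Real.pi_pos
  set y := 1 - p with hy
  have hm0 : (0 : ℝ) ∈ Icc 0 Real.pi := ⟨le_rfl, hpi.le⟩
  have hm1 : Real.pi / 4 * (y + j) ∈ Icc 0 Real.pi := ⟨by nlinarith, by nlinarith⟩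
  have hw0 : 0 ≤ 1 - y / (y + j) := by rw [sub_nonneg, div_le_one (by linarith)]; linarith
  have hw1 : 0 ≤ y / (y + j) := div_nonneg (by linarith) (by linarith)
  have hconc := strictConcaveOn_sin_Icc.concaveOn.2 hm0 hm1 hw0 hw1 (by ring)
  simp only [smul_eq_mul, Real.sin_zero, mul_zero, zero_add] at hconc
  have hpt : y / (y + j) * (Real.pi / 4 * (y + j)) = Real.pi / 4 * y := by
    have : y + j ≠ 0 := by linarith
    field_simp
  rw [hpt] at hconc
  have hhalf : 1 / 2 ≤ y / (y + j) := by
    rw [div_le_div_iff₀ (by norm_num) (by linarith)]; linarith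
  have hs : 0 ≤ Real.sin (Real.pi / 4 * (y + j)) :=
    Real.sin_nonneg_of_nonneg_of_le_pi (by nlinarith) (by nlinarith)
  rw [key, key, show 1 - (p - j) = y + j by rw [hy]; ring, ← hy]
  nlinarith [mul_le_mul_of_nonneg_right hhalf hs]

/-! The four test functions. -/

lemma isTest_inv {s : ℝ} (hs : 0 < s) : IsTest fun x => (s + defect x)⁻¹ :=
  isTest_comp_defect (F := fun w => (s + w)⁻¹) ((contDiff_const.add contDiff_defect).inv
    fun x => by have := (defect_mem x).1; positivity)

lemma isTest_inv_sq {s : ℝ} (hs : 0 < s) : IsTest fun x => (s + defect x)⁻¹ ^ 2 := by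
  simpa only [pow_two] using (isTest_inv hs).mul (isTest_inv hs)

lemma isTest_ratio {s : ℝ} (hs : 0 < s) : IsTest fun x => defect x * (s + defect x)⁻¹ :=
  isTest_defect.mul (isTest_inv hs)

lemma isTest_log {s R : ℝ} (hs : 0 < s) (hR : 0 < R) :
    IsTest fun x => Real.log (R + defect x) - Real.log (s + defect x) :=
  isTest_comp_defect (F := fun w => Real.log (R + w) - Real.log (s + w))
    (((contDiff_const.add contDiff_defect).log fun x => by
      have := (defect_mem x).1; positivity).sub
    ((contDiff_const.add contDiff_defect).log fun x => by
      have := (defect_mem x).1; positivity))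

lemma deriv_deriv_defect (x : ℝ) : deriv (deriv defect) x = kpi * (1 - defect x) := by
  have := deriv_deriv_comp_defect (F := fun w => w) (F' := fun _ => 1) (F'' := fun _ => 0)
    (fun w _ => hasDerivAt_id w) (fun w _ => hasDerivAt_const w 1) x
  simpa using this

lemma hasDerivAt_inv_add {s w : ℝ} (hs : 0 < s) (hw : 0 ≤ w) :
    HasDerivAt (fun w => (s + w)⁻¹) (-((s + w) ^ 2)⁻¹) w := by
  have h := ((hasDerivAt_id w).const_add s).inv (by simp; positivity)
  convert! h using 1
  simp [neg_div]

lemma hasDerivAt_inv_add_sq {s w : ℝ} (hs : 0 < s) (hw : 0 ≤ w) :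
    HasDerivAt (fun w => ((s + w) ^ 2)⁻¹) (-2 * ((s + w) ^ 3)⁻¹) w := by
  have h := (((hasDerivAt_id w).const_add s).pow 2).inv (by simp; positivity)
  convert! h using 1
  have : s + w ≠ 0 := by positivity
  simp
  field_simp

lemma deriv_deriv_inv {s : ℝ} (hs : 0 < s) (x : ℝ) :
    deriv (deriv fun x => (s + defect x)⁻¹) x =
      kpi * (defect x * (2 - defect x) * (2 * ((s + defect x) ^ 3)⁻¹) +
        (1 - defect x) * -((s + defect x) ^ 2)⁻¹) := by
  refine deriv_deriv_comp_defect (F := fun w => (s + w)⁻¹) (F' := fun w => -((s + w) ^ 2)⁻¹)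
    (F'' := fun w => 2 * ((s + w) ^ 3)⁻¹) (fun w hw => hasDerivAt_inv_add hs hw.1)
    (fun w hw => ?_) x
  refine (hasDerivAt_inv_add_sq hs hw.1).neg.congr_deriv ?_
  ring

lemma deriv_deriv_ratio {s : ℝ} (hs : 0 < s) (x : ℝ) :
    deriv (deriv fun x => defect x * (s + defect x)⁻¹) x =
      kpi * (defect x * (2 - defect x) * (-2 * s * ((s + defect x) ^ 3)⁻¹) +
        (1 - defect x) * (s * ((s + defect x) ^ 2)⁻¹)) := by
  refine deriv_deriv_comp_defect (F := fun w => w * (s + w)⁻¹)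
    (F' := fun w => s * ((s + w) ^ 2)⁻¹)
    (F'' := fun w => -2 * s * ((s + w) ^ 3)⁻¹) (fun w hw => ?_) (fun w hw => ?_) x
  · refine ((hasDerivAt_id w).mul (hasDerivAt_inv_add hs hw.1)).congr_deriv ?_
    have : s + w ≠ 0 := by have := hw.1; positivity
    simp only [id]
    field_simp
    ring
  · refine ((hasDerivAt_inv_add_sq hs hw.1).const_mul s).congr_deriv ?_
    ring

lemma deriv_deriv_log {s R : ℝ} (hs : 0 < s) (hR : 0 < R) (x : ℝ) :
    deriv (deriv fun x => Real.log (R + defect x) - Real.log (s + defect x)) x =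
      kpi * (defect x * (2 - defect x) * (((s + defect x) ^ 2)⁻¹ - ((R + defect x) ^ 2)⁻¹) +
        (1 - defect x) * ((R + defect x)⁻¹ - (s + defect x)⁻¹)) := by
  refine deriv_deriv_comp_defect (F := fun w => Real.log (R + w) - Real.log (s + w))
    (F' := fun w => (R + w)⁻¹ - (s + w)⁻¹)
    (F'' := fun w => ((s + w) ^ 2)⁻¹ - ((R + w) ^ 2)⁻¹) (fun w hw => ?_) (fun w hw => ?_) x
  · have hl : ∀ c : ℝ, 0 < c → HasDerivAt (fun w => Real.log (c + w)) (c + w)⁻¹ w := fun c hc => by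
      have := ((hasDerivAt_id w).const_add c).log (by have := hw.1; simp; positivity)
      simpa using this
    exact (hl R hR).sub (hl s hs)
  · refine ((hasDerivAt_inv_add hR hw.1).sub (hasDerivAt_inv_add hs hw.1)).congr_deriv ?_
    ring

/-! Pointwise inequalities. -/

/-- `σ^{3/4}/(σ+v)` is a supersolution of the backward equation when `σ` decreases at rate `3π²/4`,
up to a bounded rate. -/
lemma supersolution_ineq {s w : ℝ} (hs : 0 < s) (hw : 0 ≤ w) :
    kpi * (w * (2 - w) * (2 * ((s + w) ^ 3)⁻¹) + (1 - w) * -((s + w) ^ 2)⁻¹) +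
      3 * kpi * (s + w)⁻¹ ^ 2 ≤ (kpi + 9 / 4 * kpi / s) * (s + w)⁻¹ := by
  have hsw : 0 < s + w := by positivity
  have key : w * (2 - w) * 2 * s - (1 - w) * (s + w) * s + 3 * (s + w) * s ≤
      (s + 9 / 4) * (s + w) ^ 2 := by
    have h1 : 0 ≤ s * (2 * w ^ 2 - w * (s + w) + (s + w) ^ 2) :=
      mul_nonneg hs.le (by nlinarith [sq_nonneg (w - (s + w) / 2), sq_nonneg w, sq_nonneg (s + w)])
    nlinarith [sq_nonneg (2 * w - (s + w) / 2)]
  have e : (kpi + 9 / 4 * kpi / s) * (s + w)⁻¹ -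
      (kpi * (w * (2 - w) * (2 * ((s + w) ^ 3)⁻¹) + (1 - w) * -((s + w) ^ 2)⁻¹) +
        3 * kpi * (s + w)⁻¹ ^ 2) = kpi / (s * (s + w) ^ 3) * ((s + 9 / 4) * (s + w) ^ 2 -
      (w * (2 - w) * 2 * s - (1 - w) * (s + w) * s + 3 * (s + w) * s)) := by
    field_simp
    ring
  have := mul_nonneg (by have := kpi_pos; positivity : 0 ≤ kpi / (s * (s + w) ^ 3))
    (sub_nonneg.2 key)
  linarith

/-- Diffusion can raise the logarithmic potential only as fast as the left phase concentrates at the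
wall, a rate that `exists_lint_inv_le` controls. -/
lemma log_operator_le {s R w : ℝ} (hs : 0 < s) (hsR : s ≤ R) (hw : w ∈ Icc (0 : ℝ) 2) :
    kpi * (w * (2 - w) * (((s + w) ^ 2)⁻¹ - ((R + w) ^ 2)⁻¹) +
        (1 - w) * ((R + w)⁻¹ - (s + w)⁻¹)) ≤ 3 * kpi * (s + w)⁻¹ := by
  have hw0 := hw.1
  have hsw : 0 < s + w := by positivity
  have hRw : 0 < R + w := by linarith
  have h1 : w * (2 - w) * (((s + w) ^ 2)⁻¹ - ((R + w) ^ 2)⁻¹) ≤ 2 * (s + w)⁻¹ := by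
    have ha : 0 ≤ w * (2 - w) := mul_nonneg hw0 (by linarith [hw.2])
    have hb : 0 ≤ ((R + w) ^ 2)⁻¹ := by positivity
    have hc : w * (2 - w) ≤ 2 * (s + w) := by nlinarith
    calc _ ≤ w * (2 - w) * ((s + w) ^ 2)⁻¹ := by nlinarith
      _ ≤ 2 * (s + w) * ((s + w) ^ 2)⁻¹ := by gcongr
      _ = _ := by field_simp
  have h2 : (1 - w) * ((R + w)⁻¹ - (s + w)⁻¹) ≤ (s + w)⁻¹ := by
    have ha : (R + w)⁻¹ ≤ (s + w)⁻¹ := by gcongr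
    have hb : 0 < (R + w)⁻¹ := by positivity
    nlinarith [hw.2]
  have := kpi_pos
  nlinarith

/-- For `w` small against `s`, diffusion raises the weight `w/(s+w)` at a rate about `kpi/s`. The
term `-6w/(s+w)` absorbs the region where it does not, leaving a linear relaxation law. -/
lemma ratio_operator_ge {s w : ℝ} (hs : 0 < s) (hw : 0 ≤ w) :
    kpi / s * ((1 - s) - 6 * (w * (s + w)⁻¹)) ≤
      kpi * (w * (2 - w) * (-2 * s * ((s + w) ^ 3)⁻¹) + (1 - w) * (s * ((s + w) ^ 2)⁻¹)) := by
  have hsw : 0 < s + w := by positivity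
  have key : 0 ≤ 9 * s * w ^ 2 + 5 * w ^ 3 + s ^ 2 * w ^ 2 + (s * (s + w) ^ 3 - s ^ 3 * w) := by
    have : 0 ≤ s * (s + w) ^ 3 - s ^ 3 * w := by
      have : s * (s + w) ^ 3 - s ^ 3 * w =
        s * (s ^ 3 + 2 * s ^ 2 * w + 3 * s * w ^ 2 + w ^ 3) := by ring
      rw [this]; positivity
    positivity
  have e : kpi * (w * (2 - w) * (-2 * s * ((s + w) ^ 3)⁻¹) + (1 - w) * (s * ((s + w) ^ 2)⁻¹)) -
      kpi / s * ((1 - s) - 6 * (w * (s + w)⁻¹)) = kpi / (s * (s + w) ^ 3) *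
      (9 * s * w ^ 2 + 5 * w ^ 3 + s ^ 2 * w ^ 2 + (s * (s + w) ^ 3 - s ^ 3 * w)) := by
    field_simp
    ring
  have := mul_nonneg (by have := kpi_pos; positivity : 0 ≤ kpi / (s * (s + w) ^ 3)) key
  linarith

/-- The loss of the near mass in a jump is controlled by the gain of the far mass. -/
lemma loss_le {s R v vm vp : ℝ} (hs : 0 < s) (hsR : s ≤ R / 2) (hvp : 0 ≤ vp) (h1 : vp ≤ v)
    (h2 : v ≤ vm) (h3 : vm ≤ 4 * v) (h4 : (v - vp) / 3 ≤ vm - v) :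
    v * (s + v)⁻¹ - vp * (s + vp)⁻¹ ≤
      48 * ((Real.log (R + v) - Real.log (s + v)) - (Real.log (R + vm) - Real.log (s + vm))) +
        3 / R * (vm - v) := by
  have hR : 0 < R := by linarith
  have hv : 0 ≤ v := hvp.trans h1
  have hsv : 0 < s + v := by positivity
  have hsvp : 0 < s + vp := by positivity
  have hsvm : 0 < s + vm := by linarith
  have hRv : 0 < R + v := by positivity
  have hRvm : 0 < R + vm := by linarith
  have hloss : v * (s + v)⁻¹ - vp * (s + vp)⁻¹ ≤ (v - vp) / (s + v) := by
    have e : (v - vp) / (s + v) - (v * (s + v)⁻¹ - vp * (s + vp)⁻¹) =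
        vp * (v - vp) / ((s + v) * (s + vp)) := by
      field_simp; ring
    have : 0 ≤ vp * (v - vp) / ((s + v) * (s + vp)) := by
      have := sub_nonneg.2 h1; positivity
    linarith
  have hgain : (R - s) * (vm - v) / ((R + v) * (s + vm)) ≤
      (Real.log (R + v) - Real.log (s + v)) - (Real.log (R + vm) - Real.log (s + vm)) := by
    have hz : 0 < (R + v) * (s + vm) / ((s + v) * (R + vm)) := by positivity
    have hlog := Real.one_sub_inv_le_log_of_pos hz
    rw [Real.log_div (by positivity) (by positivity), Real.log_mul hRv.ne' hsvm.ne',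
      Real.log_mul hsv.ne' hRvm.ne'] at hlog
    have e : 1 - ((R + v) * (s + vm) / ((s + v) * (R + vm)))⁻¹ =
        (R - s) * (vm - v) / ((R + v) * (s + vm)) := by
      field_simp; ring
    linarith
  have hmv : 0 ≤ vm - v := sub_nonneg.2 h2
  have hgain0 : 0 ≤ (R - s) * (vm - v) / ((R + v) * (s + vm)) :=
    div_nonneg (mul_nonneg (by linarith) hmv) (by positivity)
  -- Up to `R` the logarithm pays, with `48 = 3·2·4·2`: the dipole ratio, `R + v ≤ 2R`, `s + vm ≤
  -- 4(s + v)` and `R - s ≥ R/2`. Beyond `R` the loss is at most `(v - vp)/R`, and the gain in `w`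
  -- pays.
  rcases le_or_gt v R with hvR | hvR
  · have h5 : (v - vp) / (s + v) ≤ 48 * ((R - s) * (vm - v) / ((R + v) * (s + vm))) := by
      rw [mul_div_assoc', div_le_div_iff₀ hsv (by positivity)]
      have ha : (R + v) * (s + vm) ≤ 2 * R * (4 * (s + v)) := by gcongr <;> linarith
      have hb : R / 2 * (vm - v) ≤ (R - s) * (vm - v) := by gcongr; linarith
      calc (v - vp) * ((R + v) * (s + vm)) ≤ (3 * (vm - v)) * (2 * R * (4 * (s + v))) := by
            have := sub_nonneg.2 h1
            gcongr
            linarith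
        _ = 48 * (R / 2 * (vm - v)) * (s + v) := by ring
        _ ≤ _ := by gcongr
    have h6 : 0 ≤ 3 / R * (vm - v) := by positivity
    linarith
  · have h5 : (v - vp) / (s + v) ≤ 3 / R * (vm - v) := by
      calc (v - vp) / (s + v) ≤ (3 * (vm - v)) / R := by
            have := sub_nonneg.2 h1
            gcongr <;> linarith
        _ = _ := by ring
    linarith

/-! ### The abstract free boundary problem -/

/-- The one-sided weak formulations of a free boundary problem with jump lengths `j` and fluxes
`lam`. -/
structure IsFreeBoundary (T : ℝ) (f : ℝ → ℝ → ℝ) (p lam j : ℝ → ℝ) : Prop where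
  pos_time : 0 < T
  mem : ∀ t ∈ Ioo 0 T, p t ∈ Ioo (-1 : ℝ) 1
  jump_pos : ∀ t ∈ Ioo 0 T, 0 < j t
  jump_le_right : ∀ t ∈ Ioo 0 T, j t ≤ 1 - p t
  jump_le_left : ∀ t ∈ Ioo 0 T, j t ≤ 1 + p t
  flux_pos : ∀ t ∈ Ioo 0 T, 0 < lam t
  continuousOn : ∀ t ∈ Ioo 0 T, ContinuousOn (fun x => f x t) (Icc (-1) 1)
  pos : ∀ t ∈ Ioo 0 T, ∀ x, -1 ≤ x → x < p t → 0 < f x t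
  neg : ∀ t ∈ Ioo 0 T, ∀ x, x ≤ 1 → p t < x → f x t < 0
  left : ∀ t ∈ Ioo 0 T, ∀ ψ, IsTest ψ →
    HasDerivAt (fun t => ∫ x in (-1 : ℝ)..(p t), f x t * ψ x)
      ((∫ x in (-1 : ℝ)..(p t), f x t * deriv (deriv ψ) x) +
        lam t * (ψ (p t - j t) - ψ (p t))) t
  right : ∀ t ∈ Ioo 0 T, ∀ ψ, IsTest ψ →
    HasDerivAt (fun t => ∫ x in (p t)..1, -f x t * ψ x)
      ((∫ x in (p t)..1, -f x t * deriv (deriv ψ) x) +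
        lam t * (ψ (p t + j t) - ψ (p t))) t

lemma IsTest.comp_neg {ψ : ℝ → ℝ} (h : IsTest ψ) : IsTest fun x => ψ (-x) where
  smooth := h.smooth.comp contDiff_neg
  even_right x := by rw [← h.even_left (-x)]; ring_nf
  even_left x := by rw [← h.even_right (-x)]; ring_nf

lemma deriv_deriv_comp_neg (ψ : ℝ → ℝ) (x : ℝ) :
    deriv (deriv fun x => ψ (-x)) x = deriv (deriv ψ) (-x) := by
  have : (deriv fun x => ψ (-x)) = fun x => -deriv ψ (-x) := funext fun x => deriv_comp_neg ψ x
  rw [this, deriv.fun_neg, deriv_comp_neg, neg_neg]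

/-- Replacing `x` by `-x` and `f` by `-f` interchanges the two phases and the two walls, so only the
wall `1` needs study. -/
lemma IsFreeBoundary.reflect {T : ℝ} {f : ℝ → ℝ → ℝ} {p lam j : ℝ → ℝ}
    (h : IsFreeBoundary T f p lam j) :
    IsFreeBoundary T (fun x t => -f (-x) t) (fun t => -p t) lam j where
  pos_time := h.pos_time
  mem t ht := ⟨by linarith [(h.mem t ht).2], by linarith [(h.mem t ht).1]⟩
  jump_pos := h.jump_pos
  jump_le_right t ht := by have := h.jump_le_left t ht; linarith
  jump_le_left t ht := by have := h.jump_le_right t ht; linarith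
  flux_pos := h.flux_pos
  continuousOn t ht := ((h.continuousOn t ht).comp continuousOn_neg fun x hx =>
    ⟨by linarith [hx.2], by linarith [hx.1]⟩).neg
  pos t ht x h1 h2 := by have := h.neg t ht (-x) (by linarith) (by linarith); linarith
  neg t ht x h1 h2 := by have := h.pos t ht (-x) (by linarith) (by linarith); linarith
  left t ht ψ hψ := by
    have e : ∀ s, ∀ g : ℝ → ℝ, ∫ x in (-1 : ℝ)..(-p s), -f (-x) s * g x =
        ∫ x in (p s)..1, -f x s * g (-x) := fun s g => by
      have := intervalIntegral.integral_comp_neg (a := -1) (b := -p s)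
        (fun x => -f x s * g (-x))
      simpa using this
    have := h.right t ht _ hψ.comp_neg
    simp only [e]
    convert! this using 1
    simp only [deriv_deriv_comp_neg]
    congr 4
    ring
  right t ht ψ hψ := by
    have e : ∀ s, ∀ g : ℝ → ℝ, ∫ x in (-p s)..1, -(-f (-x) s) * g x =
        ∫ x in (-1 : ℝ)..(p s), f x s * g (-x) := fun s g => by
      have := intervalIntegral.integral_comp_neg (a := -p s) (b := 1)
        (fun x => f x s * g (-x))
      simpa using this
    have := h.left t ht _ hψ.comp_neg
    simp only [e]
    convert! this using 1
    simp only [deriv_deriv_comp_neg]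
    congr 4
    ring

/-! ### Weighted masses of the two phases -/

namespace IsFreeBoundary

variable {T : ℝ} {f : ℝ → ℝ → ℝ} {p lam j : ℝ → ℝ}

/-- The integral of `fψ` to the left of the free boundary. -/
noncomputable def lint (f : ℝ → ℝ → ℝ) (p ψ : ℝ → ℝ) (t : ℝ) : ℝ :=
  ∫ x in (-1 : ℝ)..(p t), f x t * ψ x

/-- The integral of `-fψ` to the right of the free boundary. -/
noncomputable def rint (f : ℝ → ℝ → ℝ) (p ψ : ℝ → ℝ) (t : ℝ) : ℝ :=
  ∫ x in (p t)..1, -f x t * ψ x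

lemma intervalIntegrable_left (h : IsFreeBoundary T f p lam j) {t : ℝ} (ht : t ∈ Ioo 0 T)
    {ψ : ℝ → ℝ} (hψ : Continuous ψ) :
    IntervalIntegrable (fun x => f x t * ψ x) volume (-1) (p t) :=
  IsSolution.intervalIntegrable_mul (h.continuousOn t ht) hψ (by norm_num)
    ⟨(h.mem t ht).1.le, (h.mem t ht).2.le⟩

lemma intervalIntegrable_right (h : IsFreeBoundary T f p lam j) {t : ℝ} (ht : t ∈ Ioo 0 T)
    {ψ : ℝ → ℝ} (hψ : Continuous ψ) :
    IntervalIntegrable (fun x => -f x t * ψ x) volume (p t) 1 :=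
  IsSolution.intervalIntegrable_mul (h.continuousOn t ht).neg hψ
    ⟨(h.mem t ht).1.le, (h.mem t ht).2.le⟩ (by norm_num)

lemma lint_mono (h : IsFreeBoundary T f p lam j) {t : ℝ} (ht : t ∈ Ioo 0 T)
    {φ ψ : ℝ → ℝ} (hφ : Continuous φ) (hψ : Continuous ψ)
    (hle : ∀ x ∈ Icc (-1) (p t), φ x ≤ ψ x) : lint f p φ t ≤ lint f p ψ t := by
  refine intervalIntegral.integral_mono_on_of_le_Ioo (h.mem t ht).1.le
    (h.intervalIntegrable_left ht hφ) (h.intervalIntegrable_left ht hψ) fun x hx => ?_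
  exact mul_le_mul_of_nonneg_left (hle x ⟨hx.1.le, hx.2.le⟩) (h.pos t ht x hx.1.le hx.2).le

lemma rint_mono (h : IsFreeBoundary T f p lam j) {t : ℝ} (ht : t ∈ Ioo 0 T)
    {φ ψ : ℝ → ℝ} (hφ : Continuous φ) (hψ : Continuous ψ)
    (hle : ∀ x ∈ Icc (p t) 1, φ x ≤ ψ x) : rint f p φ t ≤ rint f p ψ t := by
  refine intervalIntegral.integral_mono_on_of_le_Ioo (h.mem t ht).2.le
    (h.intervalIntegrable_right ht hφ) (h.intervalIntegrable_right ht hψ) fun x hx => ?_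
  exact mul_le_mul_of_nonneg_left (hle x ⟨hx.1.le, hx.2.le⟩)
    (neg_nonneg.2 (h.neg t ht x hx.2.le hx.1).le)

lemma lint_const_mul (c : ℝ) (ψ : ℝ → ℝ) (t : ℝ) :
    lint f p (fun x => c * ψ x) t = c * lint f p ψ t := by
  unfold lint
  rw [← intervalIntegral.integral_const_mul]
  congr 1; funext x; ring

lemma rint_const_mul (c : ℝ) (ψ : ℝ → ℝ) (t : ℝ) :
    rint f p (fun x => c * ψ x) t = c * rint f p ψ t := by
  unfold rint
  rw [← intervalIntegral.integral_const_mul]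
  congr 1; funext x; ring

lemma lint_add (h : IsFreeBoundary T f p lam j) {t : ℝ} (ht : t ∈ Ioo 0 T)
    {φ ψ : ℝ → ℝ} (hφ : Continuous φ) (hψ : Continuous ψ) :
    lint f p (fun x => φ x + ψ x) t = lint f p φ t + lint f p ψ t := by
  unfold lint
  rw [← intervalIntegral.integral_add (h.intervalIntegrable_left ht hφ)
    (h.intervalIntegrable_left ht hψ)]
  congr 1; funext x; ring

lemma rint_sub (h : IsFreeBoundary T f p lam j) {t : ℝ} (ht : t ∈ Ioo 0 T)
    {φ ψ : ℝ → ℝ} (hφ : Continuous φ) (hψ : Continuous ψ) :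
    rint f p (fun x => φ x - ψ x) t = rint f p φ t - rint f p ψ t := by
  unfold rint
  rw [← intervalIntegral.integral_sub (h.intervalIntegrable_right ht hφ)
    (h.intervalIntegrable_right ht hψ)]
  congr 1; funext x; ring

lemma lint_nonneg (h : IsFreeBoundary T f p lam j) {t : ℝ} (ht : t ∈ Ioo 0 T)
    {ψ : ℝ → ℝ} (hψ : Continuous ψ) (h0 : ∀ x, 0 ≤ ψ x) : 0 ≤ lint f p ψ t := by
  have := h.lint_mono ht (φ := fun _ => 0) continuous_const hψ fun x _ => h0 x
  simpa [lint] using this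

lemma rint_nonneg (h : IsFreeBoundary T f p lam j) {t : ℝ} (ht : t ∈ Ioo 0 T)
    {ψ : ℝ → ℝ} (hψ : Continuous ψ) (h0 : ∀ x, 0 ≤ ψ x) : 0 ≤ rint f p ψ t := by
  have := h.rint_mono ht (φ := fun _ => 0) continuous_const hψ fun x _ => h0 x
  simpa [rint] using this

lemma eq_of_hasDerivAt_zero {g : ℝ → ℝ} (hg : ∀ t ∈ Ioo 0 T, HasDerivAt g 0 t) {s t : ℝ}
    (hs : s ∈ Ioo 0 T) (ht : t ∈ Ioo 0 T) : g s = g t :=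
  isOpen_Ioo.is_const_of_deriv_eq_zero isPreconnected_Ioo
    (fun t ht => (hg t ht).differentiableAt.differentiableWithinAt) (fun t ht => (hg t ht).deriv)
    hs ht

/-- The mass on the left is conserved. -/
lemma lint_one_eq (h : IsFreeBoundary T f p lam j) {s t : ℝ} (hs : s ∈ Ioo 0 T)
    (ht : t ∈ Ioo 0 T) : lint f p (fun _ => 1) s = lint f p (fun _ => 1) t :=
  eq_of_hasDerivAt_zero (fun t ht => (h.left t ht _ (isTest_const 1)).congr_deriv (by simp)) hs ht

/-- The mass on the right is conserved. -/
lemma rint_one_eq (h : IsFreeBoundary T f p lam j) {s t : ℝ} (hs : s ∈ Ioo 0 T)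
    (ht : t ∈ Ioo 0 T) : rint f p (fun _ => 1) s = rint f p (fun _ => 1) t :=
  eq_of_hasDerivAt_zero (fun t ht => (h.right t ht _ (isTest_const 1)).congr_deriv (by simp)) hs ht

lemma rint_one_pos (h : IsFreeBoundary T f p lam j) {t : ℝ} (ht : t ∈ Ioo 0 T) :
    0 < rint f p (fun _ => 1) t := by
  have hm := h.mem t ht
  unfold rint
  refine intervalIntegral.integral_pos hm.2 ?_ (fun x hx => ?_) ⟨1, ⟨hm.2.le, le_rfl⟩, ?_⟩
  · exact ((h.continuousOn t ht).mono (Icc_subset_Icc hm.1.le le_rfl)).neg.mul continuousOn_const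
  · have := h.neg t ht x hx.2 hx.1; linarith
  · have := h.neg t ht 1 le_rfl hm.2; linarith

lemma defect_near_le (h : IsFreeBoundary T f p lam j) {t : ℝ} (ht : t ∈ Ioo 0 T) :
    defect (p t + j t) ≤ defect (p t) :=
  defect_strictAntiOn.antitoneOn ⟨(h.mem t ht).1.le, (h.mem t ht).2.le⟩
    ⟨by linarith [(h.mem t ht).1, h.jump_pos t ht], by linarith [h.jump_le_right t ht]⟩
    (by linarith [h.jump_pos t ht])

lemma le_defect_far (h : IsFreeBoundary T f p lam j) {t : ℝ} (ht : t ∈ Ioo 0 T) :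
    defect (p t) ≤ defect (p t - j t) :=
  defect_strictAntiOn.antitoneOn
    ⟨by linarith [h.jump_le_left t ht], by linarith [(h.mem t ht).2, h.jump_pos t ht]⟩
    ⟨(h.mem t ht).1.le, (h.mem t ht).2.le⟩ (by linarith [h.jump_pos t ht])

lemma defect_le_left (h : IsFreeBoundary T f p lam j) {t : ℝ} (ht : t ∈ Ioo 0 T) {x : ℝ}
    (hx : x ∈ Icc (-1) (p t)) : defect (p t) ≤ defect x :=
  defect_strictAntiOn.antitoneOn ⟨hx.1, hx.2.trans (h.mem t ht).2.le⟩
    ⟨(h.mem t ht).1.le, (h.mem t ht).2.le⟩ hx.2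

lemma defect_le_right (h : IsFreeBoundary T f p lam j) {t : ℝ} (ht : t ∈ Ioo 0 T) {x : ℝ}
    (hx : x ∈ Icc (p t) 1) : defect x ≤ defect (p t) :=
  defect_strictAntiOn.antitoneOn ⟨(h.mem t ht).1.le, (h.mem t ht).2.le⟩
    ⟨(h.mem t ht).1.le.trans hx.1, hx.2⟩ hx.1

/-! Concentration of the left mass near the right end point. -/

/-- With `a = s t₀ + w`, `b = s t + w` and `h = a - b = c(t - t₀)` one has exactly `1/b = 1/a + h/a²
+ h²/(b a²)`. The first two terms use fixed test functions, and the last is `O((t - t₀)²)`. -/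
lemma hasDerivAt_lint_inv_moving (h : IsFreeBoundary T f p lam j) {s : ℝ → ℝ} {t₀ c : ℝ}
    (ht₀ : t₀ ∈ Ioo 0 T) (hs : ∀ t, s t = s t₀ - c * (t - t₀)) (hs₀ : 0 < s t₀) :
    HasDerivAt (fun t => lint f p (fun x => (s t + defect x)⁻¹) t)
      (lint f p (deriv (deriv fun x => (s t₀ + defect x)⁻¹)) t₀ +
        lam t₀ * ((s t₀ + defect (p t₀ - j t₀))⁻¹ - (s t₀ + defect (p t₀))⁻¹) +
        c * lint f p (fun x => (s t₀ + defect x)⁻¹ ^ 2) t₀) t₀ := by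
  have hψ := isTest_inv hs₀
  have hψ2 := isTest_inv_sq hs₀
  have hsc : Continuous s := by
    have : s = fun t => s t₀ - c * (t - t₀) := funext hs
    rw [this]; fun_prop
  have hcinv : ∀ r : ℝ, 0 < r → Continuous fun x => (r + defect x)⁻¹ := fun r hr =>
    (isTest_inv hr).continuous
  have d1 := h.left t₀ ht₀ _ hψ
  have d2 : HasDerivAt (fun t => c * (t - t₀) * lint f p (fun x => (s t₀ + defect x)⁻¹ ^ 2) t)
      (c * lint f p (fun x => (s t₀ + defect x)⁻¹ ^ 2) t₀) t₀ := by
    have := (((hasDerivAt_id t₀).sub_const t₀).const_mul c).mul (h.left t₀ ht₀ _ hψ2)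
    refine this.congr_deriv ?_
    simp [lint]
  have hev : ∀ᶠ t in 𝓝 t₀, t ∈ Ioo 0 T ∧ s t₀ / 2 < s t :=
    (isOpen_Ioo.eventually_mem ht₀).and (hsc.continuousAt.eventually_const_lt (by linarith))
  have d3 : HasDerivAt (fun t => c ^ 2 * (t - t₀) ^ 2 *
      lint f p (fun x => (s t + defect x)⁻¹ * (s t₀ + defect x)⁻¹ ^ 2) t) 0 t₀ := by
    have hO : (fun t => c ^ 2 * (t - t₀) ^ 2 *
        lint f p (fun x => (s t + defect x)⁻¹ * (s t₀ + defect x)⁻¹ ^ 2) t) =O[𝓝 t₀]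
        fun t => ‖t - t₀‖ ^ 2 := by
      refine Asymptotics.IsBigO.of_bound
        (c ^ 2 * ((s t₀ / 2)⁻¹ * (s t₀)⁻¹ ^ 2 * lint f p (fun _ => 1) t₀)) ?_
      filter_upwards [hev] with t ht
      have hst : 0 < s t := by linarith [ht.2]
      have hcc : Continuous fun x => (s t + defect x)⁻¹ * (s t₀ + defect x)⁻¹ ^ 2 :=
        (hcinv _ hst).mul hψ2.continuous
      have hpos : ∀ x, 0 ≤ (s t + defect x)⁻¹ * (s t₀ + defect x)⁻¹ ^ 2 := fun x => by
        have := (defect_mem x).1; positivity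
      have h0 := h.lint_nonneg ht.1 hcc hpos
      have h1 : lint f p (fun x => (s t + defect x)⁻¹ * (s t₀ + defect x)⁻¹ ^ 2) t ≤
          (s t₀ / 2)⁻¹ * (s t₀)⁻¹ ^ 2 * lint f p (fun _ => 1) t₀ := by
        rw [← h.lint_one_eq ht.1 ht₀, ← lint_const_mul]
        refine h.lint_mono ht.1 hcc continuous_const fun x _ => ?_
        have := (defect_mem x).1
        rw [mul_one]
        gcongr <;> linarith [ht.2]
      rw [norm_mul, norm_mul, Real.norm_of_nonneg h0, Real.norm_of_nonneg (sq_nonneg c), norm_pow,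
        norm_pow, norm_norm]
      calc c ^ 2 * ‖t - t₀‖ ^ 2 * _ ≤ c ^ 2 * ‖t - t₀‖ ^ 2 *
            ((s t₀ / 2)⁻¹ * (s t₀)⁻¹ ^ 2 * lint f p (fun _ => 1) t₀) := by gcongr
        _ = _ := by ring
    have : HasFDerivAt _ (0 : ℝ →L[ℝ] ℝ) t₀ := hO.hasFDerivAt (by norm_num)
    simpa using this.hasDerivAt
  refine (((d1.add d2).add d3).congr_of_eventuallyEq ?_).congr_deriv ?_
  · filter_upwards [hev] with t ht
    have hst : 0 < s t := by linarith [ht.2]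
    have e : (fun x => (s t + defect x)⁻¹) = fun x => ((s t₀ + defect x)⁻¹ +
        c * (t - t₀) * (s t₀ + defect x)⁻¹ ^ 2) +
        c ^ 2 * (t - t₀) ^ 2 * ((s t + defect x)⁻¹ * (s t₀ + defect x)⁻¹ ^ 2) := by
      funext x
      have h1 : s t + defect x ≠ 0 := by have := (defect_mem x).1; positivity
      have h2 : s t₀ + defect x ≠ 0 := by have := (defect_mem x).1; positivity
      have h3 : c * (t - t₀) = (s t₀ + defect x) - (s t + defect x) := by rw [hs t]; ring
      rw [← mul_pow, h3]
      field_simp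
      ring
    have c1 : Continuous fun x => c * (t - t₀) * (s t₀ + defect x)⁻¹ ^ 2 :=
      continuous_const.mul hψ2.continuous
    have c2 : Continuous fun x => (s t₀ + defect x)⁻¹ +
        c * (t - t₀) * (s t₀ + defect x)⁻¹ ^ 2 := hψ.continuous.add c1
    have c3 : Continuous fun x => c ^ 2 * (t - t₀) ^ 2 *
        ((s t + defect x)⁻¹ * (s t₀ + defect x)⁻¹ ^ 2) :=
      continuous_const.mul ((hcinv _ hst).mul hψ2.continuous)
    rw [e, h.lint_add ht.1 c2 c3, h.lint_add ht.1 hψ.continuous c1, lint_const_mul,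
      lint_const_mul]
    rfl
  · simp only [lint]
    ring

end IsFreeBoundary

lemma le_of_hasDerivAt_nonneg {F F' : ℝ → ℝ} {s u : ℝ} (hsu : s ≤ u)
    (hF : ∀ t ∈ Icc s u, HasDerivAt F (F' t) t) (h0 : ∀ t ∈ Icc s u, 0 ≤ F' t) : F s ≤ F u := by
  refine monotoneOn_of_hasDerivWithinAt_nonneg (convex_Icc s u)
    (fun t ht => (hF t ht).continuousAt.continuousWithinAt)
    (fun t ht => (hF t (interior_subset ht)).hasDerivWithinAt)
    (fun t ht => h0 t (interior_subset ht)) ⟨le_rfl, hsu⟩ ⟨hsu, le_rfl⟩ hsu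

namespace IsFreeBoundary

variable {T : ℝ} {f : ℝ → ℝ → ℝ} {p lam j : ℝ → ℝ}

/-- Jumps take left mass from `p` to `p - j`, where `1/(s+w)` is no larger, so the flux term can be
dropped; `supersolution_ineq` bounds the rest. -/
lemma inv_moving_le (h : IsFreeBoundary T f p lam j) {s : ℝ} {t : ℝ} (ht : t ∈ Ioo 0 T)
    (hs : 0 < s) :
    lint f p (deriv (deriv fun x => (s + defect x)⁻¹)) t +
        lam t * ((s + defect (p t - j t))⁻¹ - (s + defect (p t))⁻¹) +
        3 * kpi * lint f p (fun x => (s + defect x)⁻¹ ^ 2) t ≤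
      (kpi + 9 / 4 * kpi / s) * lint f p (fun x => (s + defect x)⁻¹) t := by
  have h1 : lam t * ((s + defect (p t - j t))⁻¹ - (s + defect (p t))⁻¹) ≤ 0 := by
    refine mul_nonpos_of_nonneg_of_nonpos (h.flux_pos t ht).le (sub_nonpos.2 ?_)
    have := (defect_mem (p t)).1
    have := h.le_defect_far ht
    gcongr
  have c1 := (isTest_inv hs).deriv_deriv.continuous
  have c2 : Continuous fun x => 3 * kpi * (s + defect x)⁻¹ ^ 2 :=
    continuous_const.mul (isTest_inv_sq hs).continuous
  have c3 : Continuous fun x => (kpi + 9 / 4 * kpi / s) * (s + defect x)⁻¹ :=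
    continuous_const.mul (isTest_inv hs).continuous
  have h2 : lint f p (fun x => deriv (deriv fun x => (s + defect x)⁻¹) x +
      3 * kpi * (s + defect x)⁻¹ ^ 2) t ≤
      lint f p (fun x => (kpi + 9 / 4 * kpi / s) * (s + defect x)⁻¹) t := by
    refine h.lint_mono ht (c1.add c2) c3 fun x _ => ?_
    rw [deriv_deriv_inv hs]
    exact supersolution_ineq hs (defect_mem x).1
  rw [h.lint_add ht c1 c2, lint_const_mul, lint_const_mul] at h2
  linarith

/-- Dominance of the left mass near the right end point by an integrable power. -/
lemma exists_lint_inv_le (h : IsFreeBoundary T f p lam j) : ∃ C : ℝ, 0 < C ∧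
    ∀ t ∈ Ico (T / 2) T, ∀ r ∈ Ioc (0 : ℝ) 1,
      lint f p (fun x => (r + defect x)⁻¹) t ≤ C * r ^ (-(3 / 4) : ℝ) := by
  have hT := h.pos_time
  have hk := kpi_pos
  have hT2 : T / 2 ∈ Ioo 0 T := ⟨by linarith, by linarith⟩
  have hv0 : 0 < defect (p (T / 2)) :=
    defect_pos ⟨(h.mem _ hT2).1.le, (h.mem _ hT2).2⟩
  set M := lint f p (fun _ => 1) (T / 2)
  have hM : 0 ≤ M := h.lint_nonneg hT2 continuous_const fun _ => zero_le_one
  -- At the interior time `T/2` the left phase lies in `w ≥ w(p(T/2)) > 0`, which bounds the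
  -- starting value independently of `r`. The first factor bounds `s(T/2)^(3/4)`.
  set D := (1 + 3 * kpi * T) * ((defect (p (T / 2)))⁻¹ * M)
  have hD : 0 ≤ D := by positivity
  refine ⟨Real.exp (kpi * T) * D + 1, by positivity, fun t₁ ht₁ r hr => ?_⟩
  -- The regularisation shrinks to `r` exactly at `t₁`. It is linear in time because `w` scales as a
  -- squared length.
  set s : ℝ → ℝ := fun t => r + 3 * kpi * (t₁ - t) with hsdef
  have hs : ∀ t ∈ Icc (T / 2) t₁, 0 < s t := fun t ht => by
    have h1 := sub_nonneg.2 ht.2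
    have h2 := hr.1
    simp only [hsdef]; positivity
  have hsub : ∀ t ∈ Icc (T / 2) t₁, t ∈ Ioo 0 T := fun t ht =>
    ⟨by linarith [ht.1], ht.2.trans_lt ht₁.2⟩
  have hsd : ∀ t, HasDerivAt s (-(3 * kpi)) t := fun t => by
    have := (((hasDerivAt_id t).const_sub t₁).const_mul (3 * kpi)).const_add r
    refine this.congr_deriv (by ring)
  set Y : ℝ → ℝ := fun t => lint f p (fun x => (s t + defect x)⁻¹) t with hY
  have hYd : ∀ t ∈ Icc (T / 2) t₁, ∃ y, HasDerivAt Y y t ∧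
      y ≤ (kpi + 9 / 4 * kpi / s t) * Y t := fun t ht =>
    ⟨_, h.hasDerivAt_lint_inv_moving (c := 3 * kpi) (hsub t ht)
      (fun u => by simp only [hsdef]; ring) (hs t ht), h.inv_moving_le (hsub t ht) (hs t ht)⟩
  choose! Y' hY' hYle using hYd
  -- The exponent `3/4` is the one for which the decay of `s^(3/4)`, at relative rate
  -- `(3/4)·3·kpi/s`, cancels the growth rate `(9/4) kpi/s` of `Y`; the exponential removes the
  -- remaining rate `kpi`.
  have key := le_of_hasDerivAt_nonneg ht₁.1 (F := fun t =>
    -(Real.exp (-(kpi * t)) * (s t ^ (3 / 4 : ℝ) * Y t)))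
    (F' := fun t => Real.exp (-(kpi * t)) * s t ^ (3 / 4 : ℝ) *
      ((kpi + 9 / 4 * kpi / s t) * Y t - Y' t)) (fun t ht => ?_) (fun t ht => ?_)
  rotate_left
  · have e1 : HasDerivAt (fun t => Real.exp (-(kpi * t))) (Real.exp (-(kpi * t)) * -kpi) t := by
      have := ((hasDerivAt_id t).const_mul kpi).neg.exp
      refine this.congr_deriv (by simp)
    have e2 := (hsd t).rpow_const (p := 3 / 4) (Or.inl (hs t ht).ne')
    refine ((e1.mul (e2.mul (hY' t ht))).neg).congr_deriv ?_
    rw [Real.rpow_sub_one (hs t ht).ne']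
    have := (hs t ht).ne'
    simp only [Pi.mul_apply]
    field_simp
    ring
  · have := hs t ht
    have := sub_nonneg.2 (hYle t ht)
    positivity
  have hst₁ : s t₁ = r := by simp [hsdef]
  have hY₁ : Y t₁ = lint f p (fun x => (r + defect x)⁻¹) t₁ := by simp only [hY, hst₁]
  rw [← hY₁]
  have hY0 : Y (T / 2) ≤ (defect (p (T / 2)))⁻¹ * M := by
    have hs0 := hs _ ⟨le_rfl, ht₁.1⟩
    rw [← lint_const_mul]
    refine h.lint_mono hT2 (isTest_inv hs0).continuous continuous_const fun x hx => ?_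
    have := h.defect_le_left hT2 hx
    rw [mul_one]
    gcongr
    linarith
  have hs0 : s (T / 2) ^ (3 / 4 : ℝ) ≤ 1 + 3 * kpi * T := by
    have h1 : s (T / 2) ≤ 1 + 3 * kpi * T := by
      simp only [hsdef]
      have : t₁ - T / 2 ≤ T := by linarith [ht₁.2]
      have := hr.2
      gcongr
    have h2 : 1 ≤ 1 + 3 * kpi * T := by have : 0 < 3 * kpi * T := by positivity
                                        linarith
    calc s (T / 2) ^ (3 / 4 : ℝ) ≤ (1 + 3 * kpi * T) ^ (3 / 4 : ℝ) :=
          Real.rpow_le_rpow (hs _ ⟨le_rfl, ht₁.1⟩).le h1 (by norm_num)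
      _ ≤ (1 + 3 * kpi * T) ^ (1 : ℝ) := Real.rpow_le_rpow_of_exponent_le h2 (by norm_num)
      _ = _ := Real.rpow_one _
  have hprod : s (T / 2) ^ (3 / 4 : ℝ) * Y (T / 2) ≤ D := by
    have : 0 ≤ s (T / 2) ^ (3 / 4 : ℝ) := Real.rpow_nonneg (hs _ ⟨le_rfl, ht₁.1⟩).le _
    calc _ ≤ s (T / 2) ^ (3 / 4 : ℝ) * ((defect (p (T / 2)))⁻¹ * M) := by gcongr
      _ ≤ _ := mul_le_mul_of_nonneg_right hs0 (by positivity)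
  have hexp : Real.exp (-(kpi * (T / 2))) ≤ 1 := Real.exp_le_one_iff.2 (by
    have : 0 < kpi * (T / 2) := by positivity
    linarith)
  have hle : Real.exp (-(kpi * t₁)) * (r ^ (3 / 4 : ℝ) * Y t₁) ≤ D := by
    have h1 : Real.exp (-(kpi * (T / 2))) * (s (T / 2) ^ (3 / 4 : ℝ) * Y (T / 2)) ≤ 1 * D := by
      calc _ ≤ Real.exp (-(kpi * (T / 2))) * D := by gcongr
        _ ≤ _ := by gcongr
    simp only [hst₁] at key
    linarith
  have hrp : 0 < r ^ (3 / 4 : ℝ) := Real.rpow_pos_of_pos hr.1 _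
  rw [Real.rpow_neg hr.1.le, ← div_eq_mul_inv, le_div_iff₀ hrp]
  calc Y t₁ * r ^ (3 / 4 : ℝ) = Real.exp (kpi * t₁) *
        (Real.exp (-(kpi * t₁)) * (r ^ (3 / 4 : ℝ) * Y t₁)) := by
        rw [← mul_assoc, ← Real.exp_add, add_neg_cancel, Real.exp_zero]; ring
    _ ≤ Real.exp (kpi * t₁) * D := by gcongr
    _ ≤ Real.exp (kpi * T) * D := by
        have := ht₁.2.le
        gcongr
    _ ≤ _ := by linarith

lemma lint_log_eq (h : IsFreeBoundary T f p lam j) {t : ℝ} (ht : t ∈ Ioo 0 T) {r R : ℝ}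
    (hr : 0 < r) (hrR : r ≤ R) :
    lint f p (fun x => Real.log (R + defect x) - Real.log (r + defect x)) t =
      ∫ s in r..R, lint f p (fun x => (s + defect x)⁻¹) t := by
  have hm := h.mem t ht
  have e : ∀ x, Real.log (R + defect x) - Real.log (r + defect x) =
      ∫ s in r..R, (s + defect x)⁻¹ := fun x => by
    have h0 := (defect_mem x).1
    rw [intervalIntegral.integral_comp_add_right (fun y => y⁻¹), integral_inv_of_pos
      (by positivity) (by linarith), Real.log_div (by linarith) (by linarith)]
  unfold lint
  simp only [e, ← intervalIntegral.integral_const_mul]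
  refine (intervalIntegral_intervalIntegral_swap ?_).symm
  have hc : ContinuousOn (fun z : ℝ × ℝ => f z.2 t * (z.1 + defect z.2)⁻¹)
      (Icc r R ×ˢ Icc (-1) (p t)) := by
    refine ContinuousOn.mul (((h.continuousOn t ht).mono (Icc_subset_Icc le_rfl hm.2.le)).comp
      continuousOn_snd fun z hz => hz.2) (ContinuousOn.inv₀ (by
        have := continuous_defect; fun_prop) fun z hz => ?_)
    have := (defect_mem z.2).1
    have := hz.1.1
    linarith
  rw [uIoc_of_le hrR, uIoc_of_le hm.1.le]
  exact (hc.integrableOn_compact (isCompact_Icc.prod isCompact_Icc)).mono_set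
    (prod_mono Ioc_subset_Icc_self Ioc_subset_Icc_self)

/-- The power `-3/4` is integrable at 0, so the bound does not depend on `r` and tends to 0 with
`R`. -/
lemma lint_log_le (h : IsFreeBoundary T f p lam j) {C : ℝ} (hC : 0 < C)
    (hdom : ∀ t ∈ Ico (T / 2) T, ∀ r ∈ Ioc (0 : ℝ) 1,
      lint f p (fun x => (r + defect x)⁻¹) t ≤ C * r ^ (-(3 / 4) : ℝ))
    {t : ℝ} (ht : t ∈ Ico (T / 2) T) {r R : ℝ} (hr : 0 < r) (hrR : r ≤ R) (hR : R ≤ 1) :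
    lint f p (fun x => Real.log (R + defect x) - Real.log (r + defect x)) t ≤
      4 * C * R ^ (1 / 4 : ℝ) := by
  have ht' : t ∈ Ioo 0 T := ⟨by linarith [h.pos_time, ht.1], ht.2⟩
  rw [h.lint_log_eq ht' hr hrR]
  have hint : IntervalIntegrable (fun s : ℝ => C * s ^ (-(3 / 4) : ℝ)) volume r R :=
    (intervalIntegral.intervalIntegrable_rpow' (by norm_num)).const_mul C
  calc ∫ s in r..R, lint f p (fun x => (s + defect x)⁻¹) t ≤
        ∫ s in r..R, C * s ^ (-(3 / 4) : ℝ) := by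
        refine intervalIntegral.integral_mono_on hrR ?_ hint fun s hs =>
          hdom t ht s ⟨hr.trans_le hs.1, hs.2.trans hR⟩
        refine AntitoneOn.intervalIntegrable fun s hs u hu hsu => ?_
        rw [uIcc_of_le hrR] at hs hu
        refine h.lint_mono ht' (isTest_inv (hr.trans_le hu.1)).continuous
          (isTest_inv (hr.trans_le hs.1)).continuous fun x _ => ?_
        have := (defect_mem x).1
        have := hr.trans_le hs.1
        gcongr
    _ = C * ((R ^ (1 / 4 : ℝ) - r ^ (1 / 4 : ℝ)) / (1 / 4)) := by
        rw [intervalIntegral.integral_const_mul, integral_rpow (Or.inl (by norm_num))]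
        norm_num
    _ ≤ _ := by
        have : 0 ≤ r ^ (1 / 4 : ℝ) := Real.rpow_nonneg hr.le _
        have h2 := mul_nonneg hC.le this
        linarith

end IsFreeBoundary

/-! ### Transfer of the estimates from the left phase to the right phase -/

namespace IsFreeBoundary

variable {T : ℝ} {f : ℝ → ℝ → ℝ} {p lam j : ℝ → ℝ}

/-- Since `w'' ≥ -kpi`, the term `kpi M t` offsets diffusion, and jumps on the left only increase
`w`. Monotonicity follows for nonnegative flux. -/
lemma exists_hasDerivAt_lint_defect (h : IsFreeBoundary T f p lam j) {t M : ℝ} (ht : t ∈ Ioo 0 T)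
    (hM : lint f p (fun _ => 1) t = M) :
    ∃ d, HasDerivAt (fun t => lint f p defect t + kpi * M * t) d t ∧
      lam t * (defect (p t - j t) - defect (p t)) ≤ d := by
  have d1 := h.left t ht _ isTest_defect
  have d2 := (hasDerivAt_id t).const_mul (kpi * M)
  refine ⟨_, d1.add d2, ?_⟩
  have h1 : lint f p (fun _ => -kpi * 1) t ≤ lint f p (deriv (deriv defect)) t := by
    refine h.lint_mono ht continuous_const isTest_defect.deriv_deriv.continuous fun x _ => ?_
    rw [deriv_deriv_defect]
    nlinarith [kpi_pos, (defect_mem x).2]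
  rw [lint_const_mul, hM] at h1
  simp only [lint] at h1
  linarith

lemma exists_hasDerivAt_lint_log (h : IsFreeBoundary T f p lam j) {t r R : ℝ}
    (ht : t ∈ Ioo 0 T) (hr : 0 < r) (hrR : r ≤ R) :
    ∃ d, HasDerivAt (fun t => lint f p (fun x =>
        Real.log (R + defect x) - Real.log (r + defect x)) t) d t ∧
      d ≤ 3 * kpi * lint f p (fun x => (r + defect x)⁻¹) t - lam t *
        ((Real.log (R + defect (p t)) - Real.log (r + defect (p t))) -
          (Real.log (R + defect (p t - j t)) - Real.log (r + defect (p t - j t)))) := by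
  have hχ := isTest_log hr (hr.trans_le hrR)
  refine ⟨_, h.left t ht _ hχ, ?_⟩
  have h1 : lint f p (deriv (deriv fun x =>
      Real.log (R + defect x) - Real.log (r + defect x))) t ≤
      lint f p (fun x => 3 * kpi * (r + defect x)⁻¹) t := by
    refine h.lint_mono ht hχ.deriv_deriv.continuous
      (continuous_const.mul (isTest_inv hr).continuous) fun x _ => ?_
    rw [deriv_deriv_log hr (hr.trans_le hrR)]
    exact log_operator_le hr hrR (defect_mem x)
  rw [lint_const_mul] at h1
  simp only [lint] at h1 ⊢
  linarith

lemma exists_hasDerivAt_rint_ratio (h : IsFreeBoundary T f p lam j) {t r M : ℝ}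
    (ht : t ∈ Ioo 0 T) (hr : 0 < r) (hM : rint f p (fun _ => 1) t = M) :
    ∃ d, HasDerivAt (fun t => rint f p (fun x => defect x * (r + defect x)⁻¹) t) d t ∧
      kpi / r * ((1 - r) * M - 6 * rint f p (fun x => defect x * (r + defect x)⁻¹) t) -
        lam t * (defect (p t) * (r + defect (p t))⁻¹ -
          defect (p t + j t) * (r + defect (p t + j t))⁻¹) ≤ d := by
  have hχ := isTest_ratio hr
  refine ⟨_, h.right t ht _ hχ, ?_⟩
  have c1 : Continuous fun x => 6 * (defect x * (r + defect x)⁻¹) :=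
    continuous_const.mul hχ.continuous
  have h1 : rint f p (fun x => kpi / r * ((1 - r) * 1 - 6 * (defect x * (r + defect x)⁻¹))) t ≤
      rint f p (deriv (deriv fun x => defect x * (r + defect x)⁻¹)) t := by
    refine h.rint_mono ht (continuous_const.mul (continuous_const.sub c1))
      hχ.deriv_deriv.continuous fun x _ => ?_
    rw [deriv_deriv_ratio hr, mul_one]
    exact ratio_operator_ge hr (defect_mem x).1
  rw [rint_const_mul, h.rint_sub ht continuous_const c1, rint_const_mul, rint_const_mul, hM] at h1
  simp only [rint] at h1 ⊢
  linarith

lemma rint_ratio_le (h : IsFreeBoundary T f p lam j) {t r M : ℝ} (ht : t ∈ Ioo 0 T)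
    (hr : 0 < r) (hM : rint f p (fun _ => 1) t = M) :
    rint f p (fun x => defect x * (r + defect x)⁻¹) t ≤ defect (p t) * r⁻¹ * M := by
  rw [← hM, ← rint_const_mul]
  refine h.rint_mono ht (isTest_ratio hr).continuous continuous_const fun x hx => ?_
  have h1 := (defect_mem x).1
  have h2 := h.defect_le_right ht hx
  rw [mul_one]
  gcongr <;> linarith

/-- The monotone quantity that transfers mass estimates from the left to the right. -/
lemma lyapunov_le (h : IsFreeBoundary T f p lam j) {C M₁ M₂ r R : ℝ}
    (hdom : ∀ t ∈ Ico (T / 2) T, ∀ r ∈ Ioc (0 : ℝ) 1,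
      lint f p (fun x => (r + defect x)⁻¹) t ≤ C * r ^ (-(3 / 4) : ℝ))
    (hM₁ : ∀ t ∈ Ioo 0 T, lint f p (fun _ => 1) t = M₁)
    (hM₂ : ∀ t ∈ Ioo 0 T, rint f p (fun _ => 1) t = M₂)
    (hr : 0 < r) (hrR : r ≤ R / 2) (hr₁ : r ≤ 1) {s u : ℝ} (hs : T / 2 ≤ s) (hsu : s ≤ u)
    (hu : u < T) :
    Real.exp (6 * kpi / r * (s - T)) *
        (rint f p (fun x => defect x * (r + defect x)⁻¹) s - (1 - r) * M₂ / 6) -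
      48 * (lint f p (fun x => Real.log (R + defect x) - Real.log (r + defect x)) s -
        3 * kpi * (C * r ^ (-(3 / 4) : ℝ)) * s) +
      3 / R * (lint f p defect s + kpi * M₁ * s) ≤
    Real.exp (6 * kpi / r * (u - T)) *
        (rint f p (fun x => defect x * (r + defect x)⁻¹) u - (1 - r) * M₂ / 6) -
      48 * (lint f p (fun x => Real.log (R + defect x) - Real.log (r + defect x)) u -
        3 * kpi * (C * r ^ (-(3 / 4) : ℝ)) * u) +
      3 / R * (lint f p defect u + kpi * M₁ * u) := by
  have hk := kpi_pos
  have hR : 0 < R := by linarith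
  have hsub : ∀ t ∈ Icc s u, t ∈ Ioo 0 T := fun t ht =>
    ⟨by linarith [ht.1, h.pos_time], by linarith [ht.2]⟩
  have hV : ∀ t ∈ Icc s u, _ := fun t ht =>
    h.exists_hasDerivAt_lint_defect (hsub t ht) (hM₁ t (hsub t ht))
  have hX : ∀ t ∈ Icc s u, _ := fun t ht =>
    h.exists_hasDerivAt_lint_log (hsub t ht) hr (show r ≤ R by linarith)
  have hN : ∀ t ∈ Icc s u, _ := fun t ht =>
    h.exists_hasDerivAt_rint_ratio (hsub t ht) hr (hM₂ t (hsub t ht))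
  choose! V' hVd hVle using hV
  choose! X' hXd hXle using hX
  choose! N' hNd hNle using hN
  -- The exponential is the integrating factor of the relaxation at rate `6 kpi/r`. It is normalised
  -- to 1 at `T`, so before `T` the jump loss enters with weight at most 1 and `loss_le` covers it.
  refine le_of_hasDerivAt_nonneg hsu (F := fun t => Real.exp (6 * kpi / r * (t - T)) *
        (rint f p (fun x => defect x * (r + defect x)⁻¹) t - (1 - r) * M₂ / 6) -
      48 * (lint f p (fun x => Real.log (R + defect x) - Real.log (r + defect x)) t -
        3 * kpi * (C * r ^ (-(3 / 4) : ℝ)) * t) +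
      3 / R * (lint f p defect t + kpi * M₁ * t))
    (F' := fun t => Real.exp (6 * kpi / r * (t - T)) * (N' t - kpi / r * ((1 - r) * M₂ -
        6 * rint f p (fun x => defect x * (r + defect x)⁻¹) t)) -
      48 * (X' t - 3 * kpi * (C * r ^ (-(3 / 4) : ℝ))) + 3 / R * V' t)
    (fun t ht => ?_) (fun t ht => ?_)
  · have e1 : HasDerivAt (fun t => Real.exp (6 * kpi / r * (t - T)))
        (Real.exp (6 * kpi / r * (t - T)) * (6 * kpi / r)) t := by
      have := (((hasDerivAt_id t).sub_const T).const_mul (6 * kpi / r)).exp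
      refine this.congr_deriv (by simp)
    have e2 := (hXd t ht).sub ((hasDerivAt_id t).const_mul
      (3 * kpi * (C * r ^ (-(3 / 4) : ℝ))))
    refine (((e1.mul ((hNd t ht).sub_const ((1 - r) * M₂ / 6))).sub (e2.const_mul 48)).add
      ((hVd t ht).const_mul (3 / R))).congr_deriv ?_
    ring
  · have htT := hsub t ht
    have hl := h.flux_pos t htT
    have hE0 := Real.exp_pos (6 * kpi / r * (t - T))
    have hE1 : Real.exp (6 * kpi / r * (t - T)) ≤ 1 := Real.exp_le_one_iff.2
      (mul_nonpos_of_nonneg_of_nonpos (by positivity) (by linarith [htT.2]))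
    have hnear := h.defect_near_le htT
    have hfar := h.le_defect_far htT
    have hp0 := (defect_mem (p t + j t)).1
    have hloss := loss_le hr hrR hp0 hnear hfar
      (defect_sub_le (h.jump_pos t htT) (h.jump_le_right t htT) (h.jump_le_left t htT))
      (defect_dipole (h.jump_pos t htT) (h.jump_le_right t htT) (h.jump_le_left t htT))
    have hd := hdom t ⟨by linarith [ht.1], htT.2⟩ r ⟨hr, hr₁⟩
    have hXt := hXle t ht
    have hVt := mul_le_mul_of_nonneg_left (hVle t ht) (by positivity : 0 ≤ 3 / R)
    have hNt := hNle t ht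
    set loss := defect (p t) * (r + defect (p t))⁻¹ -
      defect (p t + j t) * (r + defect (p t + j t))⁻¹ with hlossdef
    have hloss0 : 0 ≤ loss := by
      have e : ∀ w, 0 ≤ w → w * (r + w)⁻¹ = 1 - r * (r + w)⁻¹ := fun w hw => by
        field_simp; ring
      rw [hlossdef, e _ hp0, e _ (hp0.trans hnear), sub_nonneg]
      gcongr
    have hNE : -(lam t * loss) ≤ Real.exp (6 * kpi / r * (t - T)) * (N' t - kpi / r *
        ((1 - r) * M₂ - 6 * rint f p (fun x => defect x * (r + defect x)⁻¹) t)) := by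
      have h1 : Real.exp (6 * kpi / r * (t - T)) * (-(lam t * loss)) ≤
          Real.exp (6 * kpi / r * (t - T)) * (N' t - kpi / r *
        ((1 - r) * M₂ - 6 * rint f p (fun x => defect x * (r + defect x)⁻¹) t)) := by
        gcongr
        linarith
      have h2 : Real.exp (6 * kpi / r * (t - T)) * (lam t * loss) ≤ 1 * (lam t * loss) := by
        gcongr
      linarith
    have hl2 := mul_le_mul_of_nonneg_left hloss hl.le
    have hd2 := mul_le_mul_of_nonneg_left hd (by positivity : 0 ≤ 3 * kpi)
    linarith

/-- A bounded monotone function converges at `T`, so its late increments are small. -/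
lemma exists_increment_le {W : ℝ → ℝ} {A η : ℝ} (hT : 0 < T)
    (hmono : ∀ s u, 0 < s → s ≤ u → u < T → W s ≤ W u) (hA : ∀ t ∈ Ioo 0 T, W t ≤ A)
    (hη : 0 < η) : ∃ t₀ ∈ Ioo 0 T, ∀ s u, t₀ ≤ s → s ≤ u → u < T → W u - W s ≤ η := by
  have hne : (W '' Ioo 0 T).Nonempty := ⟨_, T / 2, ⟨by linarith, by linarith⟩, rfl⟩
  have hbdd : BddAbove (W '' Ioo 0 T) := ⟨A, by rintro _ ⟨t, ht, rfl⟩; exact hA t ht⟩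
  obtain ⟨_, ⟨t₀, ht₀, rfl⟩, h1⟩ := exists_lt_of_lt_csSup hne
    (show sSup (W '' Ioo 0 T) - η < sSup (W '' Ioo 0 T) by linarith)
  refine ⟨t₀, ht₀, fun s u hs hsu hu => ?_⟩
  have h2 := le_csSup hbdd ⟨u, ⟨by linarith [ht₀.1], hu⟩, rfl⟩
  have h3 := hmono t₀ s ht₀.1 hs (by linarith)
  linarith

lemma eventually_mul_rpow_le (A : ℝ) {c : ℝ} (hc : 0 < c) :
    ∀ᶠ r in 𝓝[>] (0 : ℝ), A * r ^ (1 / 4 : ℝ) ≤ c := by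
  have h1 : Tendsto (fun r : ℝ => A * r ^ (1 / 4 : ℝ)) (𝓝 0) (𝓝 (A * 0 ^ (1 / 4 : ℝ))) :=
    ((Real.continuousAt_rpow_const 0 (1 / 4) (Or.inr (by norm_num))).tendsto).const_mul A
  rw [Real.zero_rpow (by norm_num), mul_zero] at h1
  exact ((h1.mono_left nhdsWithin_le_nhds).eventually_lt_const hc).mono fun _ h => h.le

/-- Near the final time the defect at the free boundary is bounded below. -/
lemma exists_le_defect (h : IsFreeBoundary T f p lam j) :
    ∃ d : ℝ, 0 < d ∧ ∀ᶠ t in 𝓝[<] T, d ≤ defect (p t) := by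
  have hT := h.pos_time
  have hk := kpi_pos
  have hT2 : T / 2 ∈ Ioo 0 T := ⟨by linarith, by linarith⟩
  obtain ⟨C, hC, hdom⟩ := h.exists_lint_inv_le
  set M₁ := lint f p (fun _ => 1) (T / 2)
  set M₂ := rint f p (fun _ => 1) (T / 2)
  have hM₁ : ∀ t ∈ Ioo 0 T, lint f p (fun _ => 1) t = M₁ := fun t ht => h.lint_one_eq ht hT2
  have hM₂ : ∀ t ∈ Ioo 0 T, rint f p (fun _ => 1) t = M₂ := fun t ht => h.rint_one_eq ht hT2
  have hM₁0 : 0 ≤ M₁ := h.lint_nonneg hT2 continuous_const fun _ => zero_le_one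
  have hM₂0 : 0 < M₂ := h.rint_one_pos hT2
  set q := Real.exp (-(6 * kpi))
  have hq : q < 1 := Real.exp_lt_one_iff.2 (by linarith)
  have hq0 : 0 < q := Real.exp_pos _
  -- Over a window of length `r`, relaxation gains nearly `(1-q)(1-r)M₂/6`, which is at least `c`
  -- for `r ≤ 1/2`. The choices are ordered: `R` makes the potential small, then `t₀` depends on
  -- `R`, then `r` on both.
  set c := M₂ / 12 * (1 - q) with hcdef
  have hc : 0 < c := mul_pos (by positivity) (by linarith)
  obtain ⟨R, hRc, hR⟩ := ((eventually_mul_rpow_le (48 * (4 * C))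
    (show 0 < c / 4 by positivity)).and (Ioc_mem_nhdsGT one_pos)).exists
  have hR0 := hR.1
  obtain ⟨t₀, ht₀, hW⟩ := exists_increment_le (T := T)
    (W := fun t => lint f p defect t + kpi * M₁ * t) (A := 2 * M₁ + kpi * M₁ * T)
    (η := R * c / 12) hT (fun s u hs hsu hu => by
      have hV : ∀ t ∈ Icc s u, _ := fun t (ht : t ∈ Icc s u) =>
        h.exists_hasDerivAt_lint_defect (t := t) ⟨by linarith [ht.1], by linarith [ht.2]⟩
          (hM₁ t ⟨by linarith [ht.1], by linarith [ht.2]⟩)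
      choose! V' hVd hVle using hV
      refine le_of_hasDerivAt_nonneg hsu hVd fun t ht => le_trans ?_ (hVle t ht)
      have htT : t ∈ Ioo 0 T := ⟨by linarith [ht.1], by linarith [ht.2]⟩
      exact mul_nonneg (h.flux_pos t htT).le (sub_nonneg.2 (h.le_defect_far htT)))
    (fun t ht => by
      have h1 : lint f p defect t ≤ lint f p (fun _ => 2 * 1) t :=
        h.lint_mono ht continuous_defect continuous_const fun x _ => by
          linarith [(defect_mem x).2]
      rw [lint_const_mul, hM₁ t ht] at h1
      have h2 : kpi * M₁ * t ≤ kpi * M₁ * T := by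
        have := ht.2.le
        gcongr
      linarith) (by positivity)
  -- The window `[T-r, T)` must lie after both `t₀` and `T/2`; the power condition makes the
  -- diffusive growth of the potential over it at most `c/4`.
  obtain ⟨r, ⟨hrc, hr⟩, hr0⟩ := ((eventually_mul_rpow_le (144 * kpi * C)
    (show 0 < c / 4 by positivity)).and (Ioc_mem_nhdsGT
      (show 0 < min (min (R / 2) (1 / 2)) (min (T - t₀) (T / 2)) by
        have := ht₀.2
        simp only [lt_min_iff]
        refine ⟨⟨?_, ?_⟩, ?_, ?_⟩ <;> linarith))).and self_mem_nhdsWithin |>.exists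
  have hr0 : 0 < r := hr0
  have hrle := hr.2
  simp only [le_min_iff] at hrle
  obtain ⟨⟨hr1, hr2⟩, hr3, hr4⟩ := hrle
  have hrR : r ≤ R := by linarith
  have hpow : 48 * (3 * kpi * (C * r ^ (-(3 / 4) : ℝ))) * r ≤ c / 4 := by
    refine le_of_eq_of_le ?_ hrc
    have : r ^ (1 / 4 : ℝ) = r ^ (-(3 / 4) : ℝ) * r := by
      rw [← Real.rpow_add_one hr0.ne']
      norm_num
    rw [this]
    ring
  have hexp : ∀ᶠ t in 𝓝[<] T, q + 7 / 8 * (1 - q) < Real.exp (6 * kpi / r * (t - T)) := by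
    have h1 : Tendsto (fun t => Real.exp (6 * kpi / r * (t - T))) (𝓝 T)
        (𝓝 (Real.exp (6 * kpi / r * (T - T)))) :=
      (by fun_prop : Continuous fun t => Real.exp (6 * kpi / r * (t - T))).tendsto T
    rw [sub_self, mul_zero, Real.exp_zero] at h1
    exact (h1.mono_left nhdsWithin_le_nhds).eventually_const_lt (by linarith)
  refine ⟨c / 8 * r / M₂, by positivity, ?_⟩
  filter_upwards [hexp, Ioo_mem_nhdsLT (show T - r < T by linarith)] with u hE hu
  have huT : u ∈ Ioo 0 T := ⟨by linarith [hu.1], hu.2⟩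
  have hsT : T - r ∈ Ioo 0 T := ⟨by linarith, by linarith⟩
  have key := h.lyapunov_le hdom hM₁ hM₂ hr0 hr1 (by linarith) (s := T - r) (by linarith) hu.1.le
    hu.2
  have eq : 6 * kpi / r * (T - r - T) = -(6 * kpi) := by field_simp; ring
  rw [eq] at key
  change q * _ - _ + _ ≤ _ at key
  have hWle := hW (T - r) u (by linarith) hu.1.le hu.2
  have hW3 : 3 / R * ((lint f p defect u + kpi * M₁ * u) -
      (lint f p defect (T - r) + kpi * M₁ * (T - r))) ≤ c / 4 := by
    calc _ ≤ 3 / R * (R * c / 12) := by gcongr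
      _ = c / 4 := by field_simp; norm_num
  have hX0 : 0 ≤ lint f p (fun x => Real.log (R + defect x) - Real.log (r + defect x)) u :=
    h.lint_nonneg huT (isTest_log hr0 hR0).continuous fun x => by
      have := (defect_mem x).1
      exact sub_nonneg.2 (Real.log_le_log (by linarith) (by linarith))
  have hX1 := h.lint_log_le hC hdom (t := T - r) ⟨by linarith, by linarith⟩ hr0 hrR hR.2
  have hN0 : 0 ≤ rint f p (fun x => defect x * (r + defect x)⁻¹) (T - r) :=
    h.rint_nonneg hsT (isTest_ratio hr0).continuous fun x => by
      have := (defect_mem x).1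
      positivity
  have hN1 : 0 ≤ rint f p (fun x => defect x * (r + defect x)⁻¹) u :=
    h.rint_nonneg huT (isTest_ratio hr0).continuous fun x => by
      have := (defect_mem x).1
      positivity
  have hEle : Real.exp (6 * kpi / r * (u - T)) ≤ 1 := Real.exp_le_one_iff.2
    (mul_nonpos_of_nonneg_of_nonpos (by positivity) (by linarith [hu.2]))
  have hEN : Real.exp (6 * kpi / r * (u - T)) *
      rint f p (fun x => defect x * (r + defect x)⁻¹) u ≤
      1 * rint f p (fun x => defect x * (r + defect x)⁻¹) u := by gcongr
  have hqN := mul_nonneg hq0.le hN0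
  have hmain : 7 / 8 * c ≤ (Real.exp (6 * kpi / r * (u - T)) - q) * ((1 - r) * M₂ / 6) := by
    calc 7 / 8 * c = (7 / 8 * (1 - q)) * ((1 / 2) * M₂ / 6) := by rw [hcdef]; ring
      _ ≤ _ := by gcongr <;> linarith
  have hBr : 48 * (3 * kpi * (C * r ^ (-(3 / 4) : ℝ))) * (u - (T - r)) ≤
      48 * (3 * kpi * (C * r ^ (-(3 / 4) : ℝ))) * r := by
    have := Real.rpow_nonneg hr0.le (-(3 / 4) : ℝ)
    gcongr
    linarith [hu.2]
  -- The gain is at least `7c/8`, and the three costs (initial potential, its diffusive growth,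
  -- increment of `V`) are at most `c/4` each.
  have hNc : c / 8 ≤ rint f p (fun x => defect x * (r + defect x)⁻¹) u := by
    linarith
  have hfin := hNc.trans (h.rint_ratio_le huT hr0 (hM₂ u huT))
  rw [div_le_iff₀ hM₂0]
  calc c / 8 * r ≤ defect (p u) * r⁻¹ * M₂ * r := by gcongr
    _ = _ := by field_simp

/-- The free boundary does not approach the right end point at the final time. -/
lemma exists_eventually_le (h : IsFreeBoundary T f p lam j) :
    ∃ ε : ℝ, 0 < ε ∧ ∀ᶠ t in 𝓝[<] T, p t ≤ 1 - ε := by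
  obtain ⟨d, hd, hev⟩ := h.exists_le_defect
  have h1 : ∀ᶠ x in 𝓝 (1 : ℝ), defect x < d :=
    continuous_defect.continuousAt.eventually_lt_const (by rwa [defect_one])
  obtain ⟨ε, hε, hball⟩ := Metric.eventually_nhds_iff.1 h1
  refine ⟨ε, hε, ?_⟩
  filter_upwards [hev, Ioo_mem_nhdsLT h.pos_time] with t ht htT
  by_contra! hlt
  have := hball (y := p t) (by
    rw [Real.dist_eq, abs_lt]
    constructor <;> linarith [(h.mem t htT).2])
  linarith

end IsFreeBoundary

/-! ### Bounds on the whole time interval and conclusion -/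

lemma exists_pos_le_of_eventually {g : ℝ → ℝ} {T : ℝ} (hg : ∀ t ∈ Ico 0 T, 0 < g t)
    (hc : ∀ t ∈ Ioo 0 T, ContinuousAt g t)
    (h0 : ∃ ε : ℝ, 0 < ε ∧ ∀ᶠ t in 𝓝[>] (0 : ℝ), ε ≤ g t)
    (h1 : ∃ ε : ℝ, 0 < ε ∧ ∀ᶠ t in 𝓝[<] T, ε ≤ g t) :
    ∃ ε : ℝ, 0 < ε ∧ ∀ t ∈ Ico 0 T, ε ≤ g t := by
  rcases le_or_gt T 0 with hT | hT
  · exact ⟨1, one_pos, fun t ht => absurd (ht.1.trans_lt ht.2) hT.not_gt⟩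
  obtain ⟨ε₀, hε₀, h0⟩ := h0
  obtain ⟨ε₁, hε₁, h1⟩ := h1
  obtain ⟨u, hu, h0⟩ := (mem_nhdsGT_iff_exists_Ioo_subset' (one_pos (α := ℝ))).1 h0
  obtain ⟨v, hv, h1⟩ := (mem_nhdsLT_iff_exists_Ioo_subset' hT).1 h1
  have hu : 0 < u := hu
  have hv : v < T := hv
  have hsub : ∀ t ∈ Icc (u / 2) ((max v 0 + T) / 2), t ∈ Ioo 0 T := fun t ht =>
    ⟨by linarith [ht.1], by linarith [ht.2, max_lt hv hT]⟩
  obtain ⟨ε₂, hε₂, h2⟩ := isCompact_Icc.exists_forall_le'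
    (fun t ht => (hc t (hsub t ht)).continuousWithinAt)
    (fun t ht => hg t ⟨(hsub t ht).1.le, (hsub t ht).2⟩)
  refine ⟨min (min ε₀ ε₁) (min ε₂ (g 0)), by
    have := hg 0 ⟨le_rfl, hT⟩
    simp only [lt_min_iff]
    exact ⟨⟨hε₀, hε₁⟩, hε₂, this⟩, fun t ht => ?_⟩
  rcases ht.1.eq_or_lt with rfl | ht0
  · exact (min_le_right _ _).trans (min_le_right _ _)
  rcases lt_or_ge t u with htu | htu
  · exact ((min_le_left _ _).trans (min_le_left _ _)).trans (h0 ⟨ht0, htu⟩)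
  rcases lt_or_ge v t with htv | htv
  · exact ((min_le_left _ _).trans (min_le_right _ _)).trans (h1 ⟨htv, ht.2⟩)
  · exact ((min_le_right _ _).trans (min_le_left _ _)).trans (h2 t
      ⟨by linarith, by linarith [le_max_left v 0, max_lt hv hT]⟩)

namespace IsSolution

variable {κ a T : ℝ} {fI : ℝ → ℝ} {f : ℝ → ℝ → ℝ} {p : ℝ → ℝ} {pI : ℝ}

/-- The strict signs of the datum at `b` and `c` persist for small times because it is attained in
the limit, and the signs of `f(·,t)` on either side of `p t` then confine `p t`. -/
lemma eventually_mem_Ioo_initial (h : IsSolution κ a fI T f p) (hT : 0 < T)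
    (hκ₀ : 0 < κ) (hκ₁ : κ ≤ 1)
    (ha₀ : 0 < a) (hI : IsInitialDatum a fI pI) {b c : ℝ} (hb : b ∈ Ioo (-1) pI) (hc : c ∈ Ioo pI 1) :
    ∀ᶠ t in 𝓝[>] (0 : ℝ), p t ∈ Ioo b c := by
  have hb' : b ∈ Icc (-1 : ℝ) 1 := ⟨hb.1.le, by linarith [hb.2, hI.zero_mem.2]⟩
  have hc' : c ∈ Icc (-1 : ℝ) 1 := ⟨by linarith [hc.1, hI.zero_mem.1], hc.2.le⟩
  have hlim := fun x hx => (h.tendsto_initial.tendsto_at (x := x) hx)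
  have hcont : ∀ t ∈ Ioo 0 T, ContinuousOn (fun x => f x t) (Icc (-1) 1) := fun _ ht =>
    h.continuousOn_space hκ₀ hκ₁ ha₀ hI.contDiffOn.continuousOn ht
  filter_upwards [(hlim b hb').eventually_const_lt (hI.pos_left b hb' hb.2),
    (hlim c hc').eventually_lt_const (hI.neg_right c hc' hc.1), Ioo_mem_nhdsGT hT] with t h1 h2 ht
  constructor
  · by_contra! hle
    rcases hle.lt_or_eq with hlt | heq
    · exact (h.neg_right ht (hcont t ht) hb'.2 hlt).not_gt h1
    · exact h1.ne' ((h.zero_iff t ⟨ht.1.le, ht.2⟩ b hb').2 heq.symm)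
  · by_contra! hle
    rcases hle.lt_or_eq with hlt | heq
    · exact (h.pos_left ht (hcont t ht) hc'.1 hlt).not_gt h2
    · exact h2.ne ((h.zero_iff t ⟨ht.1.le, ht.2⟩ c hc').2 heq)

lemma isFreeBoundary (h : IsSolution κ a fI T f p) (hκ₀ : 0 < κ) (hκ₁ : κ ≤ 1) (ha₀ : 0 < a)
    (hT : 0 < T) (hI : ContinuousOn fI (Icc (-1) 1)) :
    IsFreeBoundary T f p (flux f p) fun t => jump κ a (p t) where
  pos_time := hT
  mem t ht := h.mem t ⟨ht.1.le, ht.2⟩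
  jump_pos t ht := PriceFormation.jump_pos hκ₀ ha₀ (h.mem t ⟨ht.1.le, ht.2⟩)
  jump_le_right t ht := (jump_le hκ₁ (h.mem t ⟨ht.1.le, ht.2⟩)).1
  jump_le_left t ht := (jump_le hκ₁ (h.mem t ⟨ht.1.le, ht.2⟩)).2
  flux_pos := h.flux_pos
  continuousOn _ ht := h.continuousOn_space hκ₀ hκ₁ ha₀ hI ht
  pos _ ht _ hx hxp := h.pos_left ht (h.continuousOn_space hκ₀ hκ₁ ha₀ hI ht) hx hxp
  neg _ ht _ hx hxp := h.neg_right ht (h.continuousOn_space hκ₀ hκ₁ ha₀ hI ht) hx hxp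
  left _ ht _ hψ := h.hasDerivAt_left hκ₀ hκ₁ ha₀ hI hψ ht
  right _ ht _ hψ := h.hasDerivAt_right hκ₀ hκ₁ ha₀ hI hψ ht

lemma exists_mem_Icc (h : IsSolution κ a fI T f p) (hT : 0 < T) (hκ₀ : 0 < κ) (hκ₁ : κ ≤ 1)
    (ha₀ : 0 < a) (hI : IsInitialDatum a fI pI) :
    ∃ ε : ℝ, 0 < ε ∧ ∀ t ∈ Ico 0 T, p t ∈ Icc (-1 + ε) (1 - ε) := by
  have hF := h.isFreeBoundary hκ₀ hκ₁ ha₀ hT hI.contDiffOn.continuousOn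
  have hz := hI.zero_mem
  have h0 := h.eventually_mem_Ioo_initial hT hκ₀ hκ₁ ha₀ hI (b := (pI - 1) / 2)
    (c := (pI + 1) / 2) ⟨by linarith [hz.1], by linarith [hz.1]⟩
    ⟨by linarith [hz.2], by linarith [hz.2]⟩
  obtain ⟨ε₁, hε₁, h1⟩ := exists_pos_le_of_eventually (g := fun t => 1 - p t) (T := T)
    (fun t ht => sub_pos.2 (h.mem t ht).2)
    (fun t ht => continuousAt_const.sub (h.continuousAt_free_boundary ht))
    ⟨(1 - pI) / 2, by linarith [hz.2], h0.mono fun t ht => by linarith [ht.2]⟩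
    (by
      obtain ⟨ε, hε, hev⟩ := hF.exists_eventually_le
      exact ⟨ε, hε, hev.mono fun t ht => by linarith⟩)
  obtain ⟨ε₂, hε₂, h2⟩ := exists_pos_le_of_eventually (g := fun t => 1 + p t) (T := T)
    (fun t ht => by linarith [(h.mem t ht).1])
    (fun t ht => continuousAt_const.add (h.continuousAt_free_boundary ht))
    ⟨(1 + pI) / 2, by linarith [hz.1], h0.mono fun t ht => by linarith [ht.1]⟩
    (by
      obtain ⟨ε, hε, hev⟩ := hF.reflect.exists_eventually_le
      exact ⟨ε, hε, hev.mono fun t ht => by linarith⟩)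
  refine ⟨min ε₁ ε₂, lt_min hε₁ hε₂, fun t ht => ?_⟩
  have := h1 t ht
  have := h2 t ht
  have := min_le_left ε₁ ε₂
  have := min_le_right ε₁ ε₂
  constructor <;> linarith

end IsSolution

end PriceFormation

theorem mainTheorem5 (κ a : ℝ) (hκ₀ : 0 < κ) (hκ₁ : κ ≤ 1) (ha₀ : 0 < a) (ha₁ : a < 1)
    (fI : ℝ → ℝ) (pI : ℝ) (hI : PriceFormation.IsInitialDatum a fI pI)
    (T : ℝ) (hT : 0 < T) (f : ℝ → ℝ → ℝ) (p : ℝ → ℝ)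
    (hsol : PriceFormation.IsSolution κ a fI T f p) :
    ∃ ε : ℝ, 0 < ε ∧
      (∀ t ∈ Ico 0 T, p t ∈ Icc (-1 + ε) (1 - ε)) ∧
      (∀ q : ℝ, MapClusterPt q (𝓝[<] T) p → q ∈ Icc (-1 + ε) (1 - ε)) := by
  obtain ⟨ε, hε, h⟩ := hsol.exists_mem_Icc hT hκ₀ hκ₁ ha₀ hI
  refine ⟨ε, hε, h, fun q hq => ?_⟩
  have hev : ∀ᶠ t in 𝓝[<] T, p t ∈ Icc (-1 + ε) (1 - ε) :=
    mem_of_superset (Ioo_mem_nhdsLT hT) fun t ht => h t ⟨ht.1.le, ht.2⟩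
  exact isClosed_Icc.mem_of_mapClusterPt hq hev
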